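/- Let $n\ge 3$, $s\in(\tfrac12,1)$, let $\mathscr E\subset\mathbb S^{n-1}$ be a finite set, let $\varphi_0\in C_c^\infty((-2,2),[0,1])$ be even with $\varphi_0=1$ on $[-1,1]$, and let $\psi:\mathbb R\to[0,1]$ be smooth, supported in $[-2,2]$ and equal to $1$ on $[-1,1]$. Let $\mathcal F f(\zeta)=\hat f(\zeta)=\int e^{-i\zeta\cdot x}f(x)\,dx$, with space-time frequency variable $(\xi,\tau)\in\mathbb R^n\times\mathbb R$. Put $\varphi(r)=\varphi_0(r)-\varphi_0(2r)$ and $\varphi_k(r)=\varphi(r/2^k)$ for $k\ge1$. Let $\Delta_k$ $(k\ge 0)$ be the Fourier multiplier with symbol $\varphi_k(|\xi|)$ and $Q_j$ $(j\ge0)$ the one with symbol $\varphi_j(\tau+|\xi|^{2s})$. The operators $i\partial_t-(-\Delta)^s+i$ and $e^{-it(-\Delta)^s}$ have the symbols $-(\tau+|\xi|^{2s})+i$ and $e^{-it|\xi|^{2s}}$. Let $I_0=[0,2]$, $I_m=[2^{m-1},2^{m+1}]$ for $m\ge1$, $$D_{k,j}=\{(\xi,\tau): |\xi|\in I_k,\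 |\tau+|\xi|^{2s}|\in I_j\},\qquad D_{k,\infty}=\bigcup_{j\ge0}D_{k,j},$$ $$D^{e,k'}_{k,\le J}=\Big\{(\xi,\tau)\in\bigcup_{0\le j\le J}D_{k,j}:\ \langle\xi,e\rangle\in[2^{k'-1},2^{k'+1}]\Big\}.$$ For $f:\mathbb R^{n+1}\to\mathbb C$ define $$\|f\|_{X_k}=\sum_{j\ge0}2^{j/2}\|Q_jf\|_{L^2_{t,x}}\ \text{ if }\operatorname{supp}\hat f\subset D_{k,\infty},\qquad \|f\|_{X_k}=\infty\ \text{ otherwise},$$ and, for $k\ge100$, integers $1\le k'\le k+1$ and $e\in\mathscr E$, $$\|f\|_{Y^e_{k,k'}}=2^{-k'\frac{2s-1}{2}}\,2^{2n(k-k')}\,\|(i\partial_t-(-\Delta)^s+i)f\|_{L^1_eL^2_{t,e^\perp}}\ \text{ if }\operatorname{supp}\hat f\subset D^{e,k'}_{k,\le 2sk+10},\qquad \infty\ \text{ otherwise}.$$ Let $Z_k=X_k+\sum_{e\in\mathscr E}\sum_{k'=1}^{k+1}Y^e_{k,k'}$ with the infimum norm over decompositions ($Z_k=X_k$ for $k<100$).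 Set $$\|u\|_{F^\sigma}=\sum_{k\ge0}2^{k\sigma}\|\Delta_ku\|_{Z_k},\qquad \|F\|_{N^\sigma}=\sum_{k\ge0}2^{k\sigma}\|(i\partial_t-(-\Delta)^s+i)^{-1}\Delta_kF\|_{Z_k},\qquad \|f_0\|_{B^\sigma_{2,1}}=\sum_{k\ge0}2^{k\sigma}\|\Delta_kf_0\|_{L^2(\mathbb R^n)}.$$ Then there is a constant $C$, depending only on $n,s,\mathscr E,\varphi_0,\psi$, such that for every $\sigma\ge0$: 1. for every $f_0\in B^\sigma_{2,1}(\mathbb R^n)$, $$\|\psi(t)e^{-it(-\Delta)^s}f_0\|_{F^\sigma}\le C\|f_0\|_{B^\sigma_{2,1}};$$ 2. for every tempered distribution $F$ on $\mathbb R^{n}\times\mathbb R$ with $\|F\|_{N^\sigma}<\infty$, the function $f(x,t)=i\psi(t)\int_0^te^{-i(t-r)(-\Delta)^s}F(x,r)\,dr$ is a well-defined element of $L^2(\mathbb R^{n+1})$ and $$\|f\|_{F^\sigma}\le C\|F\|_{N^\sigma}\qquad\text{and}\qquad\|f\|_{N^\sigma}\le C\|F\|_{N^\sigma}.$$ (Such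 an $F$ has a function $\hat F(\xi,\tau)$ as its Fourier transform, and the integral is understood through its spatial Fourier transform $\frac1{2\pi}\int_{\mathbb R}\hat F(\xi,\tau)\int_0^te^{-i(t-r)|\xi|^{2s}}e^{ir\tau}\,dr\,d\tau$, which converges absolutely for almost every $\xi$ and every $t$.) -/

import Mathlib

open MeasureTheory FourierTransform SchwartzMap
open scoped ENNReal NNReal ContDiff

noncomputable section

namespace SMap

/-! Mathlib's Fourier transform is `𝓕 f ζ = ∫ exp (-2πi ⟨ζ, x⟩) f x dx`.  Its value at `ζ` is the value
at `2πζ` of the transform with kernel `exp (-i ⟨ζ, x⟩)`.  All symbols and all frequency sets below are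
written in the variable `2πζ`, so that they are the symbols and sets for the kernel `exp (-i ⟨ζ, x⟩)`. -/

/-- Physical space `ℝⁿ`. -/
abbrev Space (n : ℕ) : Type := EuclideanSpace ℝ (Fin n)

/-- Space-time `ℝⁿ × ℝ` with its Euclidean structure; the first component is the space variable `x`
(or `ξ`), the second one is the time variable `t` (or `τ`). -/
abbrev SpaceTime (n : ℕ) : Type := WithLp 2 (Space n × ℝ)

/-- Complex valued `L²` functions on space-time. -/
abbrev L2ST (n : ℕ) : Type := Lp (α := SpaceTime n) ℂ 2

/-- Complex valued `L²` functions on `ℝⁿ`. -/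
abbrev L2S (n : ℕ) : Type := Lp (α := Space n) ℂ 2

/-- The point `(x, t)` of space-time. -/
abbrev pt {n : ℕ} (x : Space n) (t : ℝ) : SpaceTime n := WithLp.toLp 2 (x, t)

/-- The Fourier multiplier operator `f ↦ 𝓕⁻¹ (m 𝓕 f)` on `L²`, for those `f` for which
`m 𝓕 f` is again in `L²` (which is every `f` if `m` is bounded and measurable). -/
def l2Multiplier {V : Type*} [NormedAddCommGroup V] [InnerProductSpace ℝ V]
    [FiniteDimensional ℝ V] [MeasurableSpace V] [BorelSpace V]
    (m : V → ℂ) (f : Lp ℂ 2 (volume : Measure V)) : Lp ℂ 2 (volume : Measure V) :=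
  open Classical in
  if h : MemLp (fun ζ => m ζ * (𝓕 f : Lp ℂ 2 (volume : Measure V)) ζ) 2 (volume : Measure V) then
    𝓕⁻ (h.toLp _)
  else 0

/-! ### Littlewood-Paley cut-offs -/

/-- `φ₀` is a Littlewood-Paley bump function. -/
structure IsBump (φ₀ : ℝ → ℝ) : Prop where
  smooth : ContDiff ℝ ∞ φ₀
  supp : tsupport φ₀ ⊆ Set.Ioo (-2) 2
  range : ∀ r, φ₀ r ∈ Set.Icc (0 : ℝ) 1
  eq_one : ∀ r ∈ Set.Icc (-1 : ℝ) 1, φ₀ r = 1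
  even : ∀ r, φ₀ (-r) = φ₀ r

/-- The dyadic cut-offs: `φ₀` for `k = 0`, and `φ (r / 2 ^ k)` with `φ r = φ₀ r - φ₀ (2 r)` for
`k ≥ 1`.  Their sum over `k ≥ 0` is `1`. -/
def dyadic (φ₀ : ℝ → ℝ) (k : ℕ) (r : ℝ) : ℝ :=
  if k = 0 then φ₀ r else φ₀ (r / 2 ^ k) - φ₀ (2 * (r / 2 ^ k))

/-- `|ξ| ^ (2 s)` at the frequency `2πξ`. -/
def disp {n : ℕ} (s : ℝ) (ξ : Space n) : ℝ := ‖(2 * Real.pi) • ξ‖ ^ (2 * s)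

/-- The modulation `τ + |ξ| ^ (2 s)` at the frequency `2π(ξ, τ)`. -/
def modulation {n : ℕ} (s : ℝ) (ζ : SpaceTime n) : ℝ := 2 * Real.pi * ζ.snd + disp s ζ.fst

/-- The frequency projection `Δₖ` on `L²(ℝⁿ)`. -/
def freqProjS {n : ℕ} (φ₀ : ℝ → ℝ) (k : ℕ) (f : L2S n) : L2S n :=
  l2Multiplier (fun ξ => (dyadic φ₀ k ‖(2 * Real.pi) • ξ‖ : ℂ)) f

/-- The spatial frequency projection `Δₖ` on `L²(ℝⁿ × ℝ)`. -/
def freqProj {n : ℕ} (φ₀ : ℝ → ℝ) (k : ℕ) (f : L2ST n) : L2ST n :=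
  l2Multiplier (fun ζ => (dyadic φ₀ k ‖(2 * Real.pi) • ζ.fst‖ : ℂ)) f

/-- The modulation projection `Qⱼ` on `L²(ℝⁿ × ℝ)`. -/
def modProj {n : ℕ} (φ₀ : ℝ → ℝ) (s : ℝ) (j : ℕ) (f : L2ST n) : L2ST n :=
  l2Multiplier (fun ζ => (dyadic φ₀ j (modulation s ζ) : ℂ)) f

/-- The symbol `-(τ + |ξ| ^ (2 s)) + i` of `i ∂ₜ - (-Δ) ^ s + i`. -/
def symb {n : ℕ} (s : ℝ) (ζ : SpaceTime n) : ℂ := -(modulation s ζ : ℂ) + Complex.I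

/-! ### Besov norm and resolution spaces -/

/-- The norm of the inhomogeneous Besov space `B^σ_{2,1}(ℝⁿ)`; for `σ ≥ 0` this space is contained
in `L²`. -/
def besovNorm {n : ℕ} (φ₀ : ℝ → ℝ) (σ : ℝ) (f : L2S n) : ℝ≥0∞ :=
  ∑' k : ℕ, (2 : ℝ≥0∞) ^ ((k : ℝ) * σ) * ‖freqProjS φ₀ k f‖ₑ

/-- The dyadic intervals `I₀ = [0, 2]` and `Iₘ = [2 ^ (m - 1), 2 ^ (m + 1)]` for `m ≥ 1`. -/
def dyadicInterval (m : ℕ) : Set ℝ :=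
  if m = 0 then Set.Icc 0 2 else Set.Icc ((2 : ℝ) ^ ((m : ℝ) - 1)) ((2 : ℝ) ^ ((m : ℝ) + 1))

/-- The points `ζ` with `2πζ ∈ D_{k,j}`. -/
def regionD {n : ℕ} (s : ℝ) (k j : ℕ) : Set (SpaceTime n) :=
  {ζ | ‖(2 * Real.pi) • ζ.fst‖ ∈ dyadicInterval k ∧ |modulation s ζ| ∈ dyadicInterval j}

/-- The points `ζ` with `2πζ ∈ D_{k,∞} = ⋃ⱼ D_{k,j}`. -/
def regionX {n : ℕ} (s : ℝ) (k : ℕ) : Set (SpaceTime n) := ⋃ j : ℕ, regionD s k j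

/-- The points `ζ` with `2πζ ∈ D^{e,k'}_{k,≤ 2sk+10}`. -/
def regionY {n : ℕ} (s : ℝ) (k k' : ℕ) (e : Space n) : Set (SpaceTime n) :=
  {ζ | (∃ j : ℕ, (j : ℝ) ≤ 2 * s * k + 10 ∧ ζ ∈ regionD s k j) ∧
    inner ℝ ((2 * Real.pi) • ζ.fst) e ∈
      Set.Icc ((2 : ℝ) ^ ((k' : ℝ) - 1)) ((2 : ℝ) ^ ((k' : ℝ) + 1))}

/-- The Fourier transform of `f` is supported in the closed set `A`. -/
def FourierSupportedIn {n : ℕ} (f : L2ST n) (A : Set (SpaceTime n)) : Prop :=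
  ∀ᵐ ζ : SpaceTime n, ζ ∉ A → (𝓕 f : L2ST n) ζ = 0

/-- The norm of `Xₖ`. -/
def xNorm {n : ℕ} (φ₀ : ℝ → ℝ) (s : ℝ) (k : ℕ) (f : L2ST n) : ℝ≥0∞ :=
  open Classical in
  if FourierSupportedIn f (regionX s k) then
    ∑' j : ℕ, (2 : ℝ≥0∞) ^ ((j : ℝ) / 2) * ‖modProj φ₀ s j f‖ₑ
  else ⊤

/-- The norm of `L¹_e L²_{t,e^⊥}`. -/
def lateralNorm {n : ℕ} (e : Space n) (f : L2ST n) : ℝ≥0∞ :=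
  ∫⁻ a : ℝ, (∫⁻ t : ℝ, ∫⁻ y : ↥(ℝ ∙ e)ᗮ, ‖f (pt (a • e + (y : Space n)) t)‖ₑ ^ 2) ^ (1 / 2 : ℝ)

/-- The norm of `Y^e_{k,k'}`, with the weight `γ_{k,k'} = 2 ^ (2n(k - k'))`. -/
def yNorm {n : ℕ} (s : ℝ) (k k' : ℕ) (e : Space n) (f : L2ST n) : ℝ≥0∞ :=
  open Classical in
  if FourierSupportedIn f (regionY s k k' e) then
    (2 : ℝ≥0∞) ^ (-(k' : ℝ) * ((2 * s - 1) / 2)) * (2 : ℝ≥0∞) ^ (2 * (n : ℝ) * ((k : ℝ) - k')) *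
      lateralNorm e (l2Multiplier (symb s) f)
  else ⊤

/-- The indices `k'` of the spaces `Y^e_{k,k'}`: `1 ≤ k' ≤ k + 1` if `k ≥ 100`, none otherwise. -/
def yIndices (k : ℕ) : Finset ℕ := if 100 ≤ k then Finset.Icc 1 (k + 1) else ∅

/-- The norm of `Zₖ = Xₖ + ∑ₑ ∑ₖ' Y^e_{k,k'}`: the infimum over all decompositions (`⊤` if no
decomposition has finite norm).  All the summands are contained in `L²`. -/
def zNorm {n : ℕ} (φ₀ : ℝ → ℝ) (s : ℝ) (𝓔 : Finset (Space n)) (k : ℕ) (f : L2ST n) : ℝ≥0∞ :=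
  ⨅ (f₁ : L2ST n) (g : Space n → ℕ → L2ST n)
    (_ : f = f₁ + ∑ e ∈ 𝓔, ∑ k' ∈ yIndices k, g e k'),
    xNorm φ₀ s k f₁ + ∑ e ∈ 𝓔, ∑ k' ∈ yIndices k, yNorm s k k' e (g e k')

/-- The norm of `F^σ`; for `σ ≥ 0` this space is contained in `L²`. -/
def fNorm {n : ℕ} (φ₀ : ℝ → ℝ) (s : ℝ) (𝓔 : Finset (Space n)) (σ : ℝ) (u : L2ST n) : ℝ≥0∞ :=
  ∑' k : ℕ, (2 : ℝ≥0∞) ^ ((k : ℝ) * σ) * zNorm φ₀ s 𝓔 k (freqProj φ₀ k u)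

/-- The tempered distribution `T` is given by the function `G`. -/
def Represents {n : ℕ} (T : 𝓢'(SpaceTime n, ℂ)) (G : SpaceTime n → ℂ) : Prop :=
  AEStronglyMeasurable G ∧
    ∀ θ : 𝓢(SpaceTime n, ℂ), Integrable (fun ζ => θ ζ * G ζ) ∧ T θ = ∫ ζ, θ ζ * G ζ

/-- `h = (i ∂ₜ - (-Δ) ^ s + i)⁻¹ Δₖ F`. -/
def IsResolventBlock {n : ℕ} (φ₀ : ℝ → ℝ) (s : ℝ) (k : ℕ) (F : 𝓢'(SpaceTime n, ℂ))
    (h : L2ST n) : Prop :=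
  ∃ G : SpaceTime n → ℂ, Represents (𝓕 F) G ∧
    ∀ᵐ ζ : SpaceTime n, (𝓕 h : L2ST n) ζ =
      (symb s ζ)⁻¹ * ((dyadic φ₀ k ‖(2 * Real.pi) • ζ.fst‖ : ℂ) * G ζ)

/-- The norm of `N^σ` of a tempered distribution.  It is `⊤` if some
`(i ∂ₜ - (-Δ) ^ s + i)⁻¹ Δₖ F` is not in `Zₖ`; in particular, as `Zₖ ⊆ L²`, it is `⊤` if the
Fourier transform of `F` is not a function. -/
def nNorm {n : ℕ} (φ₀ : ℝ → ℝ) (s : ℝ) (𝓔 : Finset (Space n)) (σ : ℝ)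
    (F : 𝓢'(SpaceTime n, ℂ)) : ℝ≥0∞ :=
  ∑' k : ℕ, (2 : ℝ≥0∞) ^ ((k : ℝ) * σ) *
    ⨅ (h : L2ST n) (_ : IsResolventBlock φ₀ s k F h), zNorm φ₀ s 𝓔 k h

/-! ### Free evolution and Duhamel term -/

/-- `ψ : ℝ → [0, 1]` is smooth, supported in `[-2, 2]` and equal to `1` on `[-1, 1]`. -/
structure IsTimeCutoff (ψ : ℝ → ℝ) : Prop where
  smooth : ContDiff ℝ ∞ ψ
  supp : tsupport ψ ⊆ Set.Icc (-2) 2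
  range : ∀ t, ψ t ∈ Set.Icc (0 : ℝ) 1
  eq_one : ∀ t ∈ Set.Icc (-1 : ℝ) 1, ψ t = 1

/-- The free evolution `e^{-it(-Δ)^s}` of `i ∂ₜ - (-Δ) ^ s`, on `L²(ℝⁿ)`. -/
def propagator {n : ℕ} (s t : ℝ) (f : L2S n) : L2S n :=
  l2Multiplier (fun ξ => Complex.exp (-(Complex.I * t * disp s ξ))) f

/-- `u(x, t) = ψ(t) (e^{-it(-Δ)^s} f₀)(x)`. -/
def IsCutoffFree {n : ℕ} (s : ℝ) (ψ : ℝ → ℝ) (f₀ : L2S n) (u : L2ST n) : Prop :=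
  ∀ᵐ t : ℝ, ∀ᵐ x : Space n, u (pt x t) = (ψ t : ℂ) * propagator s t f₀ x

/-- The Duhamel integral `∫₀ᵗ e^{-i(t-r)(-Δ)^s} e^{irτ} dr` of a pure time oscillation, at the
frequency `2π(ξ, τ)`. -/
def duhamelKernel {n : ℕ} (s t : ℝ) (ζ : SpaceTime n) : ℂ :=
  ∫ r in (0 : ℝ)..t, Complex.exp (-(Complex.I * (t - r) * disp s ζ.fst)) *
    Complex.exp (Complex.I * r * (2 * Real.pi * ζ.snd))

/-- The spatial Fourier transform at `ξ` of `∫₀ᵗ e^{-i(t-r)(-Δ)^s} F(r) dr`, where `G` is the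
space-time Fourier transform of `F`.  Elements of `N^σ` can be distributions in time, for which `F(r)`
has no meaning for individual `r`, so `F` is written as a superposition of the oscillations `e^{irτ}`
and the integral over `τ` is taken last.  See `duhamelHat_eq` for the usual order. -/
def duhamelHat {n : ℕ} (s : ℝ) (G : SpaceTime n → ℂ) (t : ℝ) (ξ : Space n) : ℂ :=
  ∫ τ : ℝ, G (pt ξ τ) * duhamelKernel s t (pt ξ τ)

/-- If the time frequency profile is integrable, so that the spatial Fourier transform of `F` at time
`r` is the function `∫ e^{2πirτ} G(ξ, τ) dτ`, then `duhamelHat` is the usual Duhamel integral. -/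
theorem duhamelHat_eq {n : ℕ} (s : ℝ) (G : SpaceTime n → ℂ) (t : ℝ) (ξ : Space n)
    (hG : Integrable (fun τ : ℝ => G (pt ξ τ))) :
    duhamelHat s G t ξ = ∫ r in (0 : ℝ)..t, Complex.exp (-(Complex.I * (t - r) * disp s ξ)) *
      ∫ τ : ℝ, Complex.exp (Complex.I * r * (2 * Real.pi * τ)) * G (pt ξ τ) := by
  have hfin : IsFiniteMeasure ((volume : Measure ℝ).restrict (Set.uIoc 0 t)) :=
    ⟨by simp [Set.uIoc]⟩
  have hint : Integrable (Function.uncurry fun (τ r : ℝ) =>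
      G (pt ξ τ) * (Complex.exp (-(Complex.I * (t - r) * disp s ξ)) *
        Complex.exp (Complex.I * r * (2 * Real.pi * τ))))
      (volume.prod (volume.restrict (Set.uIoc 0 t))) := by
    have h1 : Integrable (fun p : ℝ × ℝ => G (pt ξ p.1) * (1 : ℂ))
        (volume.prod (volume.restrict (Set.uIoc 0 t))) :=
      hG.mul_prod (integrable_const (1 : ℂ))
    refine h1.mono ?_ (Filter.Eventually.of_forall fun p => ?_)
    · have h2 : AEStronglyMeasurable (fun p : ℝ × ℝ => G (pt ξ p.1))
          (volume.prod (volume.restrict (Set.uIoc 0 t))) := by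
        simpa using h1.aestronglyMeasurable
      refine h2.mul (Continuous.aestronglyMeasurable ?_)
      fun_prop
    · have e1 : ‖Complex.exp (-(Complex.I * (t - p.2) * disp s ξ))‖ = 1 := by
        rw [Complex.norm_exp]; simp
      have e2 : ‖Complex.exp (Complex.I * p.2 * (2 * Real.pi * p.1))‖ = 1 := by
        rw [Complex.norm_exp]; simp
      simp only [Function.uncurry, norm_mul, e1, e2, mul_one, le_refl]
  unfold duhamelHat duhamelKernel
  simp only [intervalIntegral.intervalIntegral_eq_integral_uIoc]
  simp only [WithLp.toLp_fst, WithLp.toLp_snd, mul_smul_comm, ← integral_const_mul]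
  rw [integral_smul, integral_integral_swap hint]
  congr 1
  refine integral_congr_ae (Filter.Eventually.of_forall fun r => ?_)
  refine integral_congr_ae (Filter.Eventually.of_forall fun τ => ?_)
  ring

/-- `f(x, t) = i ψ(t) ∫₀ᵗ e^{-i(t-r)(-Δ)^s} F(x, r) dr`. -/
def IsCutoffDuhamel {n : ℕ} (s : ℝ) (ψ : ℝ → ℝ) (F : 𝓢'(SpaceTime n, ℂ)) (f : L2ST n) : Prop :=
  ∃ G : SpaceTime n → ℂ, Represents (𝓕 F) G ∧
    (∀ᵐ ξ : Space n, ∀ t : ℝ,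
      Integrable (fun τ : ℝ => G (pt ξ τ) * duhamelKernel s t (pt ξ τ))) ∧
    ∀ᵐ t : ℝ, ∃ g : L2S n, (∀ᵐ x : Space n, f (pt x t) = g x) ∧
      ∀ᵐ ξ : Space n, (𝓕 g : L2S n) ξ = Complex.I * ψ t * duhamelHat s G t ξ

end SMap

end

/-! Fix a spatial frequency ξ and put w = |ξ|^{2s}. Let V be one block (i∂ₜ - (-Δ)^s + i)⁻¹ Δₖ F,
seen as a function of time at this frequency, and let v be its space-time Fourier transform. Since
the block of F is (i∂ₜ - w + i) V, Duhamel's formula integrates to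

f = -ψ(t) V(t) + ψ(t) e^{-itw} (V(0) - ∫₀ᵗ e^{irw} V(r) dr)

(`I_mul_symb_mul_duhamelKernel`, `duhProfile_eq`). The estimate on Zₖ thus splits into the time
cut-off of V and a free part.

Free part. The `symb`-weighted L² norm of ψ(t) e^{-itw} R(t) is controlled by |R(0)| and the L² norm
of R' (`exists_free_lift`), and this weighted norm dominates the Xₖ norm, because ∑ 2^{j/2} 2^{-j}
converges (`xSum_le_symb`). Here R(0) = V(0) and |R'| = |V|, so only the trace of V at time 0 and
its L² norm are needed (`exists_freePart_lift`). Constant R gives the free evolution, hence the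
first assertion.

X component. On each modulation shell the cut-off is bounded by interpolating between L² and the
weight |modulation| (`xSum_cutoff_le_xSum`). The trace is bounded by Cauchy–Schwarz in τ on each
shell (`lintegral_sq_le_xSum`).

Y component. Let F now denote (i∂ₜ - (-Δ)^s + i) V. Commuting the cut-off with the operator leaves
ψF + iψ'V (`symb_mul_cutoff`). The ψ' term is in L² and so contributes to X. The part of ψF with low
time frequency stays in Y: the projection acts in τ alone, hence is a contraction on L¹_e L² by
Plancherel (`latSum_multiplier_le`). The rest has modulation at least 2^{2sk} and goes to X
(`xSum_div_symb_le`). The L² and trace bounds come from Minkowski's inequality in the variable along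
e and from replacing the frequency along e by |ξ|^{2s} (`lintegral_comp_disp_le`); the factor
2^{2n(k-k')} of the norm pays for the Jacobian (`jacobian_exponent_le`).

Summation. The Duhamel term of a block does not depend on the decomposition in Zₖ, so the bounds
pass to the infimum (`exists_duhOf_zNorm`). For σ ≥ 0 the blocks are summable in L², which produces
f. For the N norm, dividing an L² block by `symb` puts it in Xₖ (`iInf_zNorm_le`), and Zₖ embeds in
L². -/

noncomputable section

namespace SMap

set_option linter.unusedSectionVars false

/-! ### Squares of `L²` norms -/

section Squares

variable {X : Type*} [MeasurableSpace X] {μ : Measure X}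

/-- The square of the `L²` norm. -/
def sqNorm (μ : Measure X) (f : X → ℂ) : ℝ≥0∞ := ∫⁻ x, ‖f x‖ₑ ^ 2 ∂μ

theorem eLpNorm_two_eq (f : X → ℂ) : eLpNorm f 2 μ = (sqNorm μ f) ^ (1 / 2 : ℝ) := by
  rw [eLpNorm_eq_lintegral_rpow_enorm_toReal (by norm_num) (by norm_num)]
  simp [sqNorm]

theorem sqNorm_eq (f : X → ℂ) : sqNorm μ f = (eLpNorm f 2 μ) ^ 2 := by
  rw [eLpNorm_two_eq, ← ENNReal.rpow_natCast, ← ENNReal.rpow_mul]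
  norm_num

theorem memLp_two_iff {f : X → ℂ} :
    MemLp f 2 μ ↔ AEStronglyMeasurable f μ ∧ sqNorm μ f < ⊤ := by
  unfold MemLp
  rw [eLpNorm_two_eq, ENNReal.rpow_lt_top_iff_of_pos (by norm_num)]

theorem sqNorm_congr {f g : X → ℂ} (h : f =ᵐ[μ] g) : sqNorm μ f = sqNorm μ g :=
  lintegral_congr_ae (h.mono fun x hx => by simp only [hx])

theorem enorm_add_sq_le (a b : ℂ) : ‖a + b‖ₑ ^ 2 ≤ 2 * ‖a‖ₑ ^ 2 + 2 * ‖b‖ₑ ^ 2 := by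
  have h : ‖a + b‖ ^ 2 ≤ 2 * ‖a‖ ^ 2 + 2 * ‖b‖ ^ 2 := by
    have h1 := norm_add_le a b
    have h2 := norm_nonneg (a + b)
    nlinarith [sq_nonneg (‖a‖ - ‖b‖)]
  rw [← ofReal_norm, ← ofReal_norm, ← ofReal_norm,
    ← ENNReal.ofReal_pow (norm_nonneg _), ← ENNReal.ofReal_pow (norm_nonneg _),
    ← ENNReal.ofReal_pow (norm_nonneg _)]
  rw [show (2 : ℝ≥0∞) = ENNReal.ofReal 2 by simp, ← ENNReal.ofReal_mul (by norm_num),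
    ← ENNReal.ofReal_mul (by norm_num), ← ENNReal.ofReal_add (by positivity) (by positivity)]
  exact ENNReal.ofReal_le_ofReal h

theorem sqNorm_add_le {f g : X → ℂ} (hf : AEStronglyMeasurable f μ) :
    sqNorm μ (fun x => f x + g x) ≤ 2 * sqNorm μ f + 2 * sqNorm μ g := by
  unfold sqNorm
  rw [← lintegral_const_mul' _ _ (by norm_num), ← lintegral_const_mul' _ _ (by norm_num),
    ← lintegral_add_left' ((hf.enorm.pow_const 2).const_mul 2)]
  exact lintegral_mono fun x => enorm_add_sq_le _ _

theorem sqNorm_eq_zero {f : X → ℂ} (hf : AEStronglyMeasurable f μ) :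
    sqNorm μ f = 0 ↔ f =ᵐ[μ] 0 := by
  unfold sqNorm
  rw [lintegral_eq_zero_iff' (hf.enorm.pow_const 2)]
  constructor <;> intro h <;> filter_upwards [h] with x hx <;> simpa using hx

theorem sqNorm_mono {f g : X → ℂ} (h : ∀ᵐ x ∂μ, ‖f x‖ ≤ ‖g x‖) : sqNorm μ f ≤ sqNorm μ g := by
  refine lintegral_mono_ae (h.mono fun x hx => ?_)
  gcongr
  exact enorm_le_iff_norm_le.2 hx

end Squares

/-! ### The Fourier transform of square integrable functions -/

section IsFT

variable {V : Type*} [NormedAddCommGroup V] [InnerProductSpace ℝ V]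
    [FiniteDimensional ℝ V] [MeasurableSpace V] [BorelSpace V]

/-- `g` is the `L²` Fourier transform of `f`. -/
structure IsFT (f g : V → ℂ) : Prop where
  left : MemLp f 2
  right : MemLp g 2
  eq : 𝓕 (left.toLp f) = right.toLp g

theorem IsFT.of_Lp (f : Lp ℂ 2 (volume : Measure V)) :
    IsFT f (𝓕 f : Lp ℂ 2 (volume : Measure V)) :=
  ⟨Lp.memLp f, Lp.memLp _, by simp⟩

theorem IsFT.of_Lp_inv (g : Lp ℂ 2 (volume : Measure V)) :
    IsFT (𝓕⁻ g : Lp ℂ 2 (volume : Measure V)) g :=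
  ⟨Lp.memLp _, Lp.memLp _, by simp⟩

theorem IsFT.congr {f f' g g' : V → ℂ} (h : IsFT f g) (hf : f =ᵐ[volume] f')
    (hg : g =ᵐ[volume] g') : IsFT f' g' := by
  refine ⟨(memLp_congr_ae hf).1 h.left, (memLp_congr_ae hg).1 h.right, ?_⟩
  have h1 := (MemLp.toLp_eq_toLp_iff h.left ((memLp_congr_ae hf).1 h.left)).2 hf
  have h2 := (MemLp.toLp_eq_toLp_iff h.right ((memLp_congr_ae hg).1 h.right)).2 hg
  rw [← h1, ← h2, h.eq]

theorem IsFT.unique {f f' g g' : V → ℂ} (h : IsFT f g) (h' : IsFT f' g')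
    (hf : f =ᵐ[volume] f') : g =ᵐ[volume] g' := by
  have h1 := (MemLp.toLp_eq_toLp_iff h.left h'.left).2 hf
  rw [← MemLp.toLp_eq_toLp_iff h.right h'.right, ← h.eq, ← h'.eq, h1]

theorem IsFT.unique_left {f f' g g' : V → ℂ} (h : IsFT f g) (h' : IsFT f' g')
    (hg : g =ᵐ[volume] g') : f =ᵐ[volume] f' := by
  have h1 := (MemLp.toLp_eq_toLp_iff h.right h'.right).2 hg
  rw [← MemLp.toLp_eq_toLp_iff h.left h'.left]
  rw [← h.eq, ← h'.eq] at h1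
  have := congrArg (fun u : Lp ℂ 2 (volume : Measure V) => 𝓕⁻ u) h1
  simpa using this

theorem exists_isFT {f : V → ℂ} (hf : MemLp f 2) : ∃ g, IsFT f g :=
  ⟨_, (IsFT.of_Lp (hf.toLp f)).congr hf.coeFn_toLp (Filter.EventuallyEq.refl _ _)⟩

theorem exists_isFT_left {g : V → ℂ} (hg : MemLp g 2) : ∃ f, IsFT f g :=
  ⟨_, (IsFT.of_Lp_inv (hg.toLp g)).congr (Filter.EventuallyEq.refl _ _) hg.coeFn_toLp⟩

theorem IsFT.coe_fourier {f : Lp ℂ 2 (volume : Measure V)} {g : V → ℂ} (h : IsFT f g) :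
    (𝓕 f : Lp ℂ 2 (volume : Measure V)) =ᵐ[volume] g :=
  (IsFT.of_Lp f).unique h (Filter.EventuallyEq.refl _ _)

theorem IsFT.add {f f' g g' : V → ℂ} (h : IsFT f g) (h' : IsFT f' g') :
    IsFT (fun x => f x + f' x) (fun x => g x + g' x) := by
  refine ⟨h.left.add h'.left, h.right.add h'.right, ?_⟩
  have h1 : (h.left.add h'.left).toLp (fun x => f x + f' x) = h.left.toLp f + h'.left.toLp f' :=
    MemLp.toLp_add _ _
  have h2 : (h.right.add h'.right).toLp (fun x => g x + g' x) = h.right.toLp g + h'.right.toLp g' :=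
    MemLp.toLp_add _ _
  rw [h1, h2, FourierTransform.fourier_add, h.eq, h'.eq]

theorem IsFT.const_mul {f g : V → ℂ} (h : IsFT f g) (c : ℂ) :
    IsFT (fun x => c * f x) (fun x => c * g x) := by
  refine ⟨h.left.const_mul c, h.right.const_mul c, ?_⟩
  have h1 : (h.left.const_mul c).toLp (fun x => c * f x) = c • h.left.toLp f :=
    rfl
  have h2 : (h.right.const_mul c).toLp (fun x => c * g x) = c • h.right.toLp g :=
    rfl
  rw [h1, h2, FourierTransform.fourier_smul, h.eq]

theorem IsFT.neg {f g : V → ℂ} (h : IsFT f g) : IsFT (fun x => -f x) (fun x => -g x) := by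
  simpa using h.const_mul (-1)

theorem IsFT.sub {f f' g g' : V → ℂ} (h : IsFT f g) (h' : IsFT f' g') :
    IsFT (fun x => f x - f' x) (fun x => g x - g' x) := by
  simpa [sub_eq_add_neg] using h.add h'.neg

theorem IsFT.zero : IsFT (fun _ : V => (0 : ℂ)) (fun _ => 0) := by
  obtain ⟨g, hg⟩ := exists_isFT (V := V) (f := fun _ => 0) (MemLp.zero)
  simpa using hg.const_mul 0

theorem IsFT.sqNorm_eq {f g : V → ℂ} (h : IsFT f g) : sqNorm volume f = sqNorm volume g := by
  have h1 : ‖h.left.toLp f‖ₑ = ‖h.right.toLp g‖ₑ := by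
    rw [← h.eq, ← ofReal_norm, ← ofReal_norm, Lp.norm_fourier_eq]
  rw [Lp.enorm_toLp, Lp.enorm_toLp] at h1
  rw [SMap.sqNorm_eq, SMap.sqNorm_eq, h1]

theorem integral_schwartz_fourier {f g : V → ℂ} (h : IsFT f g) (θ : 𝓢(V, ℂ)) :
    ∫ x, (𝓕 θ : 𝓢(V, ℂ)) x * f x = ∫ x, θ x * g x := by
  have h1 := congrArg (fun T : 𝓢'(V, ℂ) => T θ)
    (Lp.fourier_toTemperedDistribution_eq (h.left.toLp f))
  simp only [TemperedDistribution.fourier_apply, Lp.toTemperedDistribution_apply, h.eq] at h1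
  calc _ = ∫ x, (𝓕 θ : 𝓢(V, ℂ)) x • (h.left.toLp f) x :=
        integral_congr_ae (h.left.coeFn_toLp.mono fun x hx => by simp only [hx, smul_eq_mul])
    _ = _ := h1
    _ = _ := integral_congr_ae (h.right.coeFn_toLp.mono fun x hx => by
        simp only [hx, smul_eq_mul])

/-- Square integrable functions embed injectively into tempered distributions, so the transform can
be tested on Schwartz functions. -/
theorem IsFT.of_weak {f g : V → ℂ} (hf : MemLp f 2) (hg : MemLp g 2)
    (h : ∀ θ : 𝓢(V, ℂ), ∫ x, (𝓕 θ : 𝓢(V, ℂ)) x * f x = ∫ x, θ x * g x) : IsFT f g := by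
  refine ⟨hf, hg, ?_⟩
  obtain ⟨g', hg'⟩ := exists_isFT hf
  rw [hg'.eq]
  have h1 := LinearMap.ker_eq_bot.1 (Lp.ker_toTemperedDistributionCLM_eq_bot
    (E := V) (F := ℂ) (μ := volume) (p := 2))
  apply h1
  ext θ
  simp only [ContinuousLinearMap.coe_coe, Lp.toTemperedDistributionCLM_apply,
    Lp.toTemperedDistribution_apply]
  calc _ = ∫ x, θ x * g' x := integral_congr_ae (hg'.right.coeFn_toLp.mono fun x hx => by
        simp only [hx, smul_eq_mul])
    _ = ∫ x, θ x * g x := by rw [← integral_schwartz_fourier hg', h]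
    _ = _ := integral_congr_ae (hg.coeFn_toLp.mono fun x hx => by simp only [hx, smul_eq_mul])

/-- The bilinear pairing `∫ f g` on `L²`. -/
def pairing : Lp ℂ 2 (volume : Measure V) →L[ℂ] Lp ℂ 2 (volume : Measure V) →L[ℂ] ℂ :=
  (ContinuousLinearMap.mul ℂ ℂ).lpPairing volume 2 2

theorem pairing_apply (f g : Lp ℂ 2 (volume : Measure V)) : pairing f g = ∫ x, f x * g x := by
  simp [pairing, ContinuousLinearMap.lpPairing_eq_integral]

/-- Both sides are continuous in the second pair for the L² pairing and agree on Schwartz functions,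
which are dense. This form is applied to resolvent kernels, which are not smooth. -/
theorem IsFT.integral_mul_eq {f g f' g' : V → ℂ} (h : IsFT f g) (h' : IsFT f' g') :
    ∫ x, f x * g' x = ∫ x, g x * f' x := by
  have key : ∀ u : Lp ℂ 2 (volume : Measure V),
      pairing (h.left.toLp f) (𝓕 u) = pairing (h.right.toLp g) u := by
    have hd := SchwartzMap.denseRange_toLpCLM (E := V) (F := ℂ) (p := 2) (by norm_num)
      (μ := (volume : Measure V))
    intro u
    refine hd.induction_on (p := fun u => pairing (h.left.toLp f) (𝓕 u) =
      pairing (h.right.toLp g) u) u ?_ ?_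
    · refine isClosed_eq ?_ (pairing _).continuous
      exact (pairing _).continuous.comp (Lp.fourierTransformₗᵢ V ℂ).continuous
    · intro θ
      simp only [SchwartzMap.toLpCLM_apply]
      rw [SchwartzMap.toLp_fourier_eq, pairing_apply, pairing_apply]
      have h1 := integral_schwartz_fourier h θ
      calc _ = ∫ x, (𝓕 θ : 𝓢(V, ℂ)) x * f x := by
            refine integral_congr_ae ?_
            filter_upwards [h.left.coeFn_toLp, (𝓕 θ).coeFn_toLp 2 volume] with x h1 h2
            rw [h1, h2, mul_comm]
        _ = _ := h1
        _ = _ := by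
            refine integral_congr_ae ?_
            filter_upwards [h.right.coeFn_toLp, θ.coeFn_toLp 2 volume] with x h1 h2
            rw [h1, h2, mul_comm]
  have := key (h'.left.toLp f')
  rw [h'.eq, pairing_apply, pairing_apply] at this
  calc _ = _ := integral_congr_ae (by
        filter_upwards [h.left.coeFn_toLp, h'.right.coeFn_toLp] with x h1 h2
        rw [← h1, ← h2])
    _ = _ := this
    _ = _ := integral_congr_ae (by
        filter_upwards [h.right.coeFn_toLp, h'.left.coeFn_toLp] with x h1 h2
        rw [h1, h2])

theorem integral_fourier_mul_eq {f g : V → ℂ} (hf : Integrable f) (hg : Integrable g) :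
    ∫ x, 𝓕 f x * g x = ∫ x, f x * 𝓕 g x := by
  have h := VectorFourier.integral_fourierIntegral_smul_eq_flip (L := innerₗ V)
    (μ := volume) (ν := volume) (e := Real.fourierChar) Real.continuous_fourierChar
    (continuous_inner) hf hg
  rw [flip_innerₗ] at h
  exact h

theorem continuous_fourier {f : V → ℂ} (hf : Integrable f) : Continuous (𝓕 f) :=
  VectorFourier.fourierIntegral_continuous Real.continuous_fourierChar continuous_inner hf

/-- The L² transform and the Fourier integral have the same pairing with every test function, so
they agree almost everywhere. -/
theorem IsFT.of_integrable {f : V → ℂ} (hf : Integrable f) (hf2 : MemLp f 2) :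
    IsFT f (𝓕 f) := by
  obtain ⟨g, hg⟩ := exists_isFT hf2
  refine hg.congr (Filter.EventuallyEq.refl _ _) ?_
  refine ae_eq_of_integral_contDiff_smul_eq (hg.right.locallyIntegrable (by norm_num))
    (continuous_fourier hf).locallyIntegrable ?_
  intro θ hθ hθc
  have hc1 : HasCompactSupport (fun x => (θ x : ℂ)) := hθc.comp_left (g := fun r : ℝ => (r : ℂ)) (by simp)
  have hc2 : ContDiff ℝ ∞ (fun x => (θ x : ℂ)) := Complex.ofRealCLM.contDiff.comp hθ
  set Θ : 𝓢(V, ℂ) := hc1.toSchwartzMap hc2 with hΘ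
  have e1 : ∀ x, Θ x = (θ x : ℂ) := fun x => rfl
  have h1 := integral_schwartz_fourier hg Θ
  have h2 := integral_fourier_mul_eq (f := Θ) (g := f) Θ.integrable hf
  rw [SchwartzMap.fourier_coe] at h1
  rw [h1] at h2
  simpa [e1] using h2

theorem fourier_fourierInv_schwartz_neg (θ : 𝓢(V, ℂ)) (x : V) :
    (𝓕 θ : 𝓢(V, ℂ)) (-x) = (𝓕⁻ θ : 𝓢(V, ℂ)) x := by
  rw [SchwartzMap.fourier_coe, SchwartzMap.fourierInv_coe, Real.fourierInv_eq_fourier_neg]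

/-- Fourier inversion: transforming twice is reflection. It lets statements about the transform be
used for its inverse. -/
theorem IsFT.reflect {f g : V → ℂ} (h : IsFT f g) : IsFT (fun x => g (-x)) f := by
  refine IsFT.of_weak
    (h.right.comp_measurePreserving (Measure.measurePreserving_neg volume)) h.left ?_
  intro θ
  have h1 := integral_schwartz_fourier h (𝓕⁻ θ)
  rw [FourierTransform.fourier_fourierInv_eq] at h1
  rw [h1, ← integral_neg_eq_self]
  simp [fourier_fourierInv_schwartz_neg]

theorem IsFT.comp_isometry {W : Type*} [NormedAddCommGroup W] [InnerProductSpace ℝ W]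
    [FiniteDimensional ℝ W] [MeasurableSpace W] [BorelSpace W] {f g : V → ℂ} (h : IsFT f g)
    (A : W ≃ₗᵢ[ℝ] V) : IsFT (fun x => f (A x)) (fun x => g (A x)) := by
  refine IsFT.of_weak (h.left.comp_measurePreserving A.measurePreserving)
    (h.right.comp_measurePreserving A.measurePreserving) ?_
  intro θ
  set θ' : 𝓢(V, ℂ) := SchwartzMap.compCLMOfContinuousLinearEquiv ℂ
    A.symm.toContinuousLinearEquiv θ with hθ'
  have e1 : ∀ x, θ' x = θ (A.symm x) := fun x => rfl
  have e2 : ∀ x, (𝓕 θ' : 𝓢(V, ℂ)) x = (𝓕 θ : 𝓢(W, ℂ)) (A.symm x) := by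
    intro x
    rw [SchwartzMap.fourier_coe, SchwartzMap.fourier_coe, ← Real.fourier_comp_linearIsometry]
    rfl
  have h1 := integral_schwartz_fourier h θ'
  have hA := A.measurePreserving
  have hemb : MeasurableEmbedding A := A.toHomeomorph.measurableEmbedding
  rw [← hA.integral_comp hemb, ← hA.integral_comp hemb] at h1
  simpa [e1, e2] using h1

end IsFT

/-! ### Partial Fourier transforms of square integrable functions on a product. -/

section Partial

variable {X : Type*} [MeasurableSpace X] {μ : Measure X} [SFinite μ]
variable {V : Type*} [NormedAddCommGroup V] [InnerProductSpace ℝ V]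
    [FiniteDimensional ℝ V] [MeasurableSpace V] [BorelSpace V]

theorem sqNorm_prod {Y : Type*} [MeasurableSpace Y] {ν : Measure Y} [SFinite ν] {f : X × Y → ℂ}
    (hf : AEStronglyMeasurable f (μ.prod ν)) :
    sqNorm (μ.prod ν) f = ∫⁻ x, sqNorm ν (fun y => f (x, y)) ∂μ :=
  lintegral_prod _ (hf.enorm.pow_const 2)

theorem aemeasurable_sqNorm_fiber {Y : Type*} [MeasurableSpace Y] {ν : Measure Y} [SFinite ν]
    {f : X × Y → ℂ} (hf : AEStronglyMeasurable f (μ.prod ν)) :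
    AEMeasurable (fun x => sqNorm ν (fun y => f (x, y))) μ :=
  AEMeasurable.lintegral_prod_right' (hf.enorm.pow_const 2)

theorem memLp_fiber {Y : Type*} [MeasurableSpace Y] {ν : Measure Y} [SFinite ν]
    {f : X × Y → ℂ} (hf : MemLp f 2 (μ.prod ν)) :
    ∀ᵐ x ∂μ, MemLp (fun y => f (x, y)) 2 ν := by
  have h1 := hf.1.prodMk_left
  have h2 : ∫⁻ x, sqNorm ν (fun y => f (x, y)) ∂μ ≠ ⊤ := by
    rw [← sqNorm_prod hf.1]; exact (memLp_two_iff.1 hf).2.ne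
  filter_upwards [h1, ae_lt_top' (aemeasurable_sqNorm_fiber hf.1) h2] with x hx1 hx2
  exact memLp_two_iff.2 ⟨hx1, hx2⟩

/-- `P` is the Fourier transform of `f` in the second variable. -/
def IsPartialFT (μ : Measure X) (f P : X × V → ℂ) : Prop :=
  ∀ᵐ x ∂μ, IsFT (fun y => f (x, y)) (fun y => P (x, y))

theorem IsPartialFT.sqNorm_eq {f P : X × V → ℂ} (h : IsPartialFT μ f P)
    (hf : AEStronglyMeasurable f (μ.prod volume)) (hP : AEStronglyMeasurable P (μ.prod volume)) :
    sqNorm (μ.prod volume) f = sqNorm (μ.prod volume) P := by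
  rw [sqNorm_prod hf, sqNorm_prod hP]
  exact lintegral_congr_ae (h.mono fun x hx => hx.sqNorm_eq)

theorem IsPartialFT.memLp {f P : X × V → ℂ} (h : IsPartialFT μ f P)
    (hf : MemLp f 2 (μ.prod volume)) (hP : AEStronglyMeasurable P (μ.prod volume)) :
    MemLp P 2 (μ.prod volume) :=
  memLp_two_iff.2 ⟨hP, by rw [← h.sqNorm_eq hf.1 hP]; exact (memLp_two_iff.1 hf).2⟩

theorem IsPartialFT.sub {f P f' P' : X × V → ℂ} (h : IsPartialFT μ f P) (h' : IsPartialFT μ f' P') :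
    IsPartialFT μ (fun z => f z - f' z) (fun z => P z - P' z) := by
  filter_upwards [h, h'] with x hx hx' using hx.sub hx'

theorem ae_fiber_of_ae {Y : Type*} [MeasurableSpace Y] {ν : Measure Y} [SFinite ν]
    {p : X × Y → Prop} (h : ∀ᵐ z ∂(μ.prod ν), p z) : ∀ᵐ x ∂μ, ∀ᵐ y ∂ν, p (x, y) :=
  Measure.ae_ae_of_ae_prod h

theorem IsPartialFT.congr {f P f' P' : X × V → ℂ} (h : IsPartialFT μ f P)
    (hf : f =ᵐ[μ.prod volume] f') (hP : P =ᵐ[μ.prod volume] P') : IsPartialFT μ f' P' := by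
  filter_upwards [h, ae_fiber_of_ae hf, ae_fiber_of_ae hP] with x hx h1 h2 using hx.congr h1 h2

theorem ae_eq_of_fiber {Y : Type*} [MeasurableSpace Y] {ν : Measure Y} [SFinite ν]
    {f g : X × Y → ℂ} (hf : AEStronglyMeasurable f (μ.prod ν))
    (hg : AEStronglyMeasurable g (μ.prod ν))
    (h : ∀ᵐ x ∂μ, (fun y => f (x, y)) =ᵐ[ν] fun y => g (x, y)) : f =ᵐ[μ.prod ν] g := by
  have h1 : sqNorm (μ.prod ν) (fun z => f z - g z) = 0 := by
    rw [sqNorm_prod (f := fun z => f z - g z) (hf.sub hg)]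
    rw [← lintegral_zero (μ := μ)]
    refine lintegral_congr_ae (h.mono fun x hx => ?_)
    have : (fun y => f (x, y) - g (x, y)) =ᵐ[ν] fun _ => 0 := by
      filter_upwards [hx] with y hy
      rw [hy, sub_self]
    simp only
    rw [sqNorm_congr this]
    simp [sqNorm]
  have h2 := (sqNorm_eq_zero (hf.sub hg)).1 h1
  filter_upwards [h2] with z hz
  exact sub_eq_zero.1 hz

theorem aestronglyMeasurable_fourier_fiber {f : X × V → ℂ}
    (hf : AEStronglyMeasurable f (μ.prod volume)) :
    AEStronglyMeasurable (fun z : X × V => 𝓕 (fun y => f (z.1, y)) z.2) (μ.prod volume) := by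
  obtain ⟨g, hg, hfg⟩ := hf
  have h1 : StronglyMeasurable (fun z : X × V => ∫ y, Real.fourierChar (-inner ℝ y z.2) • g (z.1, y)) := by
    apply StronglyMeasurable.integral_prod_right' (f := fun w : (X × V) × V =>
      Real.fourierChar (-inner ℝ w.2 w.1.2) • g (w.1.1, w.2))
    refine StronglyMeasurable.smul ?_ ?_
    · have hc : Continuous (fun w : V × V => ((Real.fourierChar (-inner ℝ w.2 w.1) : Circle) : ℂ)) := by
        fun_prop
      exact hc.stronglyMeasurable.comp_measurable (g := fun w : (X × V) × V => (w.1.2, w.2))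
        (Measurable.prodMk (measurable_snd.comp measurable_fst) measurable_snd)
    · exact hg.comp_measurable (by fun_prop)
  refine ⟨_, h1, ?_⟩
  have h2 := ae_fiber_of_ae hfg
  have h3 : ∀ᵐ z ∂(μ.prod (volume : Measure V)),
      (fun y => f (z.1, y)) =ᵐ[volume] fun y => g (z.1, y) :=
    Measure.quasiMeasurePreserving_fst.ae h2
  filter_upwards [h3] with z hz
  rw [Real.fourier_congr_ae hz, Real.fourier_eq]

theorem isPartialFT_of_integrable {f : X × V → ℂ} (hf : MemLp f 2 (μ.prod volume))
    (h : ∀ᵐ x ∂μ, Integrable fun y => f (x, y)) :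
    IsPartialFT μ f (fun z => 𝓕 (fun y => f (z.1, y)) z.2) := by
  filter_upwards [h, memLp_fiber hf] with x h1 h2 using IsFT.of_integrable h1 h2

/-- The graph of the partial Fourier transform is closed in `L²`. -/
theorem isPartialFT_of_tendsto {f P : X × V → ℂ} (hf : MemLp f 2 (μ.prod volume))
    (hPmem : MemLp P 2 (μ.prod volume))
    {fn Pn : ℕ → X × V → ℂ} (hfn : ∀ n, MemLp (fn n) 2 (μ.prod volume))
    (hPn : ∀ n, AEStronglyMeasurable (Pn n) (μ.prod volume)) (h : ∀ n, IsPartialFT μ (fn n) (Pn n))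
    (hlim : Filter.Tendsto (fun n => sqNorm (μ.prod volume) (fun z => f z - fn n z)) Filter.atTop
      (nhds 0))
    (hPlim : Filter.Tendsto (fun n => sqNorm (μ.prod volume) (fun z => Pn n z - P z))
      Filter.atTop (nhds 0)) : IsPartialFT μ f P := by
  -- By Plancherel on each fibre, `E n x` dominates the squared distance between the true transform
  -- of the fibre and `P`. The infimum over `n` has integral zero, so it vanishes almost everywhere
  -- and no subsequence has to be extracted.
  set E : ℕ → X → ℝ≥0∞ := fun n x =>
    2 * sqNorm volume (fun y => f (x, y) - fn n (x, y)) +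
      2 * sqNorm volume (fun y => Pn n (x, y) - P (x, y)) with hE
  have hEm : ∀ n, AEMeasurable (E n) μ := fun n =>
    ((aemeasurable_sqNorm_fiber (hf.1.sub (hfn n).1)).const_mul 2).add
      ((aemeasurable_sqNorm_fiber ((hPn n).sub hPmem.1)).const_mul 2)
  have hEi : ∀ n, ∫⁻ x, E n x ∂μ = 2 * sqNorm (μ.prod volume) (fun z => f z - fn n z) +
      2 * sqNorm (μ.prod volume) (fun z => Pn n z - P z) := by
    intro n
    rw [sqNorm_prod (f := fun z => f z - fn n z) (hf.1.sub (hfn n).1),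
      sqNorm_prod (f := fun z => Pn n z - P z) ((hPn n).sub hPmem.1),
      ← lintegral_const_mul' _ _ (by norm_num), ← lintegral_const_mul' _ _ (by norm_num),
      ← lintegral_add_left' ((aemeasurable_sqNorm_fiber (f := fun z => f z - fn n z)
        (hf.1.sub (hfn n).1)).const_mul 2)]
  have hE0 : ∫⁻ x, ⨅ n, E n x ∂μ = 0 := by
    have h1 : Filter.Tendsto (fun n => ∫⁻ x, E n x ∂μ) Filter.atTop (nhds 0) := by
      simp only [hEi]
      have := (ENNReal.Tendsto.const_mul hlim (Or.inr (by norm_num : (2 : ℝ≥0∞) ≠ ⊤))).add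
        (ENNReal.Tendsto.const_mul hPlim (Or.inr (by norm_num : (2 : ℝ≥0∞) ≠ ⊤)))
      simpa using this
    refine le_antisymm (ge_of_tendsto' h1 fun n => ?_) bot_le
    exact lintegral_mono fun x => iInf_le _ n
  rw [lintegral_eq_zero_iff' (AEMeasurable.iInf hEm)] at hE0
  filter_upwards [hE0, ae_all_iff.2 h, memLp_fiber hf, memLp_fiber hPmem] with x hx hn hfx hPx
  obtain ⟨g, hg⟩ := exists_isFT hfx
  refine hg.congr (Filter.EventuallyEq.refl _ _) ?_
  have h1 : sqNorm volume (fun y => g y - P (x, y)) ≤ ⨅ n, E n x := by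
    refine le_iInf fun n => ?_
    have h2 := hg.sub (hn n)
    have h3 := sqNorm_add_le (f := fun y => g y - Pn n (x, y)) (g := fun y => Pn n (x, y) - P (x, y))
      h2.right.1
    simp only [sub_add_sub_cancel] at h3
    rwa [← h2.sqNorm_eq] at h3
  rw [hx] at h1
  have h2 := (sqNorm_eq_zero (hg.right.sub hPx).1).1 (le_antisymm h1 bot_le)
  filter_upwards [h2] with y hy
  exact sub_eq_zero.1 hy

/-- A limit in `L²` of functions that have a measurable partial Fourier transform has one. -/
theorem exists_isPartialFT_of_tendsto {f : X × V → ℂ} (hf : MemLp f 2 (μ.prod volume))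
    {fn Pn : ℕ → X × V → ℂ} (hfn : ∀ n, MemLp (fn n) 2 (μ.prod volume))
    (hPn : ∀ n, AEStronglyMeasurable (Pn n) (μ.prod volume)) (h : ∀ n, IsPartialFT μ (fn n) (Pn n))
    (hlim : Filter.Tendsto (fun n => sqNorm (μ.prod volume) (fun z => f z - fn n z)) Filter.atTop
      (nhds 0)) :
    ∃ P, MemLp P 2 (μ.prod volume) ∧ IsPartialFT μ f P := by
  have hPm : ∀ n, MemLp (Pn n) 2 (μ.prod volume) := fun n => (h n).memLp (hfn n) (hPn n)
  have hlim' : Filter.Tendsto (fun n => (hfn n).toLp (fn n)) Filter.atTop (nhds (hf.toLp f)) := by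
    rw [Lp.tendsto_Lp_iff_tendsto_eLpNorm']
    have h1 : ∀ n, eLpNorm ((hfn n).toLp (fn n) - hf.toLp f : X × V → ℂ) 2 (μ.prod volume) =
        (sqNorm (μ.prod volume) (fun z => f z - fn n z)) ^ (1 / 2 : ℝ) := by
      intro n
      rw [← eLpNorm_two_eq, ← eLpNorm_neg]
      refine eLpNorm_congr_ae ?_
      filter_upwards [(hfn n).coeFn_toLp, hf.coeFn_toLp] with z h1 h2
      simp [h1, h2]
    simp only [h1]
    have := ((ENNReal.continuous_rpow_const (y := (1 / 2 : ℝ))).tendsto 0).comp hlim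
    rw [ENNReal.zero_rpow_of_pos (by norm_num)] at this
    exact this
  have hcau : CauchySeq (fun n => (hPm n).toLp (Pn n)) := by
    have h1 := hlim'.cauchySeq
    rw [Metric.cauchySeq_iff] at h1 ⊢
    intro ε hε
    obtain ⟨N, hN⟩ := h1 ε hε
    refine ⟨N, fun m hm n hn => ?_⟩
    have h2 := hN m hm n hn
    rw [dist_eq_norm, ← MemLp.toLp_sub, Lp.norm_toLp] at h2 ⊢
    rw [eLpNorm_two_eq] at h2 ⊢
    have h3 := ((h m).sub (h n)).sqNorm_eq ((hfn m).sub (hfn n)).1 ((hPm m).sub (hPm n)).1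
    have h4 : sqNorm (μ.prod volume) (Pn m - Pn n) = sqNorm (μ.prod volume) (fn m - fn n) := h3.symm
    rwa [h4]
  obtain ⟨P, hP⟩ := cauchySeq_tendsto_of_complete hcau
  have hPlim : Filter.Tendsto (fun n => sqNorm (μ.prod volume) (fun z => Pn n z - P z))
      Filter.atTop (nhds 0) := by
    rw [Lp.tendsto_Lp_iff_tendsto_eLpNorm'] at hP
    have h1 : ∀ n, sqNorm (μ.prod volume) (fun z => Pn n z - P z) =
        (eLpNorm ((hPm n).toLp (Pn n) - P : X × V → ℂ) 2 (μ.prod volume)) ^ 2 := by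
      intro n
      rw [SMap.sqNorm_eq]
      congr 1
      refine eLpNorm_congr_ae ?_
      filter_upwards [(hPm n).coeFn_toLp] with z h1
      simp [h1]
    simp only [h1]
    have := ((ENNReal.continuous_pow 2).tendsto 0).comp hP
    rw [zero_pow (by norm_num)] at this
    exact this
  exact ⟨P, Lp.memLp P, isPartialFT_of_tendsto hf (Lp.memLp P) hfn hPn h hlim hPlim⟩

/-- Simple functions are dense in L², and a square integrable simple function is integrable. -/
theorem exists_integrable_approx {X : Type*} [MeasurableSpace X] {μ : Measure X} {f : X → ℂ}
    (hf : MemLp f 2 μ) : ∃ fn : ℕ → X → ℂ, (∀ n, MemLp (fn n) 2 μ) ∧ (∀ n, Integrable (fn n) μ) ∧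
      Filter.Tendsto (fun n => sqNorm μ (fun z => f z - fn n z)) Filter.atTop (nhds 0) := by
  have h1 : ∀ n : ℕ, ∃ g : SimpleFunc X ℂ, eLpNorm (f - ⇑g) 2 μ < ((n : ℝ≥0∞) + 1)⁻¹ ∧ MemLp g 2 μ :=
    fun n => hf.exists_simpleFunc_eLpNorm_sub_lt (by norm_num)
      (ENNReal.inv_ne_zero.2 (by finiteness))
  choose g hg hgm using h1
  refine ⟨fun n => g n, hgm, fun n => (SimpleFunc.memLp_iff_integrable (by norm_num)
    (by norm_num)).1 (hgm n), ?_⟩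
  have h2 : Filter.Tendsto (fun n : ℕ => (((n : ℝ≥0∞) + 1)⁻¹) ^ 2) Filter.atTop (nhds 0) := by
    have h3 : Filter.Tendsto (fun n : ℕ => ((n : ℝ≥0∞) + 1)⁻¹) Filter.atTop (nhds 0) := by
      have := (Filter.tendsto_add_atTop_iff_nat 1).2 ENNReal.tendsto_inv_nat_nhds_zero
      simpa using this
    have := ((ENNReal.continuous_pow 2).tendsto 0).comp h3
    rw [zero_pow (by norm_num)] at this
    exact this
  refine tendsto_of_tendsto_of_tendsto_of_le_of_le tendsto_const_nhds h2 (fun n => bot_le)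
    fun n => ?_
  simp only
  rw [sqNorm_eq]
  gcongr
  exact (hg n).le

/-- Choosing the L² transform on each fibre separately would not give joint measurability. For
integrable functions the fibrewise Fourier integral is jointly measurable, and Plancherel carries
this to L² limits. -/
theorem exists_isPartialFT {f : X × V → ℂ} (hf : MemLp f 2 (μ.prod volume)) :
    ∃ P, MemLp P 2 (μ.prod volume) ∧ IsPartialFT μ f P := by
  obtain ⟨fn, h1, h2, h3⟩ := exists_integrable_approx hf
  exact exists_isPartialFT_of_tendsto hf h1
    (fun n => aestronglyMeasurable_fourier_fiber (h1 n).1)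
    (fun n => isPartialFT_of_integrable (h1 n) (h2 n).prod_right_ae) h3

/-- The inverse partial transform is the partial transform followed by reflection in the second
variable. -/
theorem exists_isPartialFT_left {P : X × V → ℂ} (hP : MemLp P 2 (μ.prod volume)) :
    ∃ f, MemLp f 2 (μ.prod volume) ∧ IsPartialFT μ f P := by
  obtain ⟨Q, hQ, h⟩ := exists_isPartialFT hP
  refine ⟨fun z => Q (z.1, -z.2), ?_, h.mono fun x hx => hx.reflect⟩
  exact hQ.comp_measurePreserving
    ((MeasurePreserving.id μ).prod (Measure.measurePreserving_neg (volume : Measure V)))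

end Partial

/-! ### Factorisation of the Fourier transform on a product. -/

section Fubini

variable {U V : Type*} [NormedAddCommGroup U] [InnerProductSpace ℝ U]
    [FiniteDimensional ℝ U] [MeasurableSpace U] [BorelSpace U]
    [NormedAddCommGroup V] [InnerProductSpace ℝ V]
    [FiniteDimensional ℝ V] [MeasurableSpace V] [BorelSpace V]

theorem measurableEmbedding_toLp :
    MeasurableEmbedding (WithLp.toLp 2 : U × V → WithLp 2 (U × V)) :=
  (MeasurableEquiv.toLp 2 (U × V)).measurableEmbedding

theorem memLp_toLp_iff {f : WithLp 2 (U × V) → ℂ} :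
    MemLp (fun z : U × V => f (WithLp.toLp 2 z)) 2 (volume.prod volume) ↔ MemLp f 2 := by
  have h := WithLp.volume_preserving_toLp U V
  rw [← h.map_eq, measurableEmbedding_toLp.memLp_map_measure_iff]
  rfl

theorem ae_toLp_iff {p : WithLp 2 (U × V) → Prop} :
    (∀ᵐ z : U × V ∂(volume.prod volume), p (WithLp.toLp 2 z)) ↔ ∀ᵐ ζ, p ζ := by
  have h := WithLp.volume_preserving_toLp U V
  rw [← h.map_eq, measurableEmbedding_toLp.ae_map_iff]
  rfl

theorem sqNorm_toLp (f : WithLp 2 (U × V) → ℂ) :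
    sqNorm (volume.prod volume) (fun z : U × V => f (WithLp.toLp 2 z)) = sqNorm volume f := by
  have h := WithLp.volume_preserving_toLp U V
  unfold sqNorm
  rw [← h.map_eq, measurableEmbedding_toLp.lintegral_map]
  rfl

theorem fourier_fiber_fourier {f : U × V → ℂ} (hf : Integrable f (volume.prod volume))
    (ξ : U) (η : V) :
    𝓕 (fun x => 𝓕 (fun y => f (x, y)) η) ξ =
      𝓕 (fun ζ : WithLp 2 (U × V) => f (WithLp.ofLp ζ)) (WithLp.toLp 2 (ξ, η)) := by
  rw [Real.fourier_eq, Real.fourier_eq]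
  have h := WithLp.volume_preserving_toLp U V
  rw [← h.integral_comp measurableEmbedding_toLp]
  rw [Measure.volume_eq_prod, integral_prod]
  · refine integral_congr_ae (Filter.Eventually.of_forall fun x => ?_)
    simp only [WithLp.prod_inner_apply, Real.fourier_eq]
    rw [Circle.smul_def, ← integral_smul]
    refine integral_congr_ae (Filter.Eventually.of_forall fun y => ?_)
    simp only [Circle.smul_def, smul_smul, neg_add, AddChar.map_add_eq_mul, Circle.coe_mul]
  · have hc : Continuous (fun z : U × V => ((Real.fourierChar
        (-inner ℝ (WithLp.toLp 2 z) (WithLp.toLp 2 (ξ, η))) : Circle) : ℂ)) := by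
      simp only [WithLp.prod_inner_apply]
      fun_prop
    exact hf.bdd_smul 1 hc.aestronglyMeasurable (Filter.Eventually.of_forall fun z => (Circle.norm_coe _).le)

theorem memLp_swap {X Y : Type*} [MeasurableSpace X] [MeasurableSpace Y] {μ : Measure X}
    {ν : Measure Y} [SFinite μ] [SFinite ν] {f : X × Y → ℂ} (hf : MemLp f 2 (μ.prod ν)) :
    MemLp (fun z : Y × X => f z.swap) 2 (ν.prod μ) :=
  hf.comp_measurePreserving Measure.measurePreserving_swap

theorem sqNorm_swap {X Y : Type*} [MeasurableSpace X] [MeasurableSpace Y] {μ : Measure X}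
    {ν : Measure Y} [SFinite μ] [SFinite ν] (f : X × Y → ℂ) :
    sqNorm (ν.prod μ) (fun z : Y × X => f z.swap) = sqNorm (μ.prod ν) f := by
  unfold sqNorm
  exact (Measure.measurePreserving_swap (μ := ν) (ν := μ)).lintegral_comp_emb
    MeasurableEquiv.prodComm.measurableEmbedding (fun z => ‖f z‖ₑ ^ 2)

/-- The Fourier transform on a product is the composition of the two partial ones. -/
theorem IsFT.isPartialFT {f g : WithLp 2 (U × V) → ℂ} {P : U × V → ℂ} (h : IsFT f g)
    (hP : AEStronglyMeasurable P (volume.prod volume))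
    (hfP : IsPartialFT volume (fun z : U × V => f (WithLp.toLp 2 z)) P) :
    IsPartialFT volume (fun z : V × U => P z.swap)
      (fun z : V × U => g (WithLp.toLp 2 z.swap)) := by
  have hf' := memLp_toLp_iff.2 h.left
  have hg' := memLp_toLp_iff.2 h.right
  have hPm := hfP.memLp hf' hP
  -- On integrable approximants the factorisation is Fubini for the Fourier integral. Plancherel
  -- makes the partial and the full transforms converge along with them, and the graph of the
  -- partial transform is closed.
  obtain ⟨fn, h1, h2, h3⟩ := exists_integrable_approx hf'
  set Pn : ℕ → U × V → ℂ := fun n z => 𝓕 (fun y => fn n (z.1, y)) z.2 with hPn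
  set gn : ℕ → WithLp 2 (U × V) → ℂ := fun n => 𝓕 (fun ζ : WithLp 2 (U × V) => fn n (WithLp.ofLp ζ))
    with hgn
  have hfP' : ∀ n, IsPartialFT volume (fn n) (Pn n) := fun n =>
    isPartialFT_of_integrable (h1 n) (h2 n).prod_right_ae
  have hPnm : ∀ n, MemLp (Pn n) 2 (volume.prod volume) := fun n =>
    (hfP' n).memLp (h1 n) (aestronglyMeasurable_fourier_fiber (h1 n).1)
  have hfg : ∀ n, IsFT (fun ζ : WithLp 2 (U × V) => fn n (WithLp.ofLp ζ)) (gn n) := by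
    intro n
    refine IsFT.of_integrable ?_ (memLp_toLp_iff.1 (h1 n))
    exact (WithLp.volume_preserving_ofLp U V).integrable_comp_of_integrable (h2 n)
  have hPg : ∀ n, IsPartialFT volume (fun z : V × U => Pn n z.swap)
      (fun z : V × U => gn n (WithLp.toLp 2 z.swap)) := by
    intro n
    have e1 : (fun z : V × U => gn n (WithLp.toLp 2 z.swap)) =
        fun z => 𝓕 (fun x => Pn n (x, z.1)) z.2 := by
      ext z
      rw [hgn, hPn]
      exact (fourier_fiber_fourier (h2 n) z.2 z.1).symm
    rw [e1]
    refine isPartialFT_of_integrable (f := fun z : V × U => Pn n z.swap) (memLp_swap (hPnm n)) ?_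
    filter_upwards [(memLp_swap (hPnm n)).1.prodMk_left] with η hη
    refine ((h2 n).norm.integral_prod_left).mono' hη ?_
    exact Filter.Eventually.of_forall fun x =>
      VectorFourier.norm_fourierIntegral_le_integral_norm Real.fourierChar volume
        (innerₗ V) (fun y => fn n (x, y)) η
  refine isPartialFT_of_tendsto (memLp_swap hPm) (memLp_swap hg')
    (fun n => memLp_swap (hPnm n)) (fun n => (memLp_swap (memLp_toLp_iff.2 (hfg n).right)).1) hPg ?_ ?_
  · convert h3 using 2 with n
    rw [sqNorm_swap (fun z => P z - Pn n z)]
    exact ((hfP.sub (hfP' n)).sqNorm_eq (hf'.sub (h1 n)).1 (hPm.sub (hPnm n)).1).symm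
  · convert h3 using 2 with n
    rw [sqNorm_swap (fun z => gn n (WithLp.toLp 2 z) - g (WithLp.toLp 2 z)),
      sqNorm_toLp (fun ζ => gn n ζ - g ζ)]
    rw [← ((hfg n).sub h).sqNorm_eq, ← sqNorm_toLp]
    unfold sqNorm
    refine lintegral_congr fun z => ?_
    rw [← enorm_neg]
    simp

end Fubini

/-- **Minkowski's integral inequality** in `L²`. -/
theorem lintegral_lintegral_sq_le {X Y : Type*} [MeasurableSpace X] [MeasurableSpace Y]
    {μ : Measure X} {ν : Measure Y} [SFinite μ] [SFinite ν] {f : X × Y → ℝ≥0∞}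
    (hf : AEMeasurable f (μ.prod ν)) :
    ∫⁻ y, (∫⁻ x, f (x, y) ∂μ) ^ 2 ∂ν ≤ (∫⁻ x, (∫⁻ y, f (x, y) ^ 2 ∂ν) ^ (1 / 2 : ℝ) ∂μ) ^ 2 := by
  wlog hm : Measurable f generalizing f
  · have h1 := this (f := hf.mk f) hf.measurable_mk.aemeasurable hf.measurable_mk
    have h2 := Measure.ae_ae_of_ae_prod hf.ae_eq_mk
    have h3 := Measure.ae_ae_of_ae_prod
      ((Measure.measurePreserving_swap (μ := ν) (ν := μ)).quasiMeasurePreserving.ae hf.ae_eq_mk)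
    calc _ = ∫⁻ y, (∫⁻ x, hf.mk f (x, y) ∂μ) ^ 2 ∂ν :=
          lintegral_congr_ae (h3.mono fun y hy => by
            simp only [Prod.swap_prod_mk] at hy
            simp only
            rw [lintegral_congr_ae hy])
      _ ≤ _ := h1
      _ = _ := by
          congr 1
          refine lintegral_congr_ae (h2.mono fun x hx => ?_)
          simp only
          congr 1
          refine lintegral_congr_ae (hx.mono fun y hy => ?_)
          simp only
          rw [hy]
  have hx : ∀ x, Measurable fun y => f (x, y) := fun x => hm.comp measurable_prodMk_left
  have hy : ∀ y, Measurable fun x => f (x, y) := fun y => hm.comp measurable_prodMk_right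
  set S : Y → ℝ≥0∞ := fun y => ∫⁻ x, f (x, y) ∂μ with hS
  set N : X → ℝ≥0∞ := fun x => (∫⁻ y, f (x, y) ^ 2 ∂ν) ^ (1 / 2 : ℝ) with hN
  have hSm : Measurable S := hm.lintegral_prod_left'
  have hNm : Measurable N := ((hm.pow_const 2).lintegral_prod_right').pow_const _
  -- The square of the inner integral is a double integral over `x` and `x'`. Cauchy–Schwarz in `y`
  -- for each pair separates the two variables, without dividing by a norm that may be zero or
  -- infinite.
  have h1 : ∀ x x', ∫⁻ y, f (x, y) * f (x', y) ∂ν ≤ N x * N x' := by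
    intro x x'
    have := ENNReal.lintegral_mul_le_Lp_mul_Lq ν Real.HolderConjugate.two_two
      (hx x).aemeasurable (hx x').aemeasurable
    simpa [hN] using this
  have h2 : ∀ x, ∫⁻ y, f (x, y) * S y ∂ν ≤ N x * ∫⁻ x', N x' ∂μ := by
    intro x
    calc ∫⁻ y, f (x, y) * S y ∂ν = ∫⁻ y, ∫⁻ x', f (x, y) * f (x', y) ∂μ ∂ν :=
          lintegral_congr fun y => (lintegral_const_mul _ (hy y)).symm
      _ = ∫⁻ x', ∫⁻ y, f (x, y) * f (x', y) ∂ν ∂μ := by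
          refine lintegral_lintegral_swap (f := fun y x' => f (x, y) * f (x', y)) ?_
          exact (((hx x).comp measurable_fst).mul (hm.comp measurable_swap)).aemeasurable
      _ ≤ ∫⁻ x', N x * N x' ∂μ := lintegral_mono fun x' => h1 x x'
      _ = _ := lintegral_const_mul _ hNm
  calc ∫⁻ y, S y ^ 2 ∂ν = ∫⁻ y, ∫⁻ x, f (x, y) * S y ∂μ ∂ν :=
        lintegral_congr fun y => by rw [lintegral_mul_const _ (hy y), sq]
    _ = ∫⁻ x, ∫⁻ y, f (x, y) * S y ∂ν ∂μ := by
        refine lintegral_lintegral_swap (f := fun y x => f (x, y) * S y) ?_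
        exact ((hm.comp measurable_swap).mul (hSm.comp measurable_fst)).aemeasurable
    _ ≤ ∫⁻ x, N x * ∫⁻ x', N x' ∂μ ∂μ := lintegral_mono h2
    _ = _ := by rw [lintegral_mul_const _ hNm, sq]

/-! ### The operator `i∂ₜ - w + i` on truncated oscillations in time. -/

section Time

/-- The symbol `-(2πτ + w) + i`, as a function of `τ`. -/
def timeSymb (w τ : ℝ) : ℂ := -((2 * Real.pi * τ + w : ℝ) : ℂ) + Complex.I

theorem continuous_timeSymb (w : ℝ) : Continuous (timeSymb w) := by unfold timeSymb; fun_prop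

/-- Continuous functions with compact support are integrable and square integrable. -/
theorem integrable_and_memLp {f : ℝ → ℂ} (hf : Continuous f) (hc : HasCompactSupport f) :
    Integrable f ∧ MemLp f 2 :=
  ⟨hf.integrable_of_hasCompactSupport hc, hf.memLp_of_hasCompactSupport hc⟩

/-- The action of `i ∂ₜ - w + i` on a function `χ(t) e^{-itw} R(t)`. -/
theorem isFT_timeSymb {χ : ℝ → ℝ} (hχ : ContDiff ℝ ∞ χ) (hc : HasCompactSupport χ) (w : ℝ)
    {R R' : ℝ → ℂ} (hR : ∀ t, HasDerivAt R (R' t) t) (hR' : Continuous R') :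
    IsFT (fun t : ℝ => χ t * (Complex.exp (-(Complex.I * t * w)) * R t))
        (𝓕 fun t : ℝ => χ t * (Complex.exp (-(Complex.I * t * w)) * R t)) ∧
      IsFT (fun t : ℝ => Complex.I * (Complex.exp (-(Complex.I * t * w)) *
          (χ t * R' t + deriv χ t * R t + χ t * R t)))
        (fun τ : ℝ => timeSymb w τ *
          𝓕 (fun t : ℝ => χ t * (Complex.exp (-(Complex.I * t * w)) * R t)) τ) := by
  have hRc : Continuous R := continuous_iff_continuousAt.2 fun t => (hR t).continuousAt
  have hχc : Continuous χ := hχ.continuous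
  have hχd : ∀ t, HasDerivAt χ (deriv χ t) t := fun t =>
    (hχ.differentiable (by norm_num) t).hasDerivAt
  have hχ' : Continuous (deriv χ) := hχ.continuous_deriv (by norm_num)
  set W : ℝ → ℂ := fun t => χ t * (Complex.exp (-(Complex.I * t * w)) * R t) with hW
  set W' : ℝ → ℂ := fun t => deriv χ t * (Complex.exp (-(Complex.I * t * w)) * R t) +
    χ t * (-(Complex.I * w) * Complex.exp (-(Complex.I * t * w)) * R t +
      Complex.exp (-(Complex.I * t * w)) * R' t) with hW'
  have hd : ∀ t, HasDerivAt W (W' t) t := by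
    intro t
    have h1 : HasDerivAt (fun t : ℝ => -(Complex.I * (t : ℂ) * w)) (-(Complex.I * w)) t := by
      have := (((hasDerivAt_id t).ofReal_comp.const_mul Complex.I).mul_const (w : ℂ)).neg
      simp only [id_eq, Complex.ofReal_one, mul_one] at this
      exact this
    have h2 := h1.cexp.mul (hR t)
    have h3 := (hχd t).ofReal_comp.mul h2
    refine h3.congr_deriv ?_
    simp only [hW', Pi.mul_apply]
    ring
  have hWc : Continuous W := by fun_prop
  have hW'c : Continuous W' := by fun_prop
  have hcC : HasCompactSupport (fun t => (χ t : ℂ)) := hc.comp_left (g := fun r : ℝ => (r : ℂ)) (by simp)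
  have hcW : HasCompactSupport W := hcC.mul_right
  have hder : deriv W = W' := funext fun t => (hd t).deriv
  have hcW' : HasCompactSupport W' := hder ▸ hcW.deriv
  obtain ⟨hWi, hWm⟩ := integrable_and_memLp hWc hcW
  obtain ⟨hWi', hWm'⟩ := integrable_and_memLp hW'c hcW'
  have h1 := IsFT.of_integrable hWi hWm
  have h2 := IsFT.of_integrable hWi' hWm'
  have h3 : 𝓕 W' = fun τ : ℝ => (2 * (Real.pi : ℂ) * Complex.I * τ) • 𝓕 W τ := by
    have := Real.fourier_deriv hWi (fun t => (hd t).differentiableAt) (hder ▸ hWi')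
    rwa [hder] at this
  refine ⟨h1, ?_⟩
  refine ((h2.const_mul Complex.I).add (h1.const_mul (-w + Complex.I))).congr
    (Filter.EventuallyEq.of_eq ?_) (Filter.EventuallyEq.of_eq ?_)
  · ext t
    simp only [hW, hW']
    linear_combination (-(χ t : ℂ) * w * Complex.exp (-(Complex.I * t * w)) * R t) * Complex.I_sq
  · ext τ
    rw [h3]
    simp only [timeSymb, smul_eq_mul]
    push_cast
    linear_combination (2 * Real.pi * τ * 𝓕 W τ) * Complex.I_sq

theorem IsTimeCutoff.hasCompactSupport {ψ : ℝ → ℝ} (hψ : IsTimeCutoff ψ) : HasCompactSupport ψ :=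
  HasCompactSupport.of_support_subset_isCompact isCompact_Icc
    ((subset_tsupport ψ).trans hψ.supp)

theorem IsTimeCutoff.eq_zero {ψ : ℝ → ℝ} (hψ : IsTimeCutoff ψ) {t : ℝ}
    (ht : t ∉ Set.Icc (-2 : ℝ) 2) : ψ t = 0 ∧ deriv ψ t = 0 := by
  have h1 : t ∉ tsupport ψ := fun h => ht (hψ.supp h)
  refine ⟨image_eq_zero_of_notMem_tsupport h1, ?_⟩
  by_contra h2
  exact h1 (support_deriv_subset h2)

theorem IsTimeCutoff.exists_bound {ψ : ℝ → ℝ} (hψ : IsTimeCutoff ψ) :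
    ∃ M : ℝ≥0, 1 ≤ M ∧ ∀ t, ‖ψ t‖ ≤ M ∧ ‖deriv ψ t‖ ≤ M := by
  obtain ⟨M, hM⟩ := (hψ.hasCompactSupport.deriv).exists_bound_of_continuous
    (hψ.smooth.continuous_deriv (by norm_num))
  have hM0 : 0 ≤ M := (norm_nonneg _).trans (hM 0)
  have hM1 : ((M.toNNReal + 1 : ℝ≥0) : ℝ) = M + 1 := by simp [hM0]
  refine ⟨M.toNNReal + 1, le_add_self, fun t => ⟨?_, ?_⟩⟩ <;> rw [hM1]
  · have := hψ.range t
    rw [Real.norm_of_nonneg this.1]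
    linarith [this.2]
  · linarith [hM t]

theorem norm_exp_I_mul (t w : ℝ) : ‖Complex.exp (-(Complex.I * t * w))‖ = 1 := by
  rw [Complex.norm_exp]; simp

/-- The weighted norm of `ψ(t) e^{-itw} R(t)` is controlled by the local `H¹` norm of `R`. -/
theorem sqNorm_timeSymb_le {ψ : ℝ → ℝ} (hψ : IsTimeCutoff ψ) :
    ∃ C : ℝ≥0, ∀ (w : ℝ) (R R' : ℝ → ℂ), (∀ t, HasDerivAt R (R' t) t) → Continuous R' →
      sqNorm volume (fun τ : ℝ => timeSymb w τ *
          𝓕 (fun t : ℝ => ψ t * (Complex.exp (-(Complex.I * t * w)) * R t)) τ) ≤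
        C * (∫⁻ t in Set.Icc (-2 : ℝ) 2, ‖R t‖ₑ ^ 2) + C * ∫⁻ t in Set.Icc (-2 : ℝ) 2, ‖R' t‖ₑ ^ 2 := by
  obtain ⟨M, hM1, hM⟩ := hψ.exists_bound
  -- The commutator formula bounds the integrand by M(2|R| + |R'|), and (2a + b)² ≤ 8(a² + b²).
  refine ⟨8 * M ^ 2, fun w R R' hR hR' => ?_⟩
  have hRc : Continuous R := continuous_iff_continuousAt.2 fun t => (hR t).continuousAt
  rw [← ((isFT_timeSymb hψ.smooth hψ.hasCompactSupport w hR hR').2).sqNorm_eq]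
  rw [← mul_add, ← lintegral_add_left (by fun_prop), ← lintegral_const_mul _ (by fun_prop),
    ← lintegral_indicator measurableSet_Icc]
  refine lintegral_mono fun t => ?_
  by_cases ht : t ∈ Set.Icc (-2 : ℝ) 2
  · rw [Set.indicator_of_mem ht]
    have h1 : ‖Complex.I * (Complex.exp (-(Complex.I * t * w)) *
        (ψ t * R' t + deriv ψ t * R t + ψ t * R t))‖ ^ 2 ≤
        8 * M ^ 2 * (‖R t‖ ^ 2 + ‖R' t‖ ^ 2) := by
      rw [norm_mul, norm_mul, norm_exp_I_mul, Complex.norm_I, one_mul, one_mul]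
      have h2 : ‖(ψ t * R' t + deriv ψ t * R t + ψ t * R t : ℂ)‖ ≤ M * (2 * ‖R t‖ + ‖R' t‖) := by
        have h3 : ‖(ψ t * R' t : ℂ)‖ ≤ M * ‖R' t‖ := by
          rw [norm_mul, Complex.norm_real]; gcongr; exact (hM t).1
        have h4 : ‖(deriv ψ t * R t : ℂ)‖ ≤ M * ‖R t‖ := by
          rw [norm_mul, Complex.norm_real]; gcongr; exact (hM t).2
        have h5 : ‖(ψ t * R t : ℂ)‖ ≤ M * ‖R t‖ := by
          rw [norm_mul, Complex.norm_real]; gcongr; exact (hM t).1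
        calc _ ≤ ‖(ψ t * R' t : ℂ)‖ + ‖(deriv ψ t * R t : ℂ)‖ + ‖(ψ t * R t : ℂ)‖ := norm_add₃_le
          _ ≤ _ := by linarith
      calc _ ≤ (M * (2 * ‖R t‖ + ‖R' t‖)) ^ 2 := by gcongr
        _ = M ^ 2 * (2 * ‖R t‖ + ‖R' t‖) ^ 2 := by ring
        _ ≤ M ^ 2 * (8 * (‖R t‖ ^ 2 + ‖R' t‖ ^ 2)) := by
            gcongr
            nlinarith [sq_nonneg (2 * ‖R t‖ - ‖R' t‖), sq_nonneg ‖R' t‖]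
        _ = _ := by ring
    have h6 := ENNReal.ofReal_le_ofReal h1
    rw [ENNReal.ofReal_pow (norm_nonneg _), ofReal_norm, ENNReal.ofReal_mul (by positivity),
      ENNReal.ofReal_add (by positivity) (by positivity), ENNReal.ofReal_pow (norm_nonneg _),
      ENNReal.ofReal_pow (norm_nonneg _), ofReal_norm, ofReal_norm] at h6
    refine h6.trans (le_of_eq ?_)
    congr 1
    rw [← ENNReal.ofReal_coe_nnreal]
    simp
  · rw [Set.indicator_of_notMem ht]
    simp [(hψ.eq_zero ht).1, (hψ.eq_zero ht).2]

/-- Fundamental theorem of calculus from time 0, with Cauchy–Schwarz on an interval of length 4.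
Integrating the pointwise bound over that interval gives the factors 8 and 32. -/
theorem lintegral_Icc_le_of_deriv {R R' : ℝ → ℂ} (hR : ∀ t, HasDerivAt R (R' t) t)
    (hR' : Continuous R') :
    ∫⁻ t in Set.Icc (-2 : ℝ) 2, ‖R t‖ₑ ^ 2 ≤ 32 * (‖R 0‖ₑ ^ 2 + ∫⁻ t, ‖R' t‖ₑ ^ 2) := by
  have h1 : ∀ t ∈ Set.Icc (-2 : ℝ) 2, ‖R t‖ₑ ^ 2 ≤
      2 * ‖R 0‖ₑ ^ 2 + 2 * (4 * ∫⁻ r, ‖R' r‖ₑ ^ 2) := by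
    intro t ht
    have h2 : R t - R 0 = ∫ r in (0 : ℝ)..t, R' r :=
      (intervalIntegral.integral_eq_sub_of_hasDerivAt (fun r _ => hR r)
        (hR'.intervalIntegrable _ _)).symm
    have h3 : ‖R t - R 0‖ₑ ≤ ∫⁻ r in Set.Icc (-2 : ℝ) 2, ‖R' r‖ₑ := by
      rw [h2, ← ofReal_norm, intervalIntegral.norm_intervalIntegral_eq, ofReal_norm]
      refine (enorm_integral_le_lintegral_enorm _).trans (lintegral_mono_set ?_)
      intro r hr
      rw [Set.mem_uIoc] at hr
      obtain ⟨h5, h6⟩ := ht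
      constructor <;> rcases hr with hr | hr <;> linarith [hr.1, hr.2]
    have h4 : (∫⁻ r in Set.Icc (-2 : ℝ) 2, ‖R' r‖ₑ) ^ 2 ≤ 4 * ∫⁻ r, ‖R' r‖ₑ ^ 2 := by
      have h5 := ENNReal.lintegral_mul_le_Lp_mul_Lq (volume.restrict (Set.Icc (-2 : ℝ) 2))
        Real.HolderConjugate.two_two (f := fun _ => 1) (g := fun r => ‖R' r‖ₑ)
        (by fun_prop) (by fun_prop)
      have h6 := pow_le_pow_left' h5 2
      simp only [Pi.mul_apply, one_mul, ENNReal.one_rpow, lintegral_const,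
        Measure.restrict_apply_univ, Real.volume_Icc] at h6
      rw [mul_pow, ← ENNReal.rpow_natCast, ← ENNReal.rpow_natCast, ← ENNReal.rpow_natCast,
        ← ENNReal.rpow_mul, ← ENNReal.rpow_mul] at h6
      norm_num at h6
      calc _ ≤ _ := h6
        _ ≤ _ := by
          gcongr
          exact Measure.restrict_le_self
    have h7 := enorm_add_sq_le (R 0) (R t - R 0)
    rw [add_sub_cancel] at h7
    calc _ ≤ _ := h7
      _ ≤ 2 * ‖R 0‖ₑ ^ 2 + 2 * (∫⁻ r in Set.Icc (-2 : ℝ) 2, ‖R' r‖ₑ) ^ 2 := by gcongr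
      _ ≤ _ := by gcongr
  calc ∫⁻ t in Set.Icc (-2 : ℝ) 2, ‖R t‖ₑ ^ 2 ≤ ∫⁻ t in Set.Icc (-2 : ℝ) 2,
        (2 * ‖R 0‖ₑ ^ 2 + 2 * (4 * ∫⁻ r, ‖R' r‖ₑ ^ 2)) :=
        setLIntegral_mono' measurableSet_Icc h1
    _ = (2 * ‖R 0‖ₑ ^ 2 + 2 * (4 * ∫⁻ r, ‖R' r‖ₑ ^ 2)) * 4 := by
        rw [lintegral_const, Measure.restrict_apply_univ, Real.volume_Icc]
        norm_num
    _ ≤ _ := by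
        have e1 : ∀ a b : ℝ≥0∞, (2 * a + 2 * (4 * b)) * 4 = 8 * a + 32 * b := by intros; ring
        rw [e1, mul_add]
        gcongr
        norm_num

/-- The weighted norm of `ψ(t) e^{-itw} R(t)` in terms of `R(0)` and `R'`. -/
theorem sqNorm_timeSymb_le' {ψ : ℝ → ℝ} (hψ : IsTimeCutoff ψ) :
    ∃ C : ℝ≥0, ∀ (w : ℝ) (R R' : ℝ → ℂ), (∀ t, HasDerivAt R (R' t) t) → Continuous R' →
      sqNorm volume (fun τ : ℝ => timeSymb w τ *
          𝓕 (fun t : ℝ => ψ t * (Complex.exp (-(Complex.I * t * w)) * R t)) τ) ≤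
        C * (‖R 0‖ₑ ^ 2 + sqNorm volume R') := by
  obtain ⟨C, hC⟩ := sqNorm_timeSymb_le hψ
  refine ⟨C * 32 + C, fun w R R' hR hR' => (hC w R R' hR hR').trans ?_⟩
  have h1 := lintegral_Icc_le_of_deriv hR hR'
  have h2 : ∫⁻ t in Set.Icc (-2 : ℝ) 2, ‖R' t‖ₑ ^ 2 ≤ ‖R 0‖ₑ ^ 2 + sqNorm volume R' :=
    (lintegral_mono' Measure.restrict_le_self le_rfl).trans le_add_self
  push_cast
  rw [add_mul, mul_assoc]
  gcongr
  exact h1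

end Time

/-! ### Spatial Fourier profiles of space-time functions. -/

section Profile

variable {U V : Type*} [NormedAddCommGroup U] [InnerProductSpace ℝ U]
    [FiniteDimensional ℝ U] [MeasurableSpace U] [BorelSpace U]
    [NormedAddCommGroup V] [InnerProductSpace ℝ V]
    [FiniteDimensional ℝ V] [MeasurableSpace V] [BorelSpace V]

theorem IsFT.reflect' {f g : V → ℂ} (h : IsFT f g) : IsFT g (fun x => f (-x)) := by
  have := h.reflect.comp_isometry (LinearIsometryEquiv.neg ℝ)
  simpa using this

/-- `H(ξ, t)` is the Fourier transform of `f(x, t)` in the first variable, and `g(ξ, τ)` is the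
Fourier transform of `H` in the second one. -/
structure IsProfile (f : WithLp 2 (U × V) → ℂ) (H : U × V → ℂ) (g : WithLp 2 (U × V) → ℂ) : Prop where
  memLp : MemLp H 2 (volume.prod volume)
  left : ∀ᵐ t : V, IsFT (fun x : U => f (WithLp.toLp 2 (x, t))) (fun ξ => H (ξ, t))
  right : ∀ᵐ ξ : U, IsFT (fun t : V => H (ξ, t)) (fun τ => g (WithLp.toLp 2 (ξ, τ)))

/-- `IsFT.isPartialFT` transforms the second variable first. Applied to the reflected pair, which
describes the inverse transform, it yields the opposite order for `f`; the signs are then undone by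
reflections. -/
theorem IsFT.exists_profile {f g : WithLp 2 (U × V) → ℂ} (h : IsFT f g) :
    ∃ H, IsProfile f H g := by
  have h1 := h.reflect
  obtain ⟨P, hP, hgP⟩ := exists_isPartialFT (memLp_toLp_iff.2 h1.left)
  have h2 := h1.isPartialFT hP.1 hgP
  have hneg : MeasurePreserving (fun z : U × V => (-z.1, z.2)) (volume.prod volume)
      (volume.prod volume) :=
    (Measure.measurePreserving_neg (volume : Measure U)).prod (MeasurePreserving.id volume)
  refine ⟨fun z => P (-z.1, z.2), hP.comp_measurePreserving hneg, ?_, ?_⟩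
  · filter_upwards [h2] with t ht
    exact ht.reflect'
  · have h3 := (Measure.measurePreserving_neg (volume : Measure U)).quasiMeasurePreserving.ae hgP
    filter_upwards [h3] with ξ hξ
    have := hξ.reflect'
    have h4 := this.comp_isometry (LinearIsometryEquiv.neg ℝ)
    have h5 := h4.reflect'.reflect'
    refine (this.congr (Filter.EventuallyEq.refl _ _) (Filter.EventuallyEq.of_eq ?_))
    ext τ
    congr 1
    simp [← WithLp.toLp_neg]

theorem ae_eq_of_fiber' {X Y : Type*} [MeasurableSpace X] [MeasurableSpace Y] {μ : Measure X}
    {ν : Measure Y} [SFinite μ] [SFinite ν]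
    {f g : X × Y → ℂ} (hf : AEStronglyMeasurable f (μ.prod ν))
    (hg : AEStronglyMeasurable g (μ.prod ν))
    (h : ∀ᵐ y ∂ν, (fun x => f (x, y)) =ᵐ[μ] fun x => g (x, y)) : f =ᵐ[μ.prod ν] g := by
  have h1 := ae_eq_of_fiber (f := fun z : Y × X => f z.swap) (g := fun z : Y × X => g z.swap)
    (hf.comp_measurePreserving Measure.measurePreserving_swap)
    (hg.comp_measurePreserving Measure.measurePreserving_swap) h
  have h2 := (Measure.measurePreserving_swap (μ := μ) (ν := ν)).quasiMeasurePreserving.ae h1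
  filter_upwards [h2] with z hz using hz

theorem IsProfile.unique {f g f' g' : WithLp 2 (U × V) → ℂ} {H H' : U × V → ℂ}
    (h : IsProfile f H g) (h' : IsProfile f' H' g') (hf : f =ᵐ[volume] f') :
    H =ᵐ[volume.prod volume] H' := by
  refine ae_eq_of_fiber' h.memLp.1 h'.memLp.1 ?_
  have h1 : ∀ᵐ z : V × U ∂(volume.prod volume), f (WithLp.toLp 2 z.swap) = f' (WithLp.toLp 2 z.swap) :=
    (Measure.measurePreserving_swap (μ := (volume : Measure V)) (ν := (volume : Measure U))
      ).quasiMeasurePreserving.ae (ae_toLp_iff.2 hf)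
  filter_upwards [h.left, h'.left, ae_fiber_of_ae h1] with t h1 h2 h3
  exact h1.unique h2 h3

theorem ae_eq_toLp {f g : WithLp 2 (U × V) → ℂ} (hf : AEStronglyMeasurable f)
    (hg : AEStronglyMeasurable g)
    (h : ∀ᵐ x : U, (fun y : V => f (WithLp.toLp 2 (x, y))) =ᵐ[volume]
      fun y => g (WithLp.toLp 2 (x, y))) : f =ᵐ[volume] g := by
  refine ae_toLp_iff.1 (ae_eq_of_fiber ?_ ?_ h)
  · exact hf.comp_measurePreserving (WithLp.volume_preserving_toLp U V)
  · exact hg.comp_measurePreserving (WithLp.volume_preserving_toLp U V)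

theorem ae_fiber_toLp {p : WithLp 2 (U × V) → Prop} (h : ∀ᵐ ζ, p ζ) :
    ∀ᵐ x : U, ∀ᵐ y : V, p (WithLp.toLp 2 (x, y)) :=
  ae_fiber_of_ae (ae_toLp_iff.2 h)

/-- A function has only one profile up to null sets, and the transform of the profile in the second
variable determines `g` fibre by fibre. -/
theorem IsProfile.isFT {f g : WithLp 2 (U × V) → ℂ} {H : U × V → ℂ} (h : IsProfile f H g)
    (hf : MemLp f 2) (hg : AEStronglyMeasurable g) : IsFT f g := by
  obtain ⟨g', hg'⟩ := exists_isFT hf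
  obtain ⟨H', hH'⟩ := hg'.exists_profile
  have h1 := hH'.unique h (Filter.EventuallyEq.refl _ _)
  refine hg'.congr (Filter.EventuallyEq.refl _ _) ?_
  refine ae_eq_toLp hg'.right.1 hg ?_
  filter_upwards [h.right, hH'.right, ae_fiber_of_ae h1] with ξ h2 h3 h4
  exact h3.unique h2 h4

theorem exists_profile_of_memLp {H : U × V → ℂ} (hH : MemLp H 2 (volume.prod volume)) :
    ∃ f g : WithLp 2 (U × V) → ℂ, IsFT f g ∧ IsProfile f H g := by
  obtain ⟨f, hf, hfH⟩ := exists_isPartialFT_left (memLp_swap hH)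
  obtain ⟨g, hg, hHg⟩ := exists_isPartialFT hH
  set f' : WithLp 2 (U × V) → ℂ := fun ζ => f (WithLp.ofLp ζ).swap
  set g' : WithLp 2 (U × V) → ℂ := fun ζ => g (WithLp.ofLp ζ)
  have hf' : MemLp f' 2 := memLp_toLp_iff.1 (memLp_swap hf)
  have hg' : MemLp g' 2 := memLp_toLp_iff.1 hg
  have h : IsProfile f' H g' := ⟨hH, hfH, hHg⟩
  exact ⟨f', g', h.isFT hf' hg'.1, h⟩

/-- Multiplication by a bounded function of the second variable. -/
theorem IsProfile.mul_right {f g f' g' : WithLp 2 (U × V) → ℂ} {H : U × V → ℂ}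
    (h : IsProfile f H g) {m : V → ℂ} (hmm : Measurable m) (hf' : IsFT f' g')
    (hm : ∀ᵐ ζ, f' ζ = m ζ.snd * f ζ) :
    ∀ᵐ ξ : U, IsFT (fun t : V => m t * H (ξ, t)) (fun τ => g' (WithLp.toLp 2 (ξ, τ))) := by
  obtain ⟨H', hH'⟩ := hf'.exists_profile
  have h1 : ∀ᵐ z : V × U ∂(volume.prod volume),
      f' (WithLp.toLp 2 z.swap) = m z.1 * f (WithLp.toLp 2 z.swap) :=
    (Measure.measurePreserving_swap (μ := (volume : Measure V)) (ν := (volume : Measure U))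
      ).quasiMeasurePreserving.ae (ae_toLp_iff.2 hm)
  have h3 : H' =ᵐ[volume.prod volume] fun z => m z.2 * H z := by
    refine ae_eq_of_fiber' hH'.memLp.1
      ((hmm.comp measurable_snd).aestronglyMeasurable.mul h.memLp.1) ?_
    filter_upwards [h.left, hH'.left, ae_fiber_of_ae h1] with t h4 h5 h6
    exact h5.unique (h4.const_mul (m t)) h6
  filter_upwards [ae_fiber_of_ae h3, hH'.right] with ξ h4 h5
  exact h5.congr h4 (Filter.EventuallyEq.refl _ _)

end Profile

/-! ### Countable sums in `L²`. -/

section Tsum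

variable {X : Type*} [MeasurableSpace X] {μ : Measure X} [SFinite μ]

theorem eLpNorm_two_sq (f : X → ℂ) : (eLpNorm f 2 μ) ^ 2 = ∫⁻ x, ‖f x‖ₑ ^ 2 ∂μ :=
  (sqNorm_eq f).symm

theorem le_of_sq_le {a b : ℝ≥0∞} (h : a ^ 2 ≤ b ^ 2) : a ≤ b := by
  by_contra! hc
  exact absurd h (not_le.2 (ENNReal.pow_lt_pow_left two_ne_zero hc))

/-- **Minkowski's inequality** for countable sums in `L²`. -/
theorem eLpNorm_le_tsum {v : X → ℂ} {w : ℕ → X → ℂ} (hw : ∀ j, AEStronglyMeasurable (w j) μ)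
    (h : ∀ᵐ x ∂μ, ‖v x‖ₑ ≤ ∑' j, ‖w j x‖ₑ) : eLpNorm v 2 μ ≤ ∑' j, eLpNorm (w j) 2 μ := by
  wlog hm : ∀ j, StronglyMeasurable (w j) generalizing w
  · refine (this (fun j => (hw j).stronglyMeasurable_mk.aestronglyMeasurable) ?_
      fun j => (hw j).stronglyMeasurable_mk).trans (le_of_eq ?_)
    · filter_upwards [h, ae_all_iff.2 fun j => (hw j).ae_eq_mk] with x hx hx'
      simpa only [← hx'] using hx
    · exact tsum_congr fun j => (eLpNorm_congr_ae (hw j).ae_eq_mk).symm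
  refine le_of_sq_le ?_
  rw [eLpNorm_two_sq]
  have h1 : AEMeasurable (fun z : ℕ × X => ‖w z.1 z.2‖ₑ) (Measure.count.prod μ) :=
    (measurable_from_prod_countable_right fun j => (hm j).enorm).aemeasurable
  have h2 := lintegral_lintegral_sq_le h1
  simp only [lintegral_count] at h2
  calc _ ≤ ∫⁻ x, (∑' j, ‖w j x‖ₑ) ^ 2 ∂μ := lintegral_mono_ae (h.mono fun x hx => by gcongr)
    _ ≤ _ := h2
    _ = _ := by simp only [eLpNorm_two_eq, sqNorm]

end Tsum

/-! ### Fourier multipliers on `L²`. -/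

section Multiplier

variable {V : Type*} [NormedAddCommGroup V] [InnerProductSpace ℝ V]
    [FiniteDimensional ℝ V] [MeasurableSpace V] [BorelSpace V]

theorem isFT_l2Multiplier {m : V → ℂ} {f : Lp ℂ 2 (volume : Measure V)} {g : V → ℂ}
    (hg : IsFT f g) (h : MemLp (fun ζ => m ζ * g ζ) 2) :
    IsFT (l2Multiplier m f) (fun ζ => m ζ * g ζ) := by
  have h1 : (fun ζ => m ζ * (𝓕 f : Lp ℂ 2 (volume : Measure V)) ζ) =ᵐ[volume]
      fun ζ => m ζ * g ζ := by
    filter_upwards [hg.coe_fourier] with ζ hζ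
    rw [hζ]
  have h2 := (memLp_congr_ae h1).2 h
  unfold l2Multiplier
  rw [dif_pos h2]
  exact (IsFT.of_Lp_inv _).congr (Filter.EventuallyEq.refl _ _) (h2.coeFn_toLp.trans h1)

theorem memLp_mul_of_bound {X : Type*} [MeasurableSpace X] {μ : Measure X} {m g : X → ℂ}
    (hm : AEStronglyMeasurable m μ) {C : ℝ}
    (hC : ∀ x, ‖m x‖ ≤ C) (hg : MemLp g 2 μ) : MemLp (fun x => m x * g x) 2 μ := by
  refine MemLp.of_le_mul (c := C) hg (hm.mul hg.1) (Filter.Eventually.of_forall fun x => ?_)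
  rw [norm_mul]
  gcongr
  exact hC x

theorem IsFT.eLpNorm_eq {f g : V → ℂ} (h : IsFT f g) : eLpNorm f 2 = eLpNorm g 2 := by
  rw [eLpNorm_two_eq, eLpNorm_two_eq, h.sqNorm_eq]

theorem Lp_eq_of_isFT {f f' : Lp ℂ 2 (volume : Measure V)} {g : V → ℂ} (h : IsFT f g)
    (h' : IsFT f' g) : f = f' :=
  Lp.ext (h.unique_left h' (Filter.EventuallyEq.refl _ _))

theorem exists_Lp_isFT {g : V → ℂ} (hg : MemLp g 2) :
    ∃ f : Lp ℂ 2 (volume : Measure V), IsFT f g :=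
  ⟨_, (IsFT.of_Lp_inv (hg.toLp g)).congr (Filter.EventuallyEq.refl _ _) hg.coeFn_toLp⟩

end Multiplier

/-! ### The dyadic partition of unity. -/

section Dyadic

variable {φ₀ : ℝ → ℝ}

theorem IsBump.continuous_dyadic (h : IsBump φ₀) (k : ℕ) : Continuous (dyadic φ₀ k) := by
  have := h.smooth.continuous
  unfold dyadic
  split_ifs <;> fun_prop

theorem IsBump.abs_dyadic_le (h : IsBump φ₀) (k : ℕ) (r : ℝ) : |dyadic φ₀ k r| ≤ 1 := by
  unfold dyadic
  split_ifs
  · have := h.range r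
    rw [abs_le]; constructor <;> linarith [this.1, this.2]
  · have h1 := h.range (r / 2 ^ k)
    have h2 := h.range (2 * (r / 2 ^ k))
    rw [abs_le]; constructor <;> linarith [h1.1, h1.2, h2.1, h2.2]

theorem IsBump.norm_dyadic_le (h : IsBump φ₀) (k : ℕ) (r : ℝ) : ‖(dyadic φ₀ k r : ℂ)‖ ≤ 1 := by
  rw [Complex.norm_real]; exact h.abs_dyadic_le k r

theorem IsBump.eq_zero (h : IsBump φ₀) {r : ℝ} (hr : 2 ≤ |r|) : φ₀ r = 0 := by
  refine image_eq_zero_of_notMem_tsupport fun hm => ?_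
  have := h.supp hm
  rw [Set.mem_Ioo, ← abs_lt] at this
  linarith

theorem IsBump.eq_one' (h : IsBump φ₀) {r : ℝ} (hr : |r| ≤ 1) : φ₀ r = 1 :=
  h.eq_one r (abs_le.1 hr)

theorem two_rpow_sub_one (m : ℕ) : (2 : ℝ) ^ ((m : ℝ) - 1) = 2 ^ m / 2 := by
  rw [Real.rpow_sub (by norm_num), Real.rpow_natCast, Real.rpow_one]

theorem two_rpow_add_one (m : ℕ) : (2 : ℝ) ^ ((m : ℝ) + 1) = 2 ^ m * 2 := by
  rw [Real.rpow_add (by norm_num), Real.rpow_natCast, Real.rpow_one]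

theorem IsBump.mem_dyadicInterval (h : IsBump φ₀) {k : ℕ} {r : ℝ} (hr : dyadic φ₀ k r ≠ 0) :
    |r| ∈ dyadicInterval k := by
  unfold dyadicInterval
  unfold dyadic at hr
  split_ifs with hk
  · rw [if_pos hk] at hr
    refine ⟨abs_nonneg r, ?_⟩
    by_contra! hc
    exact hr (h.eq_zero hc.le)
  · rw [if_neg hk] at hr
    rw [two_rpow_sub_one, two_rpow_add_one]
    have hp : (0 : ℝ) < 2 ^ k := by positivity
    have e1 : |r / 2 ^ k| = |r| / 2 ^ k := by rw [abs_div, abs_of_pos hp]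
    have e2 : |2 * (r / 2 ^ k)| = 2 * (|r| / 2 ^ k) := by rw [abs_mul, e1]; norm_num
    constructor
    · by_contra! hc
      refine hr ?_
      have : |r| / 2 ^ k < 1 / 2 := by rw [div_lt_iff₀ hp]; linarith
      rw [h.eq_one' (by rw [e1]; linarith), h.eq_one' (by rw [e2]; linarith), sub_self]
    · by_contra! hc
      refine hr ?_
      have : 2 < |r| / 2 ^ k := by rw [lt_div_iff₀ hp]; linarith
      rw [h.eq_zero (by rw [e1]; linarith), h.eq_zero (by rw [e2]; linarith), sub_self]

theorem dyadicInterval_cover (J : ℕ) {r : ℝ} (h0 : 0 ≤ r) (hr : r ≤ 2 ^ (J + 1)) :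
    ∃ j ≤ J, r ∈ dyadicInterval j := by
  induction J with
  | zero => exact ⟨0, le_rfl, by simpa [dyadicInterval] using And.intro h0 (by simpa using hr)⟩
  | succ J ih =>
    by_cases h : r ≤ 2 ^ (J + 1)
    · obtain ⟨j, hj, h1⟩ := ih h
      exact ⟨j, hj.trans (Nat.le_succ _), h1⟩
    · refine ⟨J + 1, le_rfl, ?_⟩
      unfold dyadicInterval
      rw [if_neg (Nat.succ_ne_zero J), two_rpow_sub_one, two_rpow_add_one]
      push Not at h
      have hp : (0 : ℝ) < 2 ^ (J + 1) := by positivity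
      exact ⟨by linarith, by rw [← pow_succ]; exact hr⟩

theorem le_of_mem_dyadicInterval {m : ℕ} {r : ℝ} (hr : r ∈ dyadicInterval m) :
    0 ≤ r ∧ r ≤ 2 ^ (m + 1) := by
  unfold dyadicInterval at hr
  split_ifs at hr with h
  · subst h; simpa using hr
  · rw [two_rpow_sub_one, two_rpow_add_one] at hr
    exact ⟨le_trans (by positivity) hr.1, by rw [pow_succ]; exact hr.2⟩

theorem le_of_mem_dyadicInterval' {m : ℕ} (hm : m ≠ 0) {r : ℝ} (hr : r ∈ dyadicInterval m) :
    2 ^ m ≤ 2 * r := by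
  unfold dyadicInterval at hr
  rw [if_neg hm, two_rpow_sub_one] at hr
  linarith [hr.1]

theorem exists_le_two_pow (r : ℝ) : ∃ J : ℕ, r ≤ 2 ^ J := by
  obtain ⟨J, hJ⟩ := pow_unbounded_of_one_lt r (by norm_num : (1 : ℝ) < 2)
  exact ⟨J, hJ.le⟩

/-- The sum telescopes because 2 · r / 2^{N+1} = r / 2^N. -/
theorem sum_dyadic (N : ℕ) (r : ℝ) :
    ∑ j ∈ Finset.range (N + 1), dyadic φ₀ j r = φ₀ (r / 2 ^ N) := by
  induction N with
  | zero => simp [dyadic]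
  | succ N ih =>
    rw [Finset.sum_range_succ, ih]
    unfold dyadic
    rw [if_neg (Nat.succ_ne_zero N)]
    have : 2 * (r / 2 ^ (N + 1)) = r / 2 ^ N := by rw [pow_succ]; field_simp
    rw [this]; ring

theorem IsBump.exists_sum_dyadic (h : IsBump φ₀) (r : ℝ) :
    ∃ N₀ : ℕ, ∀ N ≥ N₀, ∑ j ∈ Finset.range (N + 1), dyadic φ₀ j r = 1 := by
  obtain ⟨J, hJ⟩ := exists_le_two_pow |r|
  refine ⟨J, fun N hN => ?_⟩
  rw [sum_dyadic]
  apply h.eq_one'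
  have h2 : (0 : ℝ) < 2 ^ N := by positivity
  rw [abs_div, abs_of_pos h2, div_le_one h2]
  exact hJ.trans (pow_le_pow_right₀ (by norm_num) hN)

theorem IsBump.exists_dyadic_ne (h : IsBump φ₀) (r : ℝ) : ∃ k, dyadic φ₀ k r ≠ 0 := by
  obtain ⟨N, hN⟩ := h.exists_sum_dyadic r
  by_contra! hc
  have := hN N le_rfl
  simp [hc] at this

/-- The triangle inequality in a partition of unity that is finite at each point. Together with
Minkowski it turns bounds on dyadic blocks into bounds on the whole function. -/
theorem IsBump.enorm_le_tsum (h : IsBump φ₀) (r : ℝ) (z : ℂ) :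
    ‖z‖ₑ ≤ ∑' k, ‖(dyadic φ₀ k r : ℂ) * z‖ₑ := by
  obtain ⟨N, hN⟩ := h.exists_sum_dyadic r
  have h1 : z = ∑ j ∈ Finset.range (N + 1), (dyadic φ₀ j r : ℂ) * z := by
    rw [← Finset.sum_mul, ← Complex.ofReal_sum, hN N le_rfl]; simp
  calc ‖z‖ₑ = ‖∑ j ∈ Finset.range (N + 1), (dyadic φ₀ j r : ℂ) * z‖ₑ := by rw [← h1]
    _ ≤ ∑ j ∈ Finset.range (N + 1), ‖(dyadic φ₀ j r : ℂ) * z‖ₑ := enorm_sum_le _ _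
    _ ≤ _ := ENNReal.sum_le_tsum _

end Dyadic

/-! ### The `Xₖ` norm on the Fourier side. -/

section XSum

variable {n : ℕ} {s : ℝ}

theorem continuous_disp (hs : 0 < s) : Continuous (disp s : Space n → ℝ) := by
  unfold disp
  exact Continuous.rpow_const (by fun_prop) fun _ => Or.inr (by linarith)

theorem continuous_modulation (hs : 0 < s) : Continuous (modulation s : SpaceTime n → ℝ) := by
  have := continuous_disp (n := n) hs
  unfold modulation
  fun_prop

theorem continuous_symb (hs : 0 < s) : Continuous (symb s : SpaceTime n → ℂ) := by
  have := continuous_modulation (n := n) hs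
  unfold symb
  fun_prop

theorem norm_symb_sq (ζ : SpaceTime n) : ‖symb s ζ‖ ^ 2 = 1 + modulation s ζ ^ 2 := by
  rw [← Complex.normSq_eq_norm_sq, Complex.normSq_apply]
  simp [symb]
  ring

theorem one_le_norm_symb (ζ : SpaceTime n) : 1 ≤ ‖symb s ζ‖ := by
  have := norm_symb_sq (s := s) ζ
  nlinarith [norm_nonneg (symb s ζ), sq_nonneg (modulation s ζ)]

theorem modulation_le_norm_symb (ζ : SpaceTime n) : |modulation s ζ| ≤ ‖symb s ζ‖ := by
  have := norm_symb_sq (s := s) ζ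
  refine abs_le_of_sq_le_sq ?_ (norm_nonneg _)
  linarith

theorem symb_ne_zero (ζ : SpaceTime n) : symb s ζ ≠ 0 := by
  have := one_le_norm_symb (s := s) ζ
  rw [← norm_pos_iff]; linarith

variable {φ₀ : ℝ → ℝ}

/-- The `Xₖ` norm in terms of the Fourier transform `v`, without the support condition. -/
def xSum (φ₀ : ℝ → ℝ) (s : ℝ) (v : SpaceTime n → ℂ) : ℝ≥0∞ :=
  ∑' j : ℕ, (2 : ℝ≥0∞) ^ ((j : ℝ) / 2) *
    eLpNorm (fun ζ => (dyadic φ₀ j (modulation s ζ) : ℂ) * v ζ) 2 volume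

theorem IsBump.continuous_dyadic_modulation (h : IsBump φ₀) (hs : 0 < s) (j : ℕ) :
    Continuous (fun ζ : SpaceTime n => (dyadic φ₀ j (modulation s ζ) : ℂ)) :=
  Complex.continuous_ofReal.comp ((h.continuous_dyadic j).comp (continuous_modulation hs))

theorem xNorm_eq_xSum (h : IsBump φ₀) (hs : 0 < s) {k : ℕ} {f : L2ST n} {v : SpaceTime n → ℂ}
    (hf : IsFT f v) (hsupp : ∀ᵐ ζ, ζ ∉ regionX s k → v ζ = 0) :
    xNorm φ₀ s k f = xSum φ₀ s v := by
  have h1 : FourierSupportedIn f (regionX s k) := by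
    filter_upwards [hf.coe_fourier, hsupp] with ζ h1 h2 h3
    rw [h1, h2 h3]
  unfold xNorm xSum
  rw [if_pos h1]
  refine tsum_congr fun j => ?_
  congr 1
  have h2 := isFT_l2Multiplier hf (memLp_mul_of_bound
    (h.continuous_dyadic_modulation hs j).aestronglyMeasurable
    (fun ζ => h.norm_dyadic_le j _) hf.right)
  rw [← h2.eLpNorm_eq, Lp.enorm_def]
  rfl

theorem supp_of_xNorm_lt {k : ℕ} {f : L2ST n} {v : SpaceTime n → ℂ}
    (hf : IsFT f v) (h : xNorm φ₀ s k f < ⊤) : ∀ᵐ ζ, ζ ∉ regionX s k → v ζ = 0 := by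
  unfold xNorm at h
  split_ifs at h with h1
  · filter_upwards [hf.coe_fourier, h1] with ζ h2 h3 h4
    rw [← h2, h3 h4]
  · simp at h

theorem eLpNorm_le_xSum (h : IsBump φ₀) (hs : 0 < s) {v : SpaceTime n → ℂ}
    (hv : AEStronglyMeasurable v) : eLpNorm v 2 volume ≤ xSum φ₀ s v := by
  refine (eLpNorm_le_tsum (w := fun j ζ => (dyadic φ₀ j (modulation s ζ) : ℂ) * v ζ)
    (fun j => (h.continuous_dyadic_modulation hs j).aestronglyMeasurable.mul hv)
    (Filter.Eventually.of_forall fun ζ => h.enorm_le_tsum _ _)).trans ?_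
  refine ENNReal.tsum_le_tsum fun j => ?_
  refine le_mul_of_one_le_left bot_le ?_
  rw [← ENNReal.rpow_zero (x := 2)]
  exact ENNReal.rpow_le_rpow_of_exponent_le (by norm_num) (by positivity)

theorem xSum_add_le (h : IsBump φ₀) (hs : 0 < s) {v w : SpaceTime n → ℂ}
    (hv : AEStronglyMeasurable v) (hw : AEStronglyMeasurable w) :
    xSum φ₀ s (fun ζ => v ζ + w ζ) ≤ xSum φ₀ s v + xSum φ₀ s w := by
  unfold xSum
  rw [← ENNReal.tsum_add]
  refine ENNReal.tsum_le_tsum fun j => ?_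
  rw [← mul_add]
  gcongr
  have hc := (h.continuous_dyadic_modulation (n := n) hs j).aestronglyMeasurable (μ := volume)
  have := eLpNorm_add_le (hc.mul hv) (hc.mul hw) (p := 2) (by norm_num)
  refine le_trans (le_of_eq ?_) this
  congr 1
  ext ζ
  simp [mul_add]

/-- The decay rate `2 ^ (-1/2)` of the dyadic sums. -/
def decay : ℝ≥0∞ := (2 : ℝ≥0∞) ^ (-(1 / 2) : ℝ)

theorem decay_lt_one : decay < 1 := ENNReal.rpow_lt_one_of_one_lt_of_neg (by norm_num) (by norm_num)

theorem decay_pow (j : ℕ) : decay ^ j = (2 : ℝ≥0∞) ^ (-((j : ℝ) / 2)) := by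
  rw [decay, ← ENNReal.rpow_natCast, ← ENNReal.rpow_mul]
  congr 1; ring

/-- The constant `2 ∑ 2 ^ (-j/2)`. -/
def decaySum : ℝ≥0∞ := 2 * (1 - decay)⁻¹

theorem decaySum_lt_top : decaySum < ⊤ := by
  unfold decaySum
  refine ENNReal.mul_lt_top (by norm_num) ?_
  rw [ENNReal.inv_lt_top]
  exact tsub_pos_of_lt decay_lt_one

/-- With truncated subtraction the exponent is |j - m|, so the sum consists of two pieces, each at
most a full geometric series. -/
theorem tsum_decay_le (m : ℕ) : ∑' j : ℕ, decay ^ ((j - m) + (m - j)) ≤ decaySum := by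
  have hS : ∑' j : ℕ, decay ^ j = (1 - decay)⁻¹ := ENNReal.tsum_geometric _
  have h1 : ∑' j : ℕ, decay ^ (j - m + (m - j)) =
      ∑ j ∈ Finset.range m, decay ^ (j - m + (m - j)) + ∑' j : ℕ, decay ^ (j + m - m + (m - (j + m))) :=
    (ENNReal.summable.sum_add_tsum_nat_add' (k := m)).symm
  rw [h1, decaySum, two_mul, ← hS]
  refine add_le_add ?_ (ENNReal.tsum_le_tsum fun j => le_of_eq ?_)
  · rw [← Finset.sum_range_reflect]
    calc _ ≤ ∑ j ∈ Finset.range m, decay ^ j := by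
          refine Finset.sum_le_sum fun j hj => ?_
          rw [Finset.mem_range] at hj
          exact pow_le_pow_right_of_le_one' decay_lt_one.le (by omega)
      _ ≤ _ := ENNReal.sum_le_tsum _
  · congr 1
    omega

/-- Interpolation between `L²` and the weight `|modulation|`. -/
theorem xSum_le (h : IsBump φ₀) (v : SpaceTime n → ℂ) (m : ℕ) :
    xSum φ₀ s v ≤ decaySum * ((2 : ℝ≥0∞) ^ ((m : ℝ) / 2) * eLpNorm v 2 volume +
      2 * (2 : ℝ≥0∞) ^ (-((m : ℝ) / 2)) *
        eLpNorm (fun ζ => (modulation s ζ : ℂ) * v ζ) 2 volume) := by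
  set A := eLpNorm v 2 volume
  set B := eLpNorm (fun ζ => (modulation s ζ : ℂ) * v ζ) 2 volume
  have hterm : ∀ j : ℕ, (2 : ℝ≥0∞) ^ ((j : ℝ) / 2) *
      eLpNorm (fun ζ => (dyadic φ₀ j (modulation s ζ) : ℂ) * v ζ) 2 volume ≤
      decay ^ ((j - m) + (m - j)) * ((2 : ℝ≥0∞) ^ ((m : ℝ) / 2) * A +
        2 * (2 : ℝ≥0∞) ^ (-((m : ℝ) / 2)) * B) := by
    intro j
    -- Below the splitting index the cut-off is bounded by 1. Above it the modulation is at least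
    -- 2^{j-1}, which gains 2 · 2^{-j}. Either way the term decays like 2^{-|j-m|/2}.
    rcases le_or_gt j m with hj | hj
    · have h1 : eLpNorm (fun ζ => (dyadic φ₀ j (modulation s ζ) : ℂ) * v ζ) 2 volume ≤ A := by
        refine eLpNorm_mono fun ζ => ?_
        rw [norm_mul]
        exact mul_le_of_le_one_left (norm_nonneg _) (h.norm_dyadic_le _ _)
      have h2 : (2 : ℝ≥0∞) ^ ((j : ℝ) / 2) = decay ^ ((j - m) + (m - j)) * 2 ^ ((m : ℝ) / 2) := by
        rw [Nat.sub_eq_zero_of_le hj, zero_add, decay_pow, ← ENNReal.rpow_add _ _ (by norm_num)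
          (by norm_num), Nat.cast_sub hj]
        congr 1; ring
      rw [h2, mul_assoc]
      gcongr
      exact (mul_le_mul_right h1 _).trans le_self_add
    · have h1 : eLpNorm (fun ζ => (dyadic φ₀ j (modulation s ζ) : ℂ) * v ζ) 2 volume ≤
          2 * (2 : ℝ≥0∞) ^ (-(j : ℝ)) * B := by
        have h2 : ∀ ζ : SpaceTime n, ‖(dyadic φ₀ j (modulation s ζ) : ℂ) * v ζ‖ ≤
            (2 * (2 : ℝ) ^ (-(j : ℝ))) * ‖(modulation s ζ : ℂ) * v ζ‖ := by
          intro ζ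
          by_cases h0 : dyadic φ₀ j (modulation s ζ) = 0
          · rw [h0]; simp; positivity
          · have h3 := le_of_mem_dyadicInterval' (by omega) (h.mem_dyadicInterval h0)
            rw [norm_mul, norm_mul, ← mul_assoc]
            gcongr
            refine (h.norm_dyadic_le _ _).trans ?_
            rw [Complex.norm_real, Real.norm_eq_abs, Real.rpow_neg (by norm_num), Real.rpow_natCast]
            have hp : (0 : ℝ) < 2 ^ j := by positivity
            rw [mul_right_comm, ← div_eq_mul_inv, le_div_iff₀ hp]
            linarith
        have h3 := eLpNorm_le_mul_eLpNorm_of_ae_le_mul (Filter.Eventually.of_forall h2) 2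
          (μ := volume)
        refine h3.trans (le_of_eq ?_)
        congr 1
        rw [ENNReal.ofReal_mul (by norm_num), ← ENNReal.ofReal_rpow_of_pos (by norm_num)]
        norm_num
      have h2 : (2 : ℝ≥0∞) ^ ((j : ℝ) / 2) * (2 : ℝ≥0∞) ^ (-(j : ℝ)) =
          decay ^ ((j - m) + (m - j)) * 2 ^ (-((m : ℝ) / 2)) := by
        rw [Nat.sub_eq_zero_of_le hj.le, add_zero, decay_pow, ← ENNReal.rpow_add _ _ (by norm_num)
          (by norm_num), ← ENNReal.rpow_add _ _ (by norm_num) (by norm_num), Nat.cast_sub hj.le]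
        congr 1; ring
      calc _ ≤ (2 : ℝ≥0∞) ^ ((j : ℝ) / 2) * (2 * (2 : ℝ≥0∞) ^ (-(j : ℝ)) * B) := by gcongr
        _ = ((2 : ℝ≥0∞) ^ ((j : ℝ) / 2) * (2 : ℝ≥0∞) ^ (-(j : ℝ))) * (2 * B) := by ring
        _ = decay ^ ((j - m) + (m - j)) * (2 * 2 ^ (-((m : ℝ) / 2)) * B) := by rw [h2]; ring
        _ ≤ _ := by gcongr; exact le_add_self
  calc xSum φ₀ s v ≤ ∑' j : ℕ, decay ^ ((j - m) + (m - j)) * ((2 : ℝ≥0∞) ^ ((m : ℝ) / 2) * A +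
        2 * (2 : ℝ≥0∞) ^ (-((m : ℝ) / 2)) * B) := ENNReal.tsum_le_tsum hterm
    _ = (∑' j : ℕ, decay ^ ((j - m) + (m - j))) * _ := ENNReal.tsum_mul_right
    _ ≤ _ := by gcongr; exact tsum_decay_le m

/-- This is `xSum_le` at splitting index 0, since |`symb`| dominates both 1 and the modulation; the
constant is 1 + 2. Every remainder of the proof that is smooth in time enters `Xₖ` through this
bound. -/
theorem xSum_le_symb (h : IsBump φ₀) (v : SpaceTime n → ℂ) :
    xSum φ₀ s v ≤ 3 * decaySum * eLpNorm (fun ζ => symb s ζ * v ζ) 2 volume := by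
  refine (xSum_le h v 0).trans ?_
  have h1 : eLpNorm v 2 volume ≤ eLpNorm (fun ζ => symb s ζ * v ζ) 2 volume := by
    refine eLpNorm_mono fun ζ => ?_
    rw [norm_mul]
    exact le_mul_of_one_le_left (norm_nonneg _) (one_le_norm_symb ζ)
  have h2 : eLpNorm (fun ζ => (modulation s ζ : ℂ) * v ζ) 2 volume ≤
      eLpNorm (fun ζ => symb s ζ * v ζ) 2 volume := by
    refine eLpNorm_mono fun ζ => ?_
    rw [norm_mul, norm_mul, Complex.norm_real]
    gcongr
    exact modulation_le_norm_symb ζ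
  simp only [Nat.cast_zero, zero_div, neg_zero, ENNReal.rpow_zero, one_mul, mul_one]
  calc _ ≤ decaySum * (eLpNorm (fun ζ => symb s ζ * v ζ) 2 volume +
        2 * eLpNorm (fun ζ => symb s ζ * v ζ) 2 volume) := by gcongr
    _ = _ := by ring

end XSum

/-! ### The inverse Fourier transform in time as an absolutely convergent integral. -/

section InvFT

/-- The inverse Fourier transform in time, as an integral. -/
def invFT (q : ℝ → ℂ) (t : ℝ) : ℂ :=
  ∫ τ : ℝ, Complex.exp (Complex.I * t * (2 * Real.pi * τ)) * q τ

theorem invFT_eq (q : ℝ → ℂ) (t : ℝ) : invFT q t = 𝓕 q (-t) := by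
  rw [Real.fourier_real_eq_integral_exp_smul]
  refine integral_congr_ae (Filter.Eventually.of_forall fun τ => ?_)
  simp only [smul_eq_mul]
  congr 2
  push_cast; ring

theorem continuous_invFT {q : ℝ → ℂ} (hq : Integrable q) : Continuous (invFT q) := by
  have := (continuous_fourier hq).comp continuous_neg
  convert this using 1
  ext t
  exact invFT_eq q t

theorem isFT_invFT {q : ℝ → ℂ} (hq : Integrable q) (hq2 : MemLp q 2) : IsFT (invFT q) q := by
  have := (IsFT.of_integrable hq hq2).reflect
  refine this.congr (Filter.EventuallyEq.of_eq ?_) (Filter.EventuallyEq.refl _ _)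
  ext t
  exact (invFT_eq q t).symm

theorem invFT_zero_eq (q : ℝ → ℂ) : invFT q 0 = ∫ τ, q τ := by simp [invFT]

theorem hasDerivAt_invFT {q : ℝ → ℂ} (hq : Integrable q) (hq' : Integrable fun τ : ℝ => τ * q τ)
    (t : ℝ) : HasDerivAt (invFT q) (invFT (fun τ => 2 * Real.pi * Complex.I * (τ * q τ)) t) t := by
  have h1 := Real.hasDerivAt_fourier hq (by simpa using hq') (-t)
  have h2 := h1.scomp t (hasDerivAt_neg t)
  have e1 : 𝓕 q ∘ Neg.neg = invFT q := by ext t; exact (invFT_eq q t).symm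
  rw [e1] at h2
  refine h2.congr_deriv ?_
  rw [invFT_eq, neg_smul, one_smul]
  rw [Real.fourier_real_eq_integral_exp_smul, Real.fourier_real_eq_integral_exp_smul,
    ← integral_neg]
  refine integral_congr_ae (Filter.Eventually.of_forall fun τ => ?_)
  simp only [smul_eq_mul]
  ring

theorem integrable_exp_mul {p : ℝ → ℂ} (hp : Integrable p) (t : ℝ) :
    Integrable fun τ : ℝ => Complex.exp (Complex.I * t * (2 * Real.pi * τ)) * p τ := by
  refine hp.bdd_mul (c := 1) (Continuous.aestronglyMeasurable (by fun_prop))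
    (Filter.Eventually.of_forall fun τ => ?_)
  rw [Complex.norm_exp]; simp

/-- `e^{itw}` times the inverse Fourier transform, and its derivative. -/
theorem hasDerivAt_exp_mul_invFT {q : ℝ → ℂ} (hq : Integrable q)
    (hq' : Integrable fun τ : ℝ => τ * q τ) (w t : ℝ) :
    HasDerivAt (fun t : ℝ => Complex.exp (Complex.I * t * w) * invFT q t)
      (Complex.exp (Complex.I * t * w) *
        (Complex.I * invFT (fun τ => ((2 * Real.pi * τ + w : ℝ) : ℂ) * q τ) t)) t := by
  have h1 : HasDerivAt (fun t : ℝ => Complex.I * (t : ℂ) * w) (Complex.I * w) t := by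
    have := ((hasDerivAt_id t).ofReal_comp.const_mul Complex.I).mul_const (w : ℂ)
    simp only [id_eq, Complex.ofReal_one, mul_one] at this
    exact this
  refine (h1.cexp.mul (hasDerivAt_invFT hq hq' t)).congr_deriv ?_
  have e1 : invFT (fun τ => ((2 * Real.pi * τ + w : ℝ) : ℂ) * q τ) t =
      2 * Real.pi * invFT (fun τ => τ * q τ) t + w * invFT q t := by
    unfold invFT
    rw [← integral_const_mul, ← integral_const_mul, ← integral_add]
    · refine integral_congr_ae (Filter.Eventually.of_forall fun τ => ?_)
      simp only
      push_cast; ring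
    · exact (integrable_exp_mul hq' t).const_mul _
    · exact (integrable_exp_mul hq t).const_mul _
  have e2 : invFT (fun τ => 2 * Real.pi * Complex.I * (τ * q τ)) t =
      2 * Real.pi * Complex.I * invFT (fun τ => τ * q τ) t := by
    unfold invFT
    rw [← integral_const_mul]
    refine integral_congr_ae (Filter.Eventually.of_forall fun τ => ?_)
    simp only
    ring
  rw [e1, e2]
  ring

end InvFT

/-! ### The Duhamel integral of a pure oscillation, and its superposition. -/

section Kernel

variable {n : ℕ} {s : ℝ}

theorem norm_exp_I_mul' (r w : ℝ) : ‖Complex.exp (Complex.I * r * w)‖ = 1 := by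
  rw [Complex.norm_exp]; simp

theorem continuous_duhamelKernel (hs : 0 < s) :
    Continuous fun z : ℝ × SpaceTime n => duhamelKernel s z.1 z.2 := by
  have hd := continuous_disp (n := n) hs
  unfold duhamelKernel
  refine intervalIntegral.continuous_parametric_intervalIntegral_of_continuous
    (f := fun (z : ℝ × SpaceTime n) r => Complex.exp (-(Complex.I * (z.1 - r) * disp s z.2.fst)) *
    Complex.exp (Complex.I * r * (2 * Real.pi * z.2.snd))) ?_ continuous_fst
  unfold Function.uncurry
  fun_prop

theorem norm_duhamelKernel_le (t : ℝ) (ζ : SpaceTime n) : ‖duhamelKernel s t ζ‖ ≤ |t| := by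
  unfold duhamelKernel
  have := intervalIntegral.norm_integral_le_of_norm_le_const (a := 0) (b := t) (C := 1)
    (f := fun r : ℝ => Complex.exp (-(Complex.I * (t - r) * disp s ζ.fst)) *
    Complex.exp (Complex.I * r * (2 * Real.pi * ζ.snd))) ?_
  · simpa using this
  · intro r _
    rw [norm_mul, Complex.norm_exp, Complex.norm_exp]
    simp

/-- The equation solved by the Duhamel integral of a pure oscillation. -/
theorem I_mul_symb_mul_duhamelKernel (t : ℝ) (ζ : SpaceTime n) :
    Complex.I * (symb s ζ * duhamelKernel s t ζ) =
      -Complex.exp (Complex.I * t * (2 * Real.pi * ζ.snd)) +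
        Complex.exp (-(Complex.I * t * disp s ζ.fst)) - duhamelKernel s t ζ := by
  set w := disp s ζ.fst
  set m : ℂ := (modulation s ζ : ℂ) with hm
  have hm' : m = 2 * Real.pi * ζ.snd + w := by rw [hm]; unfold modulation; push_cast; rfl
  have h1 : duhamelKernel s t ζ =
      Complex.exp (-(Complex.I * t * w)) * ∫ r in (0 : ℝ)..t, Complex.exp (Complex.I * m * r) := by
    unfold duhamelKernel
    rw [← intervalIntegral.integral_const_mul]
    refine intervalIntegral.integral_congr fun r _ => ?_
    rw [← Complex.exp_add, ← Complex.exp_add, hm']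
    congr 1; ring
  have h2 : Complex.I * m * ∫ r in (0 : ℝ)..t, Complex.exp (Complex.I * m * r) =
      Complex.exp (Complex.I * m * t) - 1 := by
    -- In this form the primitive involves no division by the modulation, so resonant frequencies
    -- need no exception in the conclusion.
    by_cases h0 : Complex.I * m = 0
    · simp [h0]
    · rw [integral_exp_mul_complex h0]
      rw [mul_div_cancel₀ _ h0]
      simp
  have h3 : Complex.exp (-(Complex.I * t * w)) * Complex.exp (Complex.I * m * t) =
      Complex.exp (Complex.I * t * (2 * Real.pi * ζ.snd)) := by
    rw [← Complex.exp_add, hm']; congr 1; ring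
  have h4 : symb s ζ = -m + Complex.I := rfl
  rw [h4, ← h3]
  linear_combination (-Complex.I * m - 1) * h1 - Complex.exp (-(Complex.I * t * w)) * h2 +
    (duhamelKernel s t ζ) * Complex.I_sq + h1

/-- Parametric integrals over time frequency are measurable. -/
theorem aestronglyMeasurable_integral_kernel {v : SpaceTime n → ℂ} (hv : AEStronglyMeasurable v)
    {K : (Space n × ℝ) × ℝ → ℂ} (hK : Continuous K) :
    AEStronglyMeasurable (fun z : Space n × ℝ => ∫ τ, v (pt z.1 τ) * K (z, τ))
      (volume.prod volume) := by
  have hpt : Measurable fun z : Space n × ℝ => (pt z.1 z.2 : SpaceTime n) :=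
    (WithLp.volume_preserving_toLp (Space n) ℝ).measurable
  have h1 : StronglyMeasurable (fun z : Space n × ℝ => ∫ τ, hv.mk v (pt z.1 τ) * K (z, τ)) := by
    apply StronglyMeasurable.integral_prod_right' (f := fun w : (Space n × ℝ) × ℝ =>
      hv.mk v (pt w.1.1 w.2) * K w)
    exact (hv.stronglyMeasurable_mk.comp_measurable
      (hpt.comp ((measurable_fst.comp measurable_fst).prodMk measurable_snd))).mul
      hK.stronglyMeasurable
  refine ⟨_, h1, ?_⟩
  have h2 := (Measure.quasiMeasurePreserving_fst (μ := (volume : Measure (Space n)))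
    (ν := (volume : Measure ℝ))).ae (ae_fiber_toLp hv.ae_eq_mk)
  filter_upwards [h2] with z hz
  refine integral_congr_ae ?_
  filter_upwards [hz] with τ hτ
  rw [hτ]

/-- The spatial Fourier transform of `i ψ(t) ∫₀ᵗ e^{-i(t-r)(-Δ)^s} F(r) dr`, where `v` is the
space-time Fourier transform of `(i ∂ₜ - (-Δ) ^ s + i)⁻¹ F`. -/
def duhProfile (ψ : ℝ → ℝ) (s : ℝ) (v : SpaceTime n → ℂ) (ξ : Space n) (t : ℝ) : ℂ :=
  Complex.I * ψ t * duhamelHat s (fun ζ => symb s ζ * v ζ) t ξ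

/-- The free part of the Duhamel term, conjugated by the free evolution. -/
def freePart (s : ℝ) (v : SpaceTime n → ℂ) (ξ : Space n) (t : ℝ) : ℂ :=
  invFT (fun τ => v (pt ξ τ)) 0 -
    ∫ r in (0 : ℝ)..t, Complex.exp (Complex.I * r * disp s ξ) * invFT (fun τ => v (pt ξ τ)) r

/-- Multiply the identity for the kernel by `v` and integrate over `τ`. The three terms become the
solution itself, the free evolution of its value at time 0, and a Duhamel integral of the solution
caused by the `+ i` in the symbol. Integrability of the fibre gives the solution a value at each
time. -/
theorem duhProfile_eq (hs : 0 < s) (ψ : ℝ → ℝ) {v : SpaceTime n → ℂ} {ξ : Space n}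
    (hv : Integrable fun τ => v (pt ξ τ)) (t : ℝ) :
    duhProfile ψ s v ξ t = -(ψ t * invFT (fun τ => v (pt ξ τ)) t) +
      ψ t * (Complex.exp (-(Complex.I * t * disp s ξ)) * freePart s v ξ t) := by
  have hD : Continuous fun τ : ℝ => duhamelKernel s t (pt ξ τ) := by
    have hpt : Continuous fun τ : ℝ => ((t, pt ξ τ) : ℝ × SpaceTime n) := by fun_prop
    exact Continuous.comp (g := fun z : ℝ × SpaceTime n => duhamelKernel s z.1 z.2)
      (f := fun τ : ℝ => ((t, pt ξ τ) : ℝ × SpaceTime n)) (continuous_duhamelKernel hs) hpt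
  have i1 := integrable_exp_mul hv t
  have i2 : Integrable fun τ : ℝ => v (pt ξ τ) * duhamelKernel s t (pt ξ τ) :=
    Integrable.mul_bdd (f := fun τ => v (pt ξ τ)) (g := fun τ => duhamelKernel s t (pt ξ τ))
      (c := |t|) hv hD.aestronglyMeasurable
      (Filter.Eventually.of_forall fun τ => norm_duhamelKernel_le t (pt ξ τ))
  have h1 : Complex.I * duhamelHat s (fun ζ => symb s ζ * v ζ) t ξ =
      -invFT (fun τ => v (pt ξ τ)) t +
        Complex.exp (-(Complex.I * t * disp s ξ)) * invFT (fun τ => v (pt ξ τ)) 0 -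
        duhamelHat s v t ξ := by
    rw [invFT_zero_eq]
    unfold invFT duhamelHat
    rw [← integral_const_mul, ← integral_const_mul, ← integral_neg, ← integral_add, ← integral_sub]
    · refine integral_congr_ae (Filter.Eventually.of_forall fun τ => ?_)
      have := I_mul_symb_mul_duhamelKernel (s := s) t (pt ξ τ)
      simp only [WithLp.toLp_fst, WithLp.toLp_snd] at this ⊢
      linear_combination (v (pt ξ τ)) * this
    · exact i1.neg.add (hv.const_mul _)
    · exact i2
    · exact i1.neg
    · exact hv.const_mul _
  have h2 : duhamelHat s v t ξ = Complex.exp (-(Complex.I * t * disp s ξ)) *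
      ∫ r in (0 : ℝ)..t, Complex.exp (Complex.I * r * disp s ξ) *
        invFT (fun τ => v (pt ξ τ)) r := by
    rw [duhamelHat_eq s v t ξ hv, ← intervalIntegral.integral_const_mul]
    refine intervalIntegral.integral_congr fun r _ => ?_
    rw [← mul_assoc, ← Complex.exp_add]
    unfold invFT
    congr 2
    ring
  unfold duhProfile freePart
  rw [h2] at h1
  linear_combination (ψ t : ℂ) * h1

theorem hasDerivAt_freePart {v : SpaceTime n → ℂ} {ξ : Space n}
    (hv : Integrable fun τ => v (pt ξ τ)) (t : ℝ) :
    HasDerivAt (freePart s v ξ)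
      (-(Complex.exp (Complex.I * t * disp s ξ) * invFT (fun τ => v (pt ξ τ)) t)) t := by
  have hc := continuous_invFT hv
  have h1 : Continuous fun r : ℝ => Complex.exp (Complex.I * r * disp s ξ) *
      invFT (fun τ => v (pt ξ τ)) r := by fun_prop
  have h2 := intervalIntegral.integral_hasDerivAt_right (h1.intervalIntegrable 0 t)
    (h1.stronglyMeasurableAtFilter _ _) h1.continuousAt
  exact h2.const_sub _

end Kernel

/-! ### Space-time Fourier transforms of free and Duhamel terms. -/

section Lift

variable {n : ℕ} {s : ℝ} {φ₀ ψ : ℝ → ℝ}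

theorem aestronglyMeasurable_toLp {U V : Type*} [NormedAddCommGroup U] [InnerProductSpace ℝ U]
    [FiniteDimensional ℝ U] [MeasurableSpace U] [BorelSpace U]
    [NormedAddCommGroup V] [InnerProductSpace ℝ V]
    [FiniteDimensional ℝ V] [MeasurableSpace V] [BorelSpace V] {f : WithLp 2 (U × V) → ℂ}
    (hf : AEStronglyMeasurable f) :
    AEStronglyMeasurable (fun z : U × V => f (WithLp.toLp 2 z)) (volume.prod volume) :=
  hf.comp_measurePreserving (WithLp.volume_preserving_toLp U V)

theorem aestronglyMeasurable_ofLp {U V : Type*} [NormedAddCommGroup U] [InnerProductSpace ℝ U]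
    [FiniteDimensional ℝ U] [MeasurableSpace U] [BorelSpace U]
    [NormedAddCommGroup V] [InnerProductSpace ℝ V]
    [FiniteDimensional ℝ V] [MeasurableSpace V] [BorelSpace V] {f : U × V → ℂ}
    (hf : AEStronglyMeasurable f (volume.prod volume)) :
    AEStronglyMeasurable (fun ζ : WithLp 2 (U × V) => f (WithLp.ofLp ζ)) :=
  hf.comp_measurePreserving (WithLp.volume_preserving_ofLp U V)

theorem sqNorm_fiber {v : SpaceTime n → ℂ} (hv : AEStronglyMeasurable v) :
    sqNorm volume v = ∫⁻ ξ : Space n, sqNorm volume (fun τ : ℝ => v (pt ξ τ)) := by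
  rw [← sqNorm_toLp, sqNorm_prod (aestronglyMeasurable_toLp hv)]

theorem symb_pt (ξ : Space n) (τ : ℝ) : symb s (pt ξ τ) = timeSymb (disp s ξ) τ := by
  simp [symb, timeSymb, modulation]

theorem memLp_fiber_toLp {v : SpaceTime n → ℂ} (hv : MemLp v 2) :
    ∀ᵐ ξ : Space n, MemLp (fun τ : ℝ => v (pt ξ τ)) 2 :=
  memLp_fiber (memLp_toLp_iff.2 hv)

theorem aestronglyMeasurable_fiber_toLp {v : SpaceTime n → ℂ} (hv : AEStronglyMeasurable v) :
    ∀ᵐ ξ : Space n, AEStronglyMeasurable (fun τ : ℝ => v (pt ξ τ)) :=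
  (aestronglyMeasurable_toLp hv).prodMk_left

/-- Functions `ψ(t) e^{-it|ξ|^{2s}} R(ξ, t)` have space-time Fourier transforms that are
concentrated near the characteristic surface. -/
theorem exists_free_lift (hs : 0 < s) (hψ : IsTimeCutoff ψ) :
    ∃ C : ℝ≥0, ∀ (n : ℕ) (R R' : Space n → ℝ → ℂ),
      (∀ᵐ ξ, (∀ t, HasDerivAt (R ξ) (R' ξ t) t) ∧ Continuous (R' ξ)) →
      AEStronglyMeasurable (fun z : Space n × ℝ =>
        ψ z.2 * (Complex.exp (-(Complex.I * z.2 * disp s z.1)) * R z.1 z.2))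
        (volume.prod volume) →
      ∃ u : SpaceTime n → ℂ, AEStronglyMeasurable u ∧
        (∀ᵐ ξ, IsFT (fun t : ℝ => ψ t * (Complex.exp (-(Complex.I * t * disp s ξ)) * R ξ t))
          (fun τ => u (pt ξ τ))) ∧
        sqNorm volume (fun ζ => symb s ζ * u ζ) ≤
          C * ∫⁻ ξ, (‖R ξ 0‖ₑ ^ 2 + sqNorm volume (R' ξ)) := by
  obtain ⟨C, hC⟩ := sqNorm_timeSymb_le' hψ
  refine ⟨C, fun n R R' hR hm => ?_⟩
  have h1 := aestronglyMeasurable_fourier_fiber hm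
  set u : SpaceTime n → ℂ := fun ζ => 𝓕 (fun t : ℝ => ψ t *
    (Complex.exp (-(Complex.I * t * disp s ζ.fst)) * R ζ.fst t)) ζ.snd with hu
  have hum : AEStronglyMeasurable u := aestronglyMeasurable_ofLp h1
  refine ⟨u, hum, ?_, ?_⟩
  · filter_upwards [hR] with ξ hξ
    exact (isFT_timeSymb hψ.smooth hψ.hasCompactSupport (disp s ξ) hξ.1 hξ.2).1
  · rw [sqNorm_fiber (v := fun ζ => symb s ζ * u ζ) ((continuous_symb hs).aestronglyMeasurable.mul hum),
      ← lintegral_const_mul' _ _ ENNReal.coe_ne_top]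
    refine lintegral_mono_ae (hR.mono fun ξ hξ => ?_)
    have := hC (disp s ξ) (R ξ) (R' ξ) hξ.1 hξ.2
    simpa only [symb_pt, hu, WithLp.toLp_fst, WithLp.toLp_snd] using this

/-- `u` is the space-time Fourier transform of the Duhamel term if `v` is that of
`(i ∂ₜ - (-Δ) ^ s + i)⁻¹ F`. -/
structure DuhOf (ψ : ℝ → ℝ) (s : ℝ) (v u : SpaceTime n → ℂ) : Prop where
  integrable : ∀ᵐ ξ : Space n, Integrable fun τ : ℝ => v (pt ξ τ)
  isFT : ∀ᵐ ξ : Space n, IsFT (duhProfile ψ s v ξ) (fun τ => u (pt ξ τ))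

theorem duhProfile_congr {v v' : SpaceTime n → ℂ} {ξ : Space n}
    (h : (fun τ : ℝ => v (pt ξ τ)) =ᵐ[volume] fun τ => v' (pt ξ τ)) :
    duhProfile ψ s v ξ = duhProfile ψ s v' ξ := by
  ext t
  unfold duhProfile duhamelHat
  congr 1
  refine integral_congr_ae ?_
  filter_upwards [h] with τ hτ
  simp only [hτ]

/-- The integrand of `duhamelHat` carries the unbounded factor `symb`. Rewriting by `duhProfile_eq`
leaves only integrals of `v` and `v'`, for which integrability is at hand. -/
theorem DuhOf.add (hs : 0 < s) {v v' u u' : SpaceTime n → ℂ} (h : DuhOf ψ s v u)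
    (h' : DuhOf ψ s v' u') : DuhOf ψ s (fun ζ => v ζ + v' ζ) (fun ζ => u ζ + u' ζ) := by
  refine ⟨?_, ?_⟩
  · filter_upwards [h.integrable, h'.integrable] with ξ h1 h2 using h1.add h2
  · filter_upwards [h.isFT, h'.isFT, h.integrable, h'.integrable] with ξ h1 h2 h3 h4
    refine (h1.add h2).congr (Filter.EventuallyEq.of_eq ?_) (Filter.EventuallyEq.refl _ _)
    ext t
    have e1 : invFT (fun τ => v (pt ξ τ) + v' (pt ξ τ)) =
        fun t => invFT (fun τ => v (pt ξ τ)) t + invFT (fun τ => v' (pt ξ τ)) t := by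
      ext t
      unfold invFT
      rw [← integral_add (integrable_exp_mul h3 t) (integrable_exp_mul h4 t)]
      simp only [mul_add]
    rw [duhProfile_eq hs ψ h3, duhProfile_eq hs ψ h4,
      duhProfile_eq hs ψ (v := fun ζ => v ζ + v' ζ) (h3.add h4)]
    unfold freePart
    simp only [e1]
    have c3 := continuous_invFT h3
    have c4 := continuous_invFT h4
    simp only [mul_add]
    rw [intervalIntegral.integral_add
      (Continuous.intervalIntegrable (by fun_prop) _ _)
      (Continuous.intervalIntegrable (by fun_prop) _ _)]
    ring

theorem DuhOf.zero : DuhOf ψ s (fun _ : SpaceTime n => 0) (fun _ => 0) := by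
  refine ⟨Filter.Eventually.of_forall fun ξ => by simp, Filter.Eventually.of_forall fun ξ => ?_⟩
  refine IsFT.zero.congr (Filter.EventuallyEq.of_eq ?_) (Filter.EventuallyEq.refl _ _)
  ext t
  simp [duhProfile, duhamelHat]

theorem DuhOf.sum (hs : 0 < s) {ι : Type*} (S : Finset ι) {v u : ι → SpaceTime n → ℂ}
    (h : ∀ i ∈ S, DuhOf ψ s (v i) (u i)) :
    DuhOf ψ s (fun ζ => ∑ i ∈ S, v i ζ) (fun ζ => ∑ i ∈ S, u i ζ) := by
  classical
  induction S using Finset.induction_on with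
  | empty => simpa using DuhOf.zero
  | insert a S ha ih =>
    simp only [Finset.sum_insert ha]
    exact (h a (Finset.mem_insert_self _ _)).add hs
      (ih fun i hi => h i (Finset.mem_insert_of_mem hi))

theorem DuhOf.congr {v u v' u' : SpaceTime n → ℂ} (h : DuhOf ψ s v u) (hv : v =ᵐ[volume] v')
    (hu : u =ᵐ[volume] u') : DuhOf ψ s v' u' := by
  refine ⟨?_, ?_⟩
  · filter_upwards [h.integrable, ae_fiber_toLp hv] with ξ h1 h2 using h1.congr h2
  · filter_upwards [h.isFT, ae_fiber_toLp hv, ae_fiber_toLp hu] with ξ h1 h2 h3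
    exact h1.congr (Filter.EventuallyEq.of_eq (duhProfile_congr h2)) h3

theorem ae_eq_zero_of_fiber {u : SpaceTime n → ℂ} {K : Space n → ℝ → ℂ}
    (h : ∀ᵐ ξ, IsFT (K ξ) (fun τ => u (pt ξ τ))) {S : Set (Space n)} (hS : MeasurableSet S)
    (hK : ∀ᵐ ξ, ξ ∉ S → K ξ =ᵐ[volume] 0) (hu : AEStronglyMeasurable u) :
    ∀ᵐ ζ, ζ.fst ∉ S → u ζ = 0 := by
  have hm : Measurable fun ζ : SpaceTime n => ζ.fst :=
    (by fun_prop : Continuous fun ζ : SpaceTime n => ζ.fst).measurable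
  set S' : Set (SpaceTime n) := {ζ | ζ.fst ∈ S}ᶜ with hS'
  have hSm : MeasurableSet S' := (hm hS).compl
  have h1 : S'.indicator u =ᵐ[volume] fun _ => 0 := by
    refine ae_eq_toLp (hu.indicator hSm) aestronglyMeasurable_const ?_
    filter_upwards [h, hK] with ξ h1 h2
    by_cases hξ : ξ ∈ S
    · refine Filter.EventuallyEq.of_eq ?_
      ext τ
      exact Set.indicator_of_notMem (by simp [hS', hξ]) _
    · have h3 := h1.unique IsFT.zero (h2 hξ)
      filter_upwards [h3] with τ hτ
      rw [Set.indicator_of_mem (by simp [hS', hξ])]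
      exact hτ
  filter_upwards [h1] with ζ h1 h2
  rwa [Set.indicator_of_mem (by simpa [hS'] using h2)] at h1

/-- The Duhamel term is local in the spatial frequency. -/
theorem DuhOf.support {v u : SpaceTime n → ℂ} (h : DuhOf ψ s v u) {S : Set (Space n)}
    (hS : MeasurableSet S) (hv : ∀ᵐ ζ, ζ.fst ∉ S → v ζ = 0) (hu : AEStronglyMeasurable u) :
    ∀ᵐ ζ, ζ.fst ∉ S → u ζ = 0 := by
  refine ae_eq_zero_of_fiber h.isFT hS ?_ hu
  filter_upwards [ae_fiber_toLp hv] with ξ h1 h2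
  refine Filter.EventuallyEq.of_eq ?_
  have h3 : (fun τ : ℝ => v (pt ξ τ)) =ᵐ[volume] fun τ => (fun _ : SpaceTime n => (0 : ℂ)) (pt ξ τ) := by
    filter_upwards [h1] with τ hτ using hτ h2
  rw [duhProfile_congr (v' := fun _ => 0) h3]
  ext t
  simp [duhProfile, duhamelHat]

/-- The free part of the Duhamel term. -/
theorem exists_freePart_lift (hs : 0 < s) (hψ : IsTimeCutoff ψ) :
    ∃ C : ℝ≥0, ∀ (n : ℕ) (v : SpaceTime n → ℂ), MemLp v 2 →
      (∀ᵐ ξ : Space n, Integrable fun τ : ℝ => v (pt ξ τ)) →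
      ∃ u : SpaceTime n → ℂ, AEStronglyMeasurable u ∧
        (∀ᵐ ξ, IsFT (fun t : ℝ => ψ t *
          (Complex.exp (-(Complex.I * t * disp s ξ)) * freePart s v ξ t))
          (fun τ => u (pt ξ τ))) ∧
        sqNorm volume (fun ζ => symb s ζ * u ζ) ≤
          C * ((∫⁻ ξ : Space n, ‖∫ τ : ℝ, v (pt ξ τ)‖ₑ ^ 2) + sqNorm volume v) := by
  obtain ⟨C, hC⟩ := exists_free_lift hs hψ
  refine ⟨C, fun n v hv hvi => ?_⟩
  have hd := continuous_disp (n := n) hs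
  have hψc : Continuous ψ := hψ.smooth.continuous
  have hH : AEStronglyMeasurable (fun z : Space n × ℝ => invFT (fun τ => v (pt z.1 τ)) z.2)
      (volume.prod volume) := by
    have := aestronglyMeasurable_integral_kernel hv.1
      (K := fun w => Complex.exp (Complex.I * w.1.2 * (2 * Real.pi * w.2))) (by fun_prop)
    simpa only [invFT, mul_comm] using this
  have hD : AEStronglyMeasurable (fun z : Space n × ℝ => duhProfile ψ s v z.1 z.2)
      (volume.prod volume) := by
    have hK : Continuous fun w : (Space n × ℝ) × ℝ =>
        symb s (pt w.1.1 w.2) * duhamelKernel s w.1.2 (pt w.1.1 w.2) := by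
      have h1 : Continuous fun w : (Space n × ℝ) × ℝ => ((w.1.2, pt w.1.1 w.2) : ℝ × SpaceTime n) := by
        fun_prop
      have h2 := Continuous.comp (g := fun z : ℝ × SpaceTime n => duhamelKernel s z.1 z.2)
        (f := fun w : (Space n × ℝ) × ℝ => ((w.1.2, pt w.1.1 w.2) : ℝ × SpaceTime n))
        (continuous_duhamelKernel hs) h1
      exact ((continuous_symb hs).comp (by fun_prop)).mul h2
    have h1 := aestronglyMeasurable_integral_kernel hv.1 hK
    have h2 : AEStronglyMeasurable (fun z : Space n × ℝ => Complex.I * ψ z.2)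
        (volume.prod volume) := Continuous.aestronglyMeasurable (by fun_prop)
    refine (h2.mul h1).congr (Filter.Eventually.of_forall fun z => ?_)
    simp only [duhProfile, duhamelHat, Pi.mul_apply]
    congr 1
    refine integral_congr_ae (Filter.Eventually.of_forall fun τ => ?_)
    simp only
    ring
  have hA : ∀ᵐ ξ : Space n, (∀ t : ℝ, HasDerivAt (freePart s v ξ)
      (-(Complex.exp (Complex.I * t * disp s ξ) * invFT (fun τ => v (pt ξ τ)) t)) t) ∧
      Continuous fun t : ℝ =>
        -(Complex.exp (Complex.I * t * disp s ξ) * invFT (fun τ => v (pt ξ τ)) t) := by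
    filter_upwards [hvi] with ξ hξ
    have := continuous_invFT hξ
    exact ⟨fun t => hasDerivAt_freePart hξ t, by fun_prop⟩
  have hB : AEStronglyMeasurable (fun z : Space n × ℝ =>
      ψ z.2 * (Complex.exp (-(Complex.I * z.2 * disp s z.1)) * freePart s v z.1 z.2))
      (volume.prod volume) := by
    -- Joint measurability of the free part is obtained by solving `duhProfile_eq` for it: the other
    -- terms are parametric integrals.
    have h1 : AEStronglyMeasurable (fun z : Space n × ℝ => duhProfile ψ s v z.1 z.2 +
        ψ z.2 * invFT (fun τ => v (pt z.1 τ)) z.2) (volume.prod volume) :=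
      hD.add ((Continuous.aestronglyMeasurable (by fun_prop)).mul hH)
    refine h1.congr ?_
    have h2 := (Measure.quasiMeasurePreserving_fst (μ := (volume : Measure (Space n)))
      (ν := (volume : Measure ℝ))).ae hvi
    filter_upwards [h2] with z hz
    rw [duhProfile_eq hs ψ hz]
    ring
  obtain ⟨u, hu1, hu2, hu3⟩ := hC n (freePart s v)
    (fun ξ t => -(Complex.exp (Complex.I * t * disp s ξ) * invFT (fun τ => v (pt ξ τ)) t)) hA hB
  refine ⟨u, hu1, hu2, hu3.trans ?_⟩
  gcongr
  rw [sqNorm_fiber hv.1, ← lintegral_add_right' _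
    (aemeasurable_sqNorm_fiber (aestronglyMeasurable_toLp hv.1))]
  refine lintegral_mono_ae ?_
  -- The value of `freePart` at time 0 is the integral of `v` over `τ`, and its derivative has the
  -- modulus of `invFT v`, whose L² norm is that of `v` by Plancherel.
  filter_upwards [hvi, memLp_fiber_toLp hv] with ξ h1 h2
  refine add_le_add (le_of_eq ?_) (le_of_eq ?_)
  · simp [freePart, invFT_zero_eq]
  · rw [← (isFT_invFT h1 h2).sqNorm_eq]
    unfold sqNorm
    refine lintegral_congr fun t => ?_
    rw [enorm_neg, enorm_mul, ← ofReal_norm (Complex.exp _), norm_exp_I_mul']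
    simp

end Lift

/-! ### Time cut-offs at bounded modulation, and sums over modulation shells. -/

section XSpace

variable {n : ℕ} {s : ℝ} {φ₀ ψ : ℝ → ℝ}

theorem eLpNorm_le_of_sqNorm_le {X Y : Type*} [MeasurableSpace X] [MeasurableSpace Y]
    {μ : Measure X} {ν : Measure Y} {f : X → ℂ} {g : Y → ℂ} {c : ℝ≥0∞}
    (h : sqNorm μ f ≤ c ^ 2 * sqNorm ν g) : eLpNorm f 2 μ ≤ c * eLpNorm g 2 ν := by
  refine le_of_sq_le ?_
  rw [mul_pow, ← sqNorm_eq, ← sqNorm_eq]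
  exact h

/-- `u` is the space-time Fourier transform of `χ(t) f(x, t)` if `v` is that of `f`. -/
def IsCutoffOf (χ : ℝ → ℝ) (v u : SpaceTime n → ℂ) : Prop :=
  ∀ᵐ ξ : Space n, ∀ h : ℝ → ℂ, IsFT h (fun τ => v (pt ξ τ)) →
    IsFT (fun t => χ t * h t) (fun τ => u (pt ξ τ))

theorem isCutoffOf_of_isFT {χ : ℝ → ℝ} (hχ : Continuous χ) {f v u : SpaceTime n → ℂ}
    (hf : IsFT f v) (hu : IsFT (fun ζ => χ ζ.snd * f ζ) u) : IsCutoffOf χ v u := by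
  obtain ⟨H, hH⟩ := hf.exists_profile
  have h1 := hH.mul_right (m := fun t => (χ t : ℂ)) (by fun_prop) hu
    (Filter.Eventually.of_forall fun ζ => rfl)
  filter_upwards [h1, hH.right] with ξ h2 h3 h h4
  refine h2.congr ?_ (Filter.EventuallyEq.refl _ _)
  filter_upwards [h3.unique_left h4 (Filter.EventuallyEq.refl _ _)] with t ht
  rw [ht]

theorem memLp_cutoff {χ : ℝ → ℝ} (hχ : Continuous χ) {M : ℝ} (hM : ∀ t, ‖χ t‖ ≤ M)
    {f : SpaceTime n → ℂ} (hf : MemLp f 2) : MemLp (fun ζ => χ ζ.snd * f ζ) 2 := by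
  refine memLp_mul_of_bound (m := fun ζ => (χ ζ.snd : ℂ))
    (Continuous.aestronglyMeasurable (by fun_prop)) (C := M) (fun ζ => ?_) hf
  rw [Complex.norm_real]
  exact hM _

theorem IsCutoffOf.sqNorm_le {χ : ℝ → ℝ} {M : ℝ≥0} (hM : ∀ t, ‖χ t‖ ≤ M) {v u : SpaceTime n → ℂ}
    (h : IsCutoffOf χ v u) (hv : MemLp v 2) (hu : AEStronglyMeasurable u) :
    sqNorm volume u ≤ (M : ℝ≥0∞) ^ 2 * sqNorm volume v := by
  rw [sqNorm_fiber hu, sqNorm_fiber hv.1, ← lintegral_const_mul' _ _ (by finiteness)]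
  refine lintegral_mono_ae ?_
  filter_upwards [h, memLp_fiber_toLp hv] with ξ h1 h2
  obtain ⟨q, hq⟩ := exists_isFT_left h2
  rw [← (h1 q hq).sqNorm_eq, ← hq.sqNorm_eq]
  unfold sqNorm
  rw [← lintegral_const_mul' _ _ (by finiteness)]
  refine lintegral_mono fun t => ?_
  rw [enorm_mul, mul_pow]
  gcongr
  rw [← ofReal_norm, Complex.norm_real]
  refine (ENNReal.ofReal_le_ofReal (hM t)).trans (le_of_eq ?_)
  simp

/-- Square integrable functions with bounded support are integrable. -/
theorem integrable_of_ae_eq_zero {q : ℝ → ℂ} (hq : MemLp q 2) {a b : ℝ}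
    (h : ∀ᵐ τ, τ ∉ Set.Icc a b → q τ = 0) : Integrable q := by
  have h1 : IntegrableOn q (Set.Icc a b) := by
    have : IsFiniteMeasure ((volume : Measure ℝ).restrict (Set.Icc a b)) := ⟨by simp⟩
    exact (hq.restrict (Set.Icc a b)).integrable (by norm_num)
  refine ((integrable_indicator_iff measurableSet_Icc).2 h1).congr ?_
  filter_upwards [h] with τ hτ
  by_cases h2 : τ ∈ Set.Icc a b
  · rw [Set.indicator_of_mem h2]
  · rw [Set.indicator_of_notMem h2, hτ h2]

theorem lintegral_sq_le_of_ae_eq_zero {q : ℝ → ℂ} (hq : AEStronglyMeasurable q) {a b : ℝ}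
    (h : ∀ᵐ τ, τ ∉ Set.Icc a b → q τ = 0) :
    (∫⁻ τ, ‖q τ‖ₑ) ^ 2 ≤ ENNReal.ofReal (b - a) * sqNorm volume q := by
  have h1 : ∫⁻ τ, ‖q τ‖ₑ = ∫⁻ τ in Set.Icc a b, ‖q τ‖ₑ := by
    rw [← lintegral_indicator measurableSet_Icc]
    refine lintegral_congr_ae ?_
    filter_upwards [h] with τ hτ
    by_cases h2 : τ ∈ Set.Icc a b
    · rw [Set.indicator_of_mem h2]
    · rw [Set.indicator_of_notMem h2, hτ h2]; simp
  have h5 := ENNReal.lintegral_mul_le_Lp_mul_Lq (volume.restrict (Set.Icc a b))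
    Real.HolderConjugate.two_two (f := fun _ => 1) (g := fun r => ‖q r‖ₑ)
    (by fun_prop) hq.restrict.enorm
  have h6 := pow_le_pow_left' h5 2
  simp only [Pi.mul_apply, one_mul, ENNReal.one_rpow, lintegral_const,
    Measure.restrict_apply_univ, Real.volume_Icc] at h6
  rw [mul_pow, ← ENNReal.rpow_natCast, ← ENNReal.rpow_natCast, ← ENNReal.rpow_natCast,
    ← ENNReal.rpow_mul, ← ENNReal.rpow_mul] at h6
  norm_num at h6
  rw [h1]
  refine h6.trans ?_
  gcongr
  exact lintegral_mono' Measure.restrict_le_self le_rfl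

theorem mem_Icc_of_abs_le {w L τ : ℝ} (h : |2 * Real.pi * τ + w| ≤ L) :
    τ ∈ Set.Icc ((-L - w) / (2 * Real.pi)) ((L - w) / (2 * Real.pi)) := by
  rw [abs_le] at h
  have hp := Real.pi_pos
  constructor
  · rw [div_le_iff₀ (by positivity)]; linarith [h.1]
  · rw [le_div_iff₀ (by positivity)]; linarith [h.2]

/-- The time cut-off at bounded modulation, at a fixed spatial frequency. -/
theorem sqNorm_timeSymb_cutoff_le (hψ : IsTimeCutoff ψ) :
    ∃ C : ℝ≥0, ∀ (w L : ℝ) (q h u : ℝ → ℂ), IsFT h q → IsFT (fun t => ψ t * h t) u →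
      0 ≤ L → (∀ᵐ τ : ℝ, L < |2 * Real.pi * τ + w| → q τ = 0) →
      sqNorm volume (fun τ => timeSymb w τ * u τ) ≤
        C * (1 + ENNReal.ofReal L ^ 2) * sqNorm volume q := by
  obtain ⟨C, hC⟩ := sqNorm_timeSymb_le hψ
  refine ⟨C, fun w L q h u hhq hu hL hsupp => ?_⟩
  set qm : ℝ → ℂ := fun τ => ((2 * Real.pi * τ + w : ℝ) : ℂ) * q τ with hqm
  have hqs : ∀ᵐ τ, τ ∉ Set.Icc ((-L - w) / (2 * Real.pi)) ((L - w) / (2 * Real.pi)) → q τ = 0 := by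
    filter_upwards [hsupp] with τ hτ h1
    refine hτ ?_
    by_contra! hc
    exact h1 (mem_Icc_of_abs_le hc)
  have hqb : ∀ᵐ τ : ℝ, ‖qm τ‖ ≤ L * ‖q τ‖ := by
    filter_upwards [hsupp] with τ hτ
    rw [hqm]
    simp only [norm_mul, Complex.norm_real, Real.norm_eq_abs]
    by_cases h1 : |2 * Real.pi * τ + w| ≤ L
    · gcongr
    · rw [hτ (not_le.1 h1)]; simp
  have hq2 := hhq.right
  have hqi := integrable_of_ae_eq_zero hq2 hqs
  have hqmm : MemLp qm 2 := MemLp.of_le_mul (c := L) hq2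
    ((Continuous.aestronglyMeasurable (by fun_prop)).mul hq2.1) hqb
  have hqmi : Integrable qm := by
    refine integrable_of_ae_eq_zero hqmm (a := (-L - w) / (2 * Real.pi))
      (b := (L - w) / (2 * Real.pi)) ?_
    filter_upwards [hqs] with τ h1 h2
    rw [hqm]; simp [h1 h2]
  have hqi' : Integrable fun τ : ℝ => τ * q τ := by
    have h1 : Integrable fun τ : ℝ => ((2 * Real.pi : ℝ) : ℂ)⁻¹ * (qm τ - w * q τ) :=
      (hqmi.sub (hqi.const_mul _)).const_mul _
    refine h1.congr (Filter.Eventually.of_forall fun τ => ?_)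
    have : ((2 * Real.pi : ℝ) : ℂ) ≠ 0 := by
      exact_mod_cast (by positivity : (2 * Real.pi : ℝ) ≠ 0)
    simp only [hqm]
    rw [inv_mul_eq_iff_eq_mul₀ this]
    push_cast; ring
  -- Conjugation by the free flow turns the modulation into the time frequency, so the derivative of
  -- `R` costs at most a factor `L` in L².
  set R : ℝ → ℂ := fun t => Complex.exp (Complex.I * t * w) * invFT q t
  set R' : ℝ → ℂ := fun t => Complex.exp (Complex.I * t * w) * (Complex.I * invFT qm t)
  have hR : ∀ t, HasDerivAt R (R' t) t := hasDerivAt_exp_mul_invFT hqi hqi' w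
  have hR' : Continuous R' := by
    have := continuous_invFT hqmi
    fun_prop
  have h1 := hC w R R' hR hR'
  have h2 := (isFT_timeSymb hψ.smooth hψ.hasCompactSupport w hR hR').1
  have e1 : (fun t : ℝ => ψ t * (Complex.exp (-(Complex.I * t * w)) * R t)) =
      fun t => ψ t * invFT q t := by
    ext t
    simp only [R]
    rw [← mul_assoc (Complex.exp _), ← Complex.exp_add]
    simp
  have h3 : u =ᵐ[volume] 𝓕 (fun t : ℝ => ψ t * (Complex.exp (-(Complex.I * t * w)) * R t)) := by
    refine hu.unique h2 ?_
    rw [e1]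
    filter_upwards [hhq.unique_left (isFT_invFT hqi hq2) (Filter.EventuallyEq.refl _ _)] with t ht
    rw [ht]
  have hRn : ∀ t, ‖R t‖ₑ = ‖invFT q t‖ₑ := fun t => by
    simp only [R]
    rw [enorm_mul, ← ofReal_norm (Complex.exp _), norm_exp_I_mul']; simp
  have hRn' : ∀ t, ‖R' t‖ₑ = ‖invFT qm t‖ₑ := fun t => by
    simp only [R']
    rw [enorm_mul, enorm_mul, ← ofReal_norm (Complex.exp _), norm_exp_I_mul',
      ← ofReal_norm Complex.I]; simp
  calc sqNorm volume (fun τ => timeSymb w τ * u τ) = _ :=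
        sqNorm_congr (h3.mono fun τ hτ => by simp only [hτ])
    _ ≤ _ := h1
    _ ≤ C * sqNorm volume q + C * sqNorm volume qm := by
        rw [← (isFT_invFT hqi hq2).sqNorm_eq, ← (isFT_invFT hqmi hqmm).sqNorm_eq]
        simp only [hRn, hRn']
        gcongr
        · exact lintegral_mono' Measure.restrict_le_self le_rfl
        · exact lintegral_mono' Measure.restrict_le_self le_rfl
    _ ≤ C * sqNorm volume q + C * (ENNReal.ofReal L ^ 2 * sqNorm volume q) := by
        gcongr
        unfold sqNorm
        rw [← lintegral_const_mul' _ _ (by finiteness)]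
        refine lintegral_mono_ae (hqb.mono fun τ hτ => ?_)
        rw [← mul_pow]
        gcongr
        rw [← ofReal_norm, ← ofReal_norm (q τ), ← ENNReal.ofReal_mul hL]
        exact ENNReal.ofReal_le_ofReal hτ
    _ = _ := by ring

/-- The time cut-off at bounded modulation. -/
theorem xSum_cutoff_le (hφ₀ : IsBump φ₀) (hs : 0 < s) (hψ : IsTimeCutoff ψ) :
    ∃ C : ℝ≥0, ∀ (n : ℕ) (v u : SpaceTime n → ℂ) (m : ℕ), MemLp v 2 → AEStronglyMeasurable u →
      IsCutoffOf ψ v u → (∀ᵐ ζ, 2 ^ (m + 1) < |modulation s ζ| → v ζ = 0) →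
      xSum φ₀ s u ≤ C * (2 ^ ((m : ℝ) / 2) * eLpNorm v 2 volume) := by
  obtain ⟨C, hC⟩ := sqNorm_timeSymb_cutoff_le hψ
  -- Here `L` = 2^{m+1}, so 1 + L² ≤ 5 · 4^m, and 5C ≤ (5C + 1)² makes the bound a perfect square.
  -- Then `xSum_le` at splitting index `m` contributes 1 from the L² norm and 2(5C + 1) from the
  -- modulation.
  refine ⟨decaySum.toNNReal * (1 + 2 * (5 * C + 1)), fun n v u m hv hu hcut hsupp => ?_⟩
  have h1 : sqNorm volume (fun ζ => symb s ζ * u ζ) ≤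
      ((5 * (C : ℝ≥0∞) + 1) * 2 ^ m) ^ 2 * sqNorm volume v := by
    rw [sqNorm_fiber (v := fun ζ => symb s ζ * u ζ)
      ((continuous_symb hs).aestronglyMeasurable.mul hu), sqNorm_fiber hv.1,
      ← lintegral_const_mul' _ _ (by finiteness)]
    refine lintegral_mono_ae ?_
    filter_upwards [hcut, memLp_fiber_toLp hv, ae_fiber_toLp hsupp] with ξ h2 h3 h4
    obtain ⟨h, hh⟩ := exists_isFT_left h3
    have h5 := hC (disp s ξ) (2 ^ (m + 1)) _ h _ hh (h2 h hh) (by positivity) (by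
      filter_upwards [h4] with τ h6 h7
      exact h6 (by simpa [modulation] using h7))
    simp only [symb_pt]
    refine h5.trans ?_
    gcongr
    rw [ENNReal.ofReal_pow (by norm_num)]
    norm_num
    have e1 : (1 : ℝ≥0∞) ≤ (2 ^ m) ^ 2 := one_le_pow₀ (one_le_pow₀ (by norm_num))
    have e2 : ((2 : ℝ≥0∞) ^ (m + 1)) ^ 2 = 4 * (2 ^ m) ^ 2 := by ring
    generalize (C : ℝ≥0∞) = c
    calc c * (1 + (2 ^ (m + 1)) ^ 2) ≤ c * ((2 ^ m) ^ 2 + 4 * (2 ^ m) ^ 2) := by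
          rw [e2]; gcongr
      _ = (5 * c) * (2 ^ m) ^ 2 := by ring
      _ ≤ (5 * c + 1) ^ 2 * (2 ^ m) ^ 2 := by
          gcongr
          calc 5 * c ≤ 5 * c + 1 := le_self_add
            _ ≤ (5 * c + 1) ^ 2 := le_self_pow₀ le_add_self (by norm_num)
      _ = _ := by ring
  have h2 : eLpNorm (fun ζ => (modulation s ζ : ℂ) * u ζ) 2 volume ≤
      ((5 * (C : ℝ≥0∞) + 1) * 2 ^ m) * eLpNorm v 2 volume := by
    refine le_trans (eLpNorm_mono fun ζ => ?_) (eLpNorm_le_of_sqNorm_le h1)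
    rw [norm_mul, norm_mul, Complex.norm_real]
    gcongr
    exact modulation_le_norm_symb ζ
  have h3 : eLpNorm u 2 volume ≤ eLpNorm v 2 volume := by
    have := eLpNorm_le_of_sqNorm_le (hcut.sqNorm_le (M := 1) (fun t => by
      have := hψ.range t
      rw [Real.norm_of_nonneg this.1]
      exact this.2) hv hu)
    simpa using this
  have e3 : (2 : ℝ≥0∞) ^ (-((m : ℝ) / 2)) * 2 ^ m = 2 ^ ((m : ℝ) / 2) := by
    rw [← ENNReal.rpow_natCast, ← ENNReal.rpow_add _ _ (by norm_num) (by norm_num)]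
    congr 1; ring
  refine (xSum_le hφ₀ u m).trans ?_
  push_cast
  rw [ENNReal.coe_toNNReal decaySum_lt_top.ne]
  calc _ ≤ decaySum * ((2 : ℝ≥0∞) ^ ((m : ℝ) / 2) * eLpNorm v 2 volume +
      2 * (2 : ℝ≥0∞) ^ (-((m : ℝ) / 2)) * (((5 * (C : ℝ≥0∞) + 1) * 2 ^ m) * eLpNorm v 2 volume)) := by
        gcongr
    _ = decaySum * ((2 : ℝ≥0∞) ^ ((m : ℝ) / 2) * eLpNorm v 2 volume +
      2 * (5 * (C : ℝ≥0∞) + 1) * ((2 : ℝ≥0∞) ^ (-((m : ℝ) / 2)) * 2 ^ m) * eLpNorm v 2 volume) := by ring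
    _ = _ := by rw [e3]; ring

/-- Countable subadditivity of `xSum`. -/
theorem xSum_le_tsum (hφ₀ : IsBump φ₀) (hs : 0 < s) {u : SpaceTime n → ℂ}
    {w : ℕ → SpaceTime n → ℂ} (hu : AEStronglyMeasurable u) (hw : ∀ j, AEStronglyMeasurable (w j))
    (hlim : Filter.Tendsto (fun N => eLpNorm (fun ζ => u ζ - ∑ j ∈ Finset.range (N + 1), w j ζ) 2 volume)
      Filter.atTop (nhds 0)) : xSum φ₀ s u ≤ ∑' j, xSum φ₀ s (w j) := by
  unfold xSum
  rw [ENNReal.tsum_comm]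
  refine ENNReal.tsum_le_tsum fun l => ?_
  rw [ENNReal.tsum_mul_left]
  gcongr
  set c : SpaceTime n → ℂ := fun ζ => (dyadic φ₀ l (modulation s ζ) : ℂ) with hc
  have hcm : AEStronglyMeasurable c := (hφ₀.continuous_dyadic_modulation hs l).aestronglyMeasurable
  -- Only finite sums are estimated by the triangle inequality; the L² remainder disappears as N
  -- grows, because each cut-off is bounded by 1.
  have key : ∀ N : ℕ, eLpNorm (fun ζ => c ζ * u ζ) 2 volume ≤
      eLpNorm (fun ζ => u ζ - ∑ j ∈ Finset.range (N + 1), w j ζ) 2 volume +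
        ∑' j, eLpNorm (fun ζ => c ζ * w j ζ) 2 volume := by
    intro N
    have hsum : AEStronglyMeasurable (fun ζ => ∑ j ∈ Finset.range (N + 1), w j ζ) := by
      have := Finset.aestronglyMeasurable_sum (Finset.range (N + 1)) fun j _ => hw j
      refine this.congr (Filter.Eventually.of_forall fun ζ => by simp)
    have h1 : (fun ζ => c ζ * u ζ) = (fun ζ => c ζ * (u ζ - ∑ j ∈ Finset.range (N + 1), w j ζ)) +
        ∑ j ∈ Finset.range (N + 1), fun ζ => c ζ * w j ζ := by
      ext ζ
      simp only [Pi.add_apply, Finset.sum_apply, ← Finset.mul_sum]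
      ring
    rw [h1]
    refine (eLpNorm_add_le (hcm.mul (hu.sub hsum)) (Finset.aestronglyMeasurable_sum _
      fun j _ => hcm.mul (hw j)) (by norm_num)).trans (add_le_add ?_ ?_)
    · refine eLpNorm_mono fun ζ => ?_
      rw [Pi.mul_apply, norm_mul]
      exact mul_le_of_le_one_left (norm_nonneg _) (hφ₀.norm_dyadic_le _ _)
    · exact (eLpNorm_sum_le (fun j _ => hcm.mul (hw j)) (by norm_num)).trans
        (ENNReal.sum_le_tsum _)
  have h2 := hlim.add_const (∑' j, eLpNorm (fun ζ => c ζ * w j ζ) 2 volume)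
  rw [zero_add] at h2
  exact ge_of_tendsto' h2 key

/-- Dominated convergence: the partial sums are φ₀(· / 2^N), which lie in [0, 1] and are eventually
1 at each point. -/
theorem tendsto_eLpNorm_sub_sum_dyadic (hφ₀ : IsBump φ₀) (hs : 0 < s) {v : SpaceTime n → ℂ}
    (hv : MemLp v 2) :
    Filter.Tendsto (fun N => eLpNorm (fun ζ => v ζ - ∑ j ∈ Finset.range (N + 1),
      (dyadic φ₀ j (modulation s ζ) : ℂ) * v ζ) 2 volume) Filter.atTop (nhds 0) := by
  have hm : ∀ N : ℕ, AEStronglyMeasurable (fun ζ => v ζ - ∑ j ∈ Finset.range (N + 1),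
      (dyadic φ₀ j (modulation s ζ) : ℂ) * v ζ) := by
    intro N
    refine hv.1.sub ?_
    have := Finset.aestronglyMeasurable_sum (Finset.range (N + 1)) (μ := volume) fun j _ =>
      (hφ₀.continuous_dyadic_modulation (n := n) hs j).aestronglyMeasurable.mul hv.1
    refine this.congr (Filter.Eventually.of_forall fun ζ => by simp)
  have h1 : Filter.Tendsto (fun N : ℕ => sqNorm volume (fun ζ => v ζ - ∑ j ∈ Finset.range (N + 1),
      (dyadic φ₀ j (modulation s ζ) : ℂ) * v ζ)) Filter.atTop (nhds 0) := by
    have h2 := tendsto_lintegral_of_dominated_convergence' (μ := (volume : Measure (SpaceTime n)))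
      (F := fun N ζ => ‖v ζ - ∑ j ∈ Finset.range (N + 1),
        (dyadic φ₀ j (modulation s ζ) : ℂ) * v ζ‖ₑ ^ 2) (f := fun _ => 0) (fun ζ => ‖v ζ‖ₑ ^ 2)
      (fun N => (hm N).enorm.pow_const 2) ?_ (memLp_two_iff.1 hv).2.ne ?_
    · simpa [sqNorm] using h2
    · intro N
      refine Filter.Eventually.of_forall fun ζ => ?_
      simp only
      gcongr
      rw [enorm_le_iff_norm_le, ← Finset.sum_mul, ← Complex.ofReal_sum, sum_dyadic, ← one_sub_mul,
        norm_mul, ← Complex.ofReal_one, ← Complex.ofReal_sub, Complex.norm_real, Real.norm_eq_abs]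
      refine mul_le_of_le_one_left (norm_nonneg _) ?_
      have := hφ₀.range (modulation s ζ / 2 ^ N)
      rw [abs_le]; constructor <;> linarith [this.1, this.2]
    · refine Filter.Eventually.of_forall fun ζ => ?_
      obtain ⟨N₀, hN⟩ := hφ₀.exists_sum_dyadic (modulation s ζ)
      refine tendsto_const_nhds.congr' ?_
      filter_upwards [Filter.eventually_ge_atTop N₀] with N h3
      rw [← Finset.sum_mul, ← Complex.ofReal_sum, hN N h3]
      simp
  have := ((ENNReal.continuous_rpow_const (y := (1 / 2 : ℝ))).tendsto 0).comp h1
  rw [ENNReal.zero_rpow_of_pos (by norm_num)] at this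
  refine this.congr fun N => ?_
  simp only [Function.comp_apply, eLpNorm_two_eq]

end XSpace

/-! ### The time cut-off, the time trace and the Duhamel term on `Xₖ`. -/

section XDuhamel

variable {n : ℕ} {s : ℝ} {φ₀ ψ : ℝ → ℝ}

theorem exists_cutoff {χ : ℝ → ℝ} (hχ : Continuous χ) {M : ℝ} (hM : ∀ t, ‖χ t‖ ≤ M)
    {v : SpaceTime n → ℂ} (hv : MemLp v 2) :
    ∃ f u : SpaceTime n → ℂ, IsFT f v ∧ IsFT (fun ζ => χ ζ.snd * f ζ) u ∧ IsCutoffOf χ v u := by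
  obtain ⟨f, hf⟩ := exists_isFT_left hv
  obtain ⟨u, hu⟩ := exists_isFT (memLp_cutoff hχ hM hf.left)
  exact ⟨f, u, hf, hu, isCutoffOf_of_isFT hχ hf hu⟩

theorem IsFT.finset_sum {V : Type*} [NormedAddCommGroup V] [InnerProductSpace ℝ V]
    [FiniteDimensional ℝ V] [MeasurableSpace V] [BorelSpace V] {ι : Type*} (S : Finset ι)
    {f g : ι → V → ℂ} (h : ∀ i ∈ S, IsFT (f i) (g i)) :
    IsFT (fun x => ∑ i ∈ S, f i x) (fun x => ∑ i ∈ S, g i x) := by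
  classical
  induction S using Finset.induction_on with
  | empty => simpa using IsFT.zero
  | insert a S ha ih =>
    simp only [Finset.sum_insert ha]
    exact (h a (Finset.mem_insert_self _ _)).add
      (ih fun i hi => h i (Finset.mem_insert_of_mem hi))

/-- The time cut-off is bounded on the `X` spaces. -/
theorem xSum_cutoff_le_xSum (hφ₀ : IsBump φ₀) (hs : 0 < s) (hψ : IsTimeCutoff ψ) :
    ∃ C : ℝ≥0, ∀ (n : ℕ) (f v u : SpaceTime n → ℂ), IsFT f v →
      IsFT (fun ζ => ψ ζ.snd * f ζ) u → xSum φ₀ s u ≤ C * xSum φ₀ s v := by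
  obtain ⟨C, hC⟩ := xSum_cutoff_le hφ₀ hs hψ
  have hψ1 : ∀ t, ‖ψ t‖ ≤ 1 := fun t => by
    have := hψ.range t
    rw [Real.norm_of_nonneg this.1]
    exact this.2
  refine ⟨C, fun n f v u hf hu => ?_⟩
  set vj : ℕ → SpaceTime n → ℂ := fun j ζ => (dyadic φ₀ j (modulation s ζ) : ℂ) * v ζ with hvj
  have hvjm : ∀ j, MemLp (vj j) 2 := fun j => memLp_mul_of_bound
    (hφ₀.continuous_dyadic_modulation hs j).aestronglyMeasurable
    (fun ζ => hφ₀.norm_dyadic_le j _) hf.right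
  choose fj uj h1 h2 h3 using fun j => exists_cutoff hψ.smooth.continuous hψ1 (hvjm j)
  -- Multiplication by ψ does not increase L² norms, so the cut-off pieces sum to the cut-off
  -- function because the pieces of `v` sum to `v`.
  have hlim : Filter.Tendsto (fun N => eLpNorm
      (fun ζ => u ζ - ∑ j ∈ Finset.range (N + 1), uj j ζ) 2 volume) Filter.atTop (nhds 0) := by
    refine tendsto_of_tendsto_of_tendsto_of_le_of_le tendsto_const_nhds
      (tendsto_eLpNorm_sub_sum_dyadic hφ₀ hs hf.right) (fun N => bot_le) fun N => ?_
    simp only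
    rw [← (hu.sub (IsFT.finset_sum (Finset.range (N + 1)) fun j _ => h2 j)).eLpNorm_eq,
      ← (hf.sub (IsFT.finset_sum (Finset.range (N + 1)) fun j _ => h1 j)).eLpNorm_eq]
    refine eLpNorm_mono fun ζ => ?_
    rw [← Finset.mul_sum, ← mul_sub, norm_mul, Complex.norm_real]
    exact mul_le_of_le_one_left (norm_nonneg _) (hψ1 _)
  refine (xSum_le_tsum hφ₀ hs hu.right.1 (fun j => (h2 j).right.1) hlim).trans ?_
  rw [xSum, ← ENNReal.tsum_mul_left]
  refine ENNReal.tsum_le_tsum fun j => ?_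
  refine hC n (vj j) (uj j) j (hvjm j) (h2 j).right.1 (h3 j) ?_
  refine Filter.Eventually.of_forall fun ζ hζ => ?_
  by_cases h0 : dyadic φ₀ j (modulation s ζ) = 0
  · simp [hvj, h0]
  · have := (le_of_mem_dyadicInterval (hφ₀.mem_dyadicInterval h0)).2
    linarith

theorem lintegral_tsum_sq_le {X : Type*} [MeasurableSpace X] {μ : Measure X} [SFinite μ]
    {a : ℕ → X → ℝ≥0∞} (ha : ∀ j, AEMeasurable (a j) μ) :
    ∫⁻ x, (∑' j, a j x) ^ 2 ∂μ ≤ (∑' j, (∫⁻ x, a j x ^ 2 ∂μ) ^ (1 / 2 : ℝ)) ^ 2 := by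
  have h1 : AEMeasurable (fun z : ℕ × X => (ha z.1).mk (a z.1) z.2) (Measure.count.prod μ) :=
    (measurable_from_prod_countable_right fun j => (ha j).measurable_mk).aemeasurable
  have h2 := lintegral_lintegral_sq_le h1
  simp only [lintegral_count] at h2
  refine le_trans (le_of_eq ?_) (h2.trans (le_of_eq ?_))
  · refine lintegral_congr_ae ?_
    filter_upwards [ae_all_iff.2 fun j => (ha j).ae_eq_mk] with x hx
    simp only [hx]
  · congr 1
    refine tsum_congr fun j => ?_
    congr 1
    refine lintegral_congr_ae ?_
    filter_upwards [(ha j).ae_eq_mk] with x hx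
    rw [hx]

/-- `X` functions are continuous in time with values in `L²`. -/
theorem lintegral_sq_le_xSum (hφ₀ : IsBump φ₀) (hs : 0 < s) {v : SpaceTime n → ℂ}
    (hv : MemLp v 2) :
    ∫⁻ ξ : Space n, (∫⁻ τ : ℝ, ‖v (pt ξ τ)‖ₑ) ^ 2 ≤ xSum φ₀ s v ^ 2 := by
  set vj : ℕ → SpaceTime n → ℂ := fun j ζ => (dyadic φ₀ j (modulation s ζ) : ℂ) * v ζ with hvj
  have hvjm : ∀ j, MemLp (vj j) 2 := fun j => memLp_mul_of_bound
    (hφ₀.continuous_dyadic_modulation hs j).aestronglyMeasurable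
    (fun ζ => hφ₀.norm_dyadic_le j _) hv
  set a : ℕ → Space n → ℝ≥0∞ := fun j ξ => ∫⁻ τ : ℝ, ‖vj j (pt ξ τ)‖ₑ with ha
  have ham : ∀ j, AEMeasurable (a j) := fun j =>
    (aestronglyMeasurable_toLp (hvjm j).1).enorm.lintegral_prod_right'
  have h1 : ∀ᵐ ξ : Space n, ∫⁻ τ : ℝ, ‖v (pt ξ τ)‖ₑ ≤ ∑' j, a j ξ := by
    filter_upwards [ae_all_iff.2 fun j => aestronglyMeasurable_fiber_toLp (hvjm j).1] with ξ h2
    rw [← lintegral_tsum fun j => (h2 j).enorm]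
    exact lintegral_mono fun τ => hφ₀.enorm_le_tsum _ _
  -- On the `j`-th shell the fibre over ξ lives on an interval of length 2^{j+1}/π ≤ 2^j, so
  -- Cauchy–Schwarz costs exactly the weight 2^{j/2} of the X norm.
  have h2 : ∀ j, (∫⁻ ξ, a j ξ ^ 2) ^ (1 / 2 : ℝ) ≤
      2 ^ ((j : ℝ) / 2) * eLpNorm (vj j) 2 volume := by
    intro j
    rw [eLpNorm_two_eq, show ((j : ℝ) / 2) = j * (1 / 2 : ℝ) by ring, ENNReal.rpow_mul,
      ← ENNReal.mul_rpow_of_nonneg _ _ (by norm_num), ENNReal.rpow_natCast,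
      sqNorm_fiber (hvjm j).1, ← lintegral_const_mul' _ _ (by finiteness)]
    refine ENNReal.rpow_le_rpow (lintegral_mono_ae ?_) (by norm_num)
    filter_upwards [aestronglyMeasurable_fiber_toLp (hvjm j).1] with ξ h3
    refine (lintegral_sq_le_of_ae_eq_zero h3 (a := (-2 ^ (j + 1) - disp s ξ) / (2 * Real.pi))
      (b := (2 ^ (j + 1) - disp s ξ) / (2 * Real.pi)) ?_).trans ?_
    · refine Filter.Eventually.of_forall fun τ hτ => ?_
      by_cases h0 : dyadic φ₀ j (modulation s (pt ξ τ)) = 0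
      · simp [hvj, h0]
      · have h4 := (le_of_mem_dyadicInterval (hφ₀.mem_dyadicInterval h0)).2
        exact absurd (mem_Icc_of_abs_le (by simpa [modulation] using h4)) hτ
    · gcongr
      rw [show (2 : ℝ≥0∞) = ENNReal.ofReal 2 by simp, ← ENNReal.ofReal_pow (by norm_num)]
      refine ENNReal.ofReal_le_ofReal ?_
      rw [← sub_div, div_le_iff₀ (by positivity)]
      have := Real.pi_gt_three
      have h5 : (0 : ℝ) < 2 ^ j := by positivity
      rw [pow_succ]
      nlinarith
  calc _ ≤ ∫⁻ ξ, (∑' j, a j ξ) ^ 2 := lintegral_mono_ae (h1.mono fun ξ h => by gcongr)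
    _ ≤ _ := lintegral_tsum_sq_le ham
    _ ≤ _ := by
      gcongr
      exact ENNReal.tsum_le_tsum h2

theorem integrable_fiber_of_lintegral {v : SpaceTime n → ℂ} (hv : AEStronglyMeasurable v)
    (h : ∫⁻ ξ : Space n, (∫⁻ τ : ℝ, ‖v (pt ξ τ)‖ₑ) ^ 2 ≠ ⊤) :
    ∀ᵐ ξ : Space n, Integrable fun τ : ℝ => v (pt ξ τ) := by
  have hm : AEMeasurable (fun ξ : Space n => (∫⁻ τ : ℝ, ‖v (pt ξ τ)‖ₑ) ^ 2) :=
    (aestronglyMeasurable_toLp hv).enorm.lintegral_prod_right'.pow_const 2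
  filter_upwards [ae_lt_top' hm h, aestronglyMeasurable_fiber_toLp hv] with ξ h1 h2
  refine ⟨h2, ?_⟩
  unfold HasFiniteIntegral
  by_contra hc
  rw [not_lt, top_le_iff] at hc
  simp [hc] at h1

/-- The Duhamel term splits into the time cut-off of the solution and a free part. -/
theorem duhOf_of_cutoff (hs : 0 < s) {v u₁ u₂ : SpaceTime n → ℂ} (hv : MemLp v 2)
    (hvi : ∀ᵐ ξ : Space n, Integrable fun τ : ℝ => v (pt ξ τ)) (h₁ : IsCutoffOf ψ v u₁)
    (h₂ : ∀ᵐ ξ, IsFT (fun t : ℝ => ψ t *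
          (Complex.exp (-(Complex.I * t * disp s ξ)) * freePart s v ξ t))
          (fun τ => u₂ (pt ξ τ))) : DuhOf ψ s v (fun ζ => -u₁ ζ + u₂ ζ) := by
  refine ⟨hvi, ?_⟩
  filter_upwards [hvi, memLp_fiber_toLp hv, h₁, h₂] with ξ h3 h4 h5 h6
  refine ((h5 _ (isFT_invFT h3 h4)).neg.add h6).congr (Filter.EventuallyEq.of_eq ?_)
    (Filter.EventuallyEq.refl _ _)
  ext t
  exact (duhProfile_eq hs ψ h3 t).symm

theorem memLp_of_symb_mul {u : SpaceTime n → ℂ} (hu : AEStronglyMeasurable u)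
    (h : sqNorm volume (fun ζ => symb s ζ * u ζ) < ⊤) : MemLp u 2 := by
  refine memLp_two_iff.2 ⟨hu, lt_of_le_of_lt (sqNorm_mono ?_) h⟩
  refine Filter.Eventually.of_forall fun ζ => ?_
  rw [norm_mul]
  exact le_mul_of_one_le_left (norm_nonneg _) (one_le_norm_symb ζ)

theorem memLp_of_xSum (hφ₀ : IsBump φ₀) (hs : 0 < s) {u : SpaceTime n → ℂ}
    (hu : AEStronglyMeasurable u) (h : xSum φ₀ s u < ⊤) : MemLp u 2 :=
  ⟨hu, (eLpNorm_le_xSum hφ₀ hs hu).trans_lt h⟩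

theorem xSum_neg (u : SpaceTime n → ℂ) : xSum φ₀ s (fun ζ => -u ζ) = xSum φ₀ s u := by
  unfold xSum
  refine tsum_congr fun j => ?_
  rw [← eLpNorm_neg]
  congr 2
  ext ζ
  simp

/-- The Duhamel term of a function of `X` type. -/
theorem exists_duhOf_xSum (hφ₀ : IsBump φ₀) (hs : 0 < s) (hψ : IsTimeCutoff ψ) :
    ∃ C : ℝ≥0, ∀ (n : ℕ) (v : SpaceTime n → ℂ), AEStronglyMeasurable v → xSum φ₀ s v < ⊤ →
      ∃ u : SpaceTime n → ℂ, AEStronglyMeasurable u ∧ DuhOf ψ s v u ∧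
        xSum φ₀ s u ≤ C * xSum φ₀ s v := by
  obtain ⟨C₁, hC₁⟩ := xSum_cutoff_le_xSum hφ₀ hs hψ
  obtain ⟨C₂, hC₂⟩ := exists_freePart_lift hs hψ
  refine ⟨C₁ + 3 * decaySum.toNNReal * (2 * C₂ + 1), fun n v hvm hvx => ?_⟩
  have hv := memLp_of_xSum hφ₀ hs hvm hvx
  have hψ1 : ∀ t, ‖ψ t‖ ≤ 1 := fun t => by
    have := hψ.range t
    rw [Real.norm_of_nonneg this.1]
    exact this.2
  -- This bound serves twice: it makes almost every fibre integrable, so that the Duhamel formula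
  -- applies, and it controls the trace at time 0 in the free part.
  have h0 := lintegral_sq_le_xSum hφ₀ hs hv
  have hvi := integrable_fiber_of_lintegral hvm
    (ne_top_of_le_ne_top (by finiteness) h0)
  obtain ⟨f, u₁, hf, hu₁, hcut⟩ := exists_cutoff hψ.smooth.continuous hψ1 hv
  obtain ⟨u₂, hu₂m, hu₂, hu₂s⟩ := hC₂ n v hv hvi
  have h1 : sqNorm volume (fun ζ => symb s ζ * u₂ ζ) ≤
      (2 * (C₂ : ℝ≥0∞) + 1) ^ 2 * xSum φ₀ s v ^ 2 := by
    refine hu₂s.trans ?_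
    calc _ ≤ (C₂ : ℝ≥0∞) * (xSum φ₀ s v ^ 2 + xSum φ₀ s v ^ 2) := by
          gcongr
          · refine le_trans (lintegral_mono fun ξ => ?_) h0
            gcongr
            exact enorm_integral_le_lintegral_enorm _
          · rw [sqNorm_eq]
            gcongr
            exact eLpNorm_le_xSum hφ₀ hs hvm
      _ = 2 * (C₂ : ℝ≥0∞) * xSum φ₀ s v ^ 2 := by ring
      _ ≤ _ := by
          gcongr
          calc 2 * (C₂ : ℝ≥0∞) ≤ 2 * C₂ + 1 := le_self_add
            _ ≤ _ := le_self_pow₀ le_add_self (by norm_num)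
  have h2 : eLpNorm (fun ζ => symb s ζ * u₂ ζ) 2 volume ≤
      (2 * (C₂ : ℝ≥0∞) + 1) * xSum φ₀ s v := by
    refine le_of_sq_le ?_
    rw [← sqNorm_eq, mul_pow]
    exact h1
  refine ⟨fun ζ => -u₁ ζ + u₂ ζ, hu₁.right.1.neg.add hu₂m, duhOf_of_cutoff hs hv hvi hcut hu₂, ?_⟩
  refine (xSum_add_le hφ₀ hs hu₁.right.1.neg hu₂m).trans ?_
  push_cast
  rw [ENNReal.coe_toNNReal decaySum_lt_top.ne, add_mul]
  refine add_le_add ?_ ?_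
  · refine (le_of_eq (xSum_neg u₁)).trans ?_
    exact hC₁ n f v u₁ hf hu₁
  · refine (xSum_le_symb hφ₀ u₂).trans ?_
    rw [mul_assoc _ _ (xSum φ₀ s v)]
    gcongr

end XDuhamel

/-! ### The space `L¹_e L²_{t,e^⊥}` and the Fourier transform in `(y, t)`. -/

section Lateral

variable {n : ℕ} {s : ℝ} {e : Space n}

/-- The variables `(y, t)` in `e^⊥ × ℝ`. -/
abbrev LatSpace (e : Space n) : Type := WithLp 2 (↥(ℝ ∙ e)ᗮ × ℝ)

/-- The decomposition `x = a e + y` of space. -/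
def latS (he : ‖e‖ = 1) : WithLp 2 (ℝ × ↥(ℝ ∙ e)ᗮ) ≃ₗᵢ[ℝ] Space n :=
  (LinearIsometryEquiv.withLpProdCongr 2 (LinearIsometryEquiv.toSpanUnitSingleton e he)
    (LinearIsometryEquiv.refl ℝ _)).trans (ℝ ∙ e).orthogonalDecomposition.symm

theorem latS_apply (he : ‖e‖ = 1) (a : ℝ) (y : ↥(ℝ ∙ e)ᗮ) :
    latS he (WithLp.toLp 2 (a, y)) = a • e + (y : Space n) := by
  simp [latS]

theorem inner_latS (he : ‖e‖ = 1) (a : ℝ) (y : ↥(ℝ ∙ e)ᗮ) :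
    inner ℝ (latS he (WithLp.toLp 2 (a, y))) e = a := by
  have h := Submodule.mem_orthogonal_singleton_iff_inner_left.1 y.2
  rw [latS_apply, inner_add_left, real_inner_smul_left, real_inner_self_eq_norm_sq, he, h]
  simp

theorem norm_latS_sq (he : ‖e‖ = 1) (a : ℝ) (y : ↥(ℝ ∙ e)ᗮ) :
    ‖latS he (WithLp.toLp 2 (a, y))‖ ^ 2 = a ^ 2 + ‖y‖ ^ 2 := by
  rw [LinearIsometryEquiv.norm_map, WithLp.prod_norm_sq_eq_of_L2]
  simp

/-- The decomposition `(x, t) = (a e + y, t)` of space-time. -/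
def latST (he : ‖e‖ = 1) : WithLp 2 (ℝ × LatSpace e) ≃ₗᵢ[ℝ] SpaceTime n :=
  (LinearIsometryEquiv.withLpProdAssoc 2 ℝ ℝ ↥(ℝ ∙ e)ᗮ ℝ).symm.trans
    (LinearIsometryEquiv.withLpProdCongr 2 (latS he) (LinearIsometryEquiv.refl ℝ ℝ))

theorem latST_apply (he : ‖e‖ = 1) (a : ℝ) (y : ↥(ℝ ∙ e)ᗮ) (t : ℝ) :
    latST he (WithLp.toLp 2 (a, WithLp.toLp 2 (y, t))) =
      pt (latS he (WithLp.toLp 2 (a, y))) t := rfl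

/-- The norm of `L¹_e L²_{t,e^⊥}` of a function. -/
def latSum (he : ‖e‖ = 1) (f : SpaceTime n → ℂ) : ℝ≥0∞ :=
  ∫⁻ a : ℝ, sqNorm volume (fun κ : LatSpace e => f (latST he (WithLp.toLp 2 (a, κ)))) ^ (1 / 2 : ℝ)

theorem measurePreserving_latST (he : ‖e‖ = 1) :
    MeasurePreserving (fun z : ℝ × LatSpace e => latST he (WithLp.toLp 2 z))
      (volume.prod volume) volume :=
  (latST he).measurePreserving.comp (WithLp.volume_preserving_toLp ℝ (LatSpace e))

theorem ae_fiber_latST (he : ‖e‖ = 1) {p : SpaceTime n → Prop} (h : ∀ᵐ ζ, p ζ) :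
    ∀ᵐ a : ℝ, ∀ᵐ κ : LatSpace e, p (latST he (WithLp.toLp 2 (a, κ))) :=
  ae_fiber_of_ae ((measurePreserving_latST he).quasiMeasurePreserving.ae h)

theorem latSum_congr (he : ‖e‖ = 1) {f f' : SpaceTime n → ℂ} (h : f =ᵐ[volume] f') :
    latSum he f = latSum he f' := by
  refine lintegral_congr_ae ?_
  filter_upwards [ae_fiber_latST he h] with a ha
  exact congrArg (· ^ (1 / 2 : ℝ)) (sqNorm_congr ha)

theorem latSum_mono (he : ‖e‖ = 1) {f f' : SpaceTime n → ℂ} (h : ∀ᵐ ζ, ‖f ζ‖ ≤ ‖f' ζ‖) :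
    latSum he f ≤ latSum he f' := by
  refine lintegral_mono_ae ?_
  filter_upwards [ae_fiber_latST he h] with a ha
  exact ENNReal.rpow_le_rpow (sqNorm_mono ha) (by norm_num)

/-- The order of the integrals over `t` and `y` is exchanged by Tonelli on almost every slice; the
slice variables form one Euclidean space, on which Plancherel can be used. -/
theorem lateralNorm_eq (he : ‖e‖ = 1) (f : L2ST n) : lateralNorm e f = latSum he f := by
  have h1 := (Lp.aestronglyMeasurable f).comp_measurePreserving (measurePreserving_latST he)
  refine lintegral_congr_ae ?_
  filter_upwards [h1.prodMk_left] with a ha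
  refine congrArg (· ^ (1 / 2 : ℝ)) ?_
  rw [← sqNorm_toLp]
  unfold sqNorm
  have h2 := (aestronglyMeasurable_toLp ha).enorm.pow_const 2
  refine Eq.trans ?_ (lintegral_prod_symm _ h2).symm
  simp only [Function.comp_def, latST_apply, latS_apply]

/-- `P` is the Fourier transform of `f` in the variables `(y, t)`. -/
structure IsLateral (he : ‖e‖ = 1) (f : SpaceTime n → ℂ) (P : ℝ × LatSpace e → ℂ)
    (g : SpaceTime n → ℂ) : Prop where
  meas : StronglyMeasurable P
  left : ∀ᵐ a : ℝ, IsFT (fun κ => f (latST he (WithLp.toLp 2 (a, κ)))) (fun κ => P (a, κ))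
  right : ∀ᵐ κ : LatSpace e,
    IsFT (fun a => P (a, κ)) (fun a => g (latST he (WithLp.toLp 2 (a, κ))))

theorem IsFT.exists_lateral (he : ‖e‖ = 1) {f g : SpaceTime n → ℂ} (h : IsFT f g) :
    ∃ P, IsLateral he f P g := by
  have h1 := h.comp_isometry (latST he)
  obtain ⟨P, hP, hfP⟩ := exists_isPartialFT (memLp_toLp_iff.2 h1.left)
  have hfP' := hfP.congr (Filter.EventuallyEq.refl _ _) hP.1.ae_eq_mk
  exact ⟨_, hP.1.stronglyMeasurable_mk, hfP',
    h1.isPartialFT hP.1.stronglyMeasurable_mk.aestronglyMeasurable hfP'⟩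

theorem IsLateral.latSum_eq {he : ‖e‖ = 1} {f g : SpaceTime n → ℂ} {P : ℝ × LatSpace e → ℂ}
    (h : IsLateral he f P g) :
    latSum he f = ∫⁻ a : ℝ, sqNorm volume (fun κ => P (a, κ)) ^ (1 / 2 : ℝ) := by
  refine lintegral_congr_ae ?_
  filter_upwards [h.left] with a ha
  rw [ha.sqNorm_eq]

/-- Multipliers in `τ` bounded by `1` are contractions on `L¹_e L²_{t,e^⊥}`. -/
theorem latSum_multiplier_le (he : ‖e‖ = 1) {f g f' g' : SpaceTime n → ℂ} (h : IsFT f g)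
    (h' : IsFT f' g') {b : ℝ → ℂ} (hb : Measurable b) (hb1 : ∀ τ, ‖b τ‖ ≤ 1)
    (hg : ∀ᵐ ζ, g' ζ = b ζ.snd * g ζ) : latSum he f' ≤ latSum he f := by
  obtain ⟨P, hP⟩ := h.exists_lateral he
  obtain ⟨P', hP'⟩ := h'.exists_lateral he
  rw [hP.latSum_eq, hP'.latSum_eq]
  -- The multiplier depends on τ only, so it commutes with the transform along e and acts by
  -- multiplication on `P`. Plancherel on each slice `a` then gives the contraction.
  have h1 : (fun z : LatSpace e × ℝ => P' z.swap) =ᵐ[volume.prod volume]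
      fun z => b z.1.snd * P z.swap := by
    refine ae_eq_of_fiber (hP'.meas.comp_measurable measurable_swap).aestronglyMeasurable
      (((hb.comp (by fun_prop)).stronglyMeasurable.mul
        (hP.meas.comp_measurable measurable_swap)).aestronglyMeasurable) ?_
    have h2 := ae_fiber_of_ae (Measure.measurePreserving_swap.quasiMeasurePreserving.ae
      ((measurePreserving_latST he).quasiMeasurePreserving.ae hg))
    filter_upwards [hP.right, hP'.right, h2] with κ h3 h4 h5
    exact h4.unique_left (h3.const_mul (b κ.snd)) h5
  have h2 := ae_fiber_of_ae (Measure.measurePreserving_swap.quasiMeasurePreserving.ae h1)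
  refine lintegral_mono_ae ?_
  filter_upwards [h2] with a ha
  refine ENNReal.rpow_le_rpow (sqNorm_mono ?_) (by norm_num)
  filter_upwards [ha] with κ hκ
  simp only [Prod.swap_prod_mk] at hκ
  rw [hκ, norm_mul]
  exact mul_le_of_le_one_left (norm_nonneg _) (hb1 _)

/-- The sup in the frequency dual to `a` is controlled by the integral in `a`. -/
theorem IsLateral.ae_eq_fourier {he : ‖e‖ = 1} {f g : SpaceTime n → ℂ} {P : ℝ × LatSpace e → ℂ}
    (h : IsLateral he f P g) (hg : AEStronglyMeasurable g) (hL : latSum he f < ⊤) :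
    (∫⁻ κ, (∫⁻ a, ‖P (a, κ)‖ₑ) ^ 2 ≤ latSum he f ^ 2) ∧
    (∀ᵐ κ : LatSpace e, Integrable fun a => P (a, κ)) ∧
    ∀ᵐ z : ℝ × LatSpace e ∂(volume.prod volume), g (latST he (WithLp.toLp 2 z)) =
      𝓕 (fun a => P (a, z.2)) z.1 := by
  have hm : AEMeasurable (fun z : ℝ × LatSpace e => ‖P z‖ₑ) (volume.prod volume) :=
    h.meas.aestronglyMeasurable.enorm
  -- Minkowski exchanges L¹ in `a` with L² in κ. In particular almost every fibre in `a` is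
  -- integrable, so its transform is a Fourier integral bounded by the integral of |`P`|.
  have h1 : ∫⁻ κ, (∫⁻ a, ‖P (a, κ)‖ₑ) ^ 2 ≤ latSum he f ^ 2 := by
    rw [h.latSum_eq]
    exact lintegral_lintegral_sq_le hm
  have h2 : ∀ᵐ κ : LatSpace e, Integrable fun a => P (a, κ) := by
    have h3 : AEMeasurable (fun κ : LatSpace e => (∫⁻ a, ‖P (a, κ)‖ₑ) ^ 2) :=
      (hm.lintegral_prod_left').pow_const 2
    filter_upwards [ae_lt_top' h3 (ne_top_of_le_ne_top (by finiteness) h1)] with κ h4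
    refine ⟨(h.meas.comp_measurable (by fun_prop)).aestronglyMeasurable, ?_⟩
    unfold HasFiniteIntegral
    by_contra hc
    rw [not_lt, top_le_iff] at hc
    simp [hc] at h4
  refine ⟨h1, h2, ?_⟩
  have hPs : AEStronglyMeasurable (fun z : LatSpace e × ℝ => P z.swap) (volume.prod volume) :=
    (h.meas.comp_measurable measurable_swap).aestronglyMeasurable
  have h5 : (fun z : LatSpace e × ℝ => g (latST he (WithLp.toLp 2 z.swap)))
      =ᵐ[volume.prod volume] fun z => 𝓕 (fun a => P (a, z.1)) z.2 := by
    refine ae_eq_of_fiber ((hg.comp_measurePreserving (measurePreserving_latST he)).comp_measurePreserving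
      Measure.measurePreserving_swap) (aestronglyMeasurable_fourier_fiber hPs) ?_
    filter_upwards [h2, h.right] with κ h6 h7
    exact h7.unique (IsFT.of_integrable h6 h7.left) (Filter.EventuallyEq.refl _ _)
  exact Measure.measurePreserving_swap.quasiMeasurePreserving.ae h5

end Lateral

/-! ### The resolvent in time and its causal, exponentially decaying kernel. -/

section Resolvent

/-- The inverse Fourier transform of `τ ↦ (timeSymb w τ)⁻¹`. -/
def timeKernel (w r : ℝ) : ℂ :=
  (Set.Ioi (0 : ℝ)).indicator (fun r : ℝ => -Complex.I * Complex.exp ((-1 - Complex.I * w) * r)) r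

theorem norm_timeKernel_le (w r : ℝ) : ‖timeKernel w r‖ ≤ 1 := by
  unfold timeKernel
  by_cases h : r ∈ Set.Ioi (0 : ℝ)
  · rw [Set.indicator_of_mem h, norm_mul, Complex.norm_exp]
    simpa using le_of_lt h
  · rw [Set.indicator_of_notMem h]; simp

theorem integrable_timeKernel (w : ℝ) : Integrable (timeKernel w) := by
  refine (integrable_indicator_iff measurableSet_Ioi).2 (Integrable.const_mul ?_ _)
  exact integrableOn_exp_mul_complex_Ioi (by simp) 0

theorem sqNorm_timeKernel_le (w : ℝ) : sqNorm volume (timeKernel w) ≤ 1 := by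
  calc sqNorm volume (timeKernel w) ≤
        ∫⁻ r, (Set.Ioi (0 : ℝ)).indicator (fun r => ENNReal.ofReal (Real.exp (-r))) r := by
        refine lintegral_mono fun r => ?_
        unfold timeKernel
        by_cases h : r ∈ Set.Ioi (0 : ℝ)
        · rw [Set.indicator_of_mem h, Set.indicator_of_mem h, ← ofReal_norm, norm_mul,
            Complex.norm_exp, ← ENNReal.ofReal_pow (by positivity)]
          refine ENNReal.ofReal_le_ofReal ?_
          have h1 : Real.exp (-r) ≤ 1 := Real.exp_le_one_iff.2 (by simpa using le_of_lt h)
          have h2 := Real.exp_pos (-r)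
          simp only [norm_neg, Complex.norm_I, one_mul]
          simp
          nlinarith
        · rw [Set.indicator_of_notMem h]; simp
    _ = ENNReal.ofReal (∫ r in Set.Ioi (0 : ℝ), Real.exp (-r)) := by
        rw [lintegral_indicator measurableSet_Ioi]
        refine (ofReal_integral_eq_lintegral_ofReal (integrableOn_exp_neg_Ioi 0) ?_).symm
        exact Filter.Eventually.of_forall fun r => (Real.exp_pos _).le
    _ = 1 := by rw [integral_exp_neg_Ioi_zero]; simp

theorem memLp_timeKernel (w : ℝ) : MemLp (timeKernel w) 2 :=
  memLp_two_iff.2 ⟨(integrable_timeKernel w).1,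
    (sqNorm_timeKernel_le w).trans_lt ENNReal.one_lt_top⟩

/-- The integral of a decaying exponential over the half line; the `+ i` of the symbol supplies the
decay rate 1, uniformly in `w`. -/
theorem fourier_timeKernel (w τ : ℝ) : 𝓕 (timeKernel w) τ = (timeSymb w τ)⁻¹ := by
  rw [Real.fourier_real_eq_integral_exp_smul]
  have h1 : ∀ r : ℝ, Complex.exp (↑(-2 * Real.pi * r * τ) * Complex.I) • timeKernel w r =
      (Set.Ioi (0 : ℝ)).indicator (fun r : ℝ =>
        -Complex.I * Complex.exp ((-1 - Complex.I * (2 * Real.pi * τ + w : ℝ)) * r)) r := by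
    intro r
    unfold timeKernel
    by_cases h : r ∈ Set.Ioi (0 : ℝ)
    · rw [Set.indicator_of_mem h, Set.indicator_of_mem h, smul_eq_mul, mul_left_comm,
        ← Complex.exp_add]
      congr 2
      push_cast
      ring
    · rw [Set.indicator_of_notMem h, Set.indicator_of_notMem h, smul_zero]
  simp only [h1]
  rw [integral_indicator measurableSet_Ioi, integral_const_mul,
    integral_exp_mul_complex_Ioi (by simp)]
  have h2 : (-1 - Complex.I * ((2 * Real.pi * τ + w : ℝ) : ℂ)) ≠ 0 := by
    intro h
    have := congrArg Complex.re h
    simp at this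
  have h3 : timeSymb w τ = -Complex.I * (-1 - Complex.I * ((2 * Real.pi * τ + w : ℝ) : ℂ)) := by
    unfold timeSymb
    linear_combination (-((2 * Real.pi * τ + w : ℝ) : ℂ)) * Complex.I_sq
  rw [h3]
  simp
  field_simp

theorem isFT_timeKernel (w : ℝ) : IsFT (timeKernel w) (fun τ => (timeSymb w τ)⁻¹) := by
  have := IsFT.of_integrable (integrable_timeKernel w) (memLp_timeKernel w)
  exact this.congr (Filter.EventuallyEq.refl _ _)
    (Filter.EventuallyEq.of_eq (funext fun τ => fourier_timeKernel w τ))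

theorem timeSymb_two_pi_mul (z τ : ℝ) : timeSymb (2 * Real.pi * z) τ = timeSymb 0 (τ + z) := by
  unfold timeSymb
  congr 3
  ring

/-- As a function of `z` this is a translate of the resolvent symbol at `w = 0`, whose L² norm
equals that of `timeKernel 0`. -/
theorem sqNorm_inv_timeSymb_le (τ : ℝ) :
    sqNorm volume (fun z : ℝ => (timeSymb (2 * Real.pi * z) τ)⁻¹) ≤ 1 := by
  refine le_trans (le_of_eq ?_) (sqNorm_timeKernel_le 0)
  rw [(isFT_timeKernel 0).sqNorm_eq]
  unfold sqNorm
  simp only [timeSymb_two_pi_mul]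
  exact lintegral_add_left_eq_self (fun z => ‖(timeSymb 0 z)⁻¹‖ₑ ^ 2) τ

/-- Convolution with `(timeSymb 0)⁻¹` is bounded on `L²`. -/
theorem sqNorm_integral_timeSymb_le (h : ℝ → ℂ) (hm : AEStronglyMeasurable h) :
    sqNorm volume (fun z : ℝ => ∫ τ, (timeSymb (2 * Real.pi * z) τ)⁻¹ * h τ) ≤ sqNorm volume h := by
  by_cases hf : sqNorm volume h = ⊤
  · rw [hf]; exact le_top
  have hh : MemLp h 2 := memLp_two_iff.2 ⟨hm, lt_top_iff_ne_top.2 hf⟩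
  obtain ⟨q, hq⟩ := exists_isFT hh
  set p : ℝ → ℂ := fun r => timeKernel 0 r * q r with hp
  have hpm : MemLp p 2 :=
    memLp_mul_of_bound (integrable_timeKernel 0).1 (norm_timeKernel_le 0) hq.right
  have hpi : Integrable p := (hq.right.integrable_mul (memLp_timeKernel 0)).congr
    (Filter.Eventually.of_forall fun r => mul_comm _ _)
  -- Modulating `timeKernel 0` by e^{-2πirz} gives `timeKernel (2πz)`. By the multiplication formula
  -- the integral is therefore the Fourier transform of `timeKernel 0` times the transform of `h`,
  -- and the kernel is bounded by 1.
  have h1 : ∀ z : ℝ, ∫ τ, (timeSymb (2 * Real.pi * z) τ)⁻¹ * h τ = 𝓕 p z := by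
    intro z
    rw [Real.fourier_real_eq_integral_exp_smul]
    have h2 := hq.integral_mul_eq (isFT_timeKernel (2 * Real.pi * z))
    calc _ = ∫ τ, h τ * (timeSymb (2 * Real.pi * z) τ)⁻¹ := by simp only [mul_comm]
      _ = _ := h2
      _ = _ := by
        refine integral_congr_ae (Filter.Eventually.of_forall fun r => ?_)
        simp only [hp, timeKernel, smul_eq_mul]
        by_cases h : r ∈ Set.Ioi (0 : ℝ)
        · rw [Set.indicator_of_mem h, Set.indicator_of_mem h]
          rw [show (-1 - Complex.I * ((2 * Real.pi * z : ℝ) : ℂ)) * r =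
            ((-2 * Real.pi * r * z : ℝ) : ℂ) * Complex.I + (-1 - Complex.I * ((0 : ℝ) : ℂ)) * r by
              push_cast; ring, Complex.exp_add]
          ring
        · rw [Set.indicator_of_notMem h, Set.indicator_of_notMem h]; simp
  simp only [h1]
  rw [← (IsFT.of_integrable hpi hpm).sqNorm_eq, hq.sqNorm_eq]
  refine sqNorm_mono (Filter.Eventually.of_forall fun r => ?_)
  rw [hp]
  simp only [norm_mul]
  exact mul_le_of_le_one_left (norm_nonneg _) (norm_timeKernel_le 0 r)

end Resolvent

/-! ### Replacing the frequency along `e` by the dispersion relation. -/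

section ChangeOfVariables

variable {n : ℕ} {s : ℝ} {e : Space n}

/-- Frequencies of size at most `R` with component along `e` between `l` and `u`. -/
def latBox (e : Space n) (R l u : ℝ) : Set (Space n) :=
  {ξ | ‖(2 * Real.pi) • ξ‖ ≤ R ∧ inner ℝ ((2 * Real.pi) • ξ) e ∈ Set.Icc l u}

theorem measurableSet_latBox (R l u : ℝ) : MeasurableSet (latBox e R l u) := by
  refine (measurableSet_le (f := fun ξ : Space n => ‖(2 * Real.pi) • ξ‖) (by fun_prop)
    measurable_const).inter ?_
  exact measurableSet_Icc.preimage (Continuous.measurable (by fun_prop))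

theorem disp_latS (he : ‖e‖ = 1) (a : ℝ) (y : ↥(ℝ ∙ e)ᗮ) :
    disp s (latS he (WithLp.toLp 2 (a, y))) = ((2 * Real.pi) ^ 2 * (a ^ 2 + ‖y‖ ^ 2)) ^ s := by
  rw [← norm_latS_sq he, disp, norm_smul, Real.norm_of_nonneg (by positivity), ← mul_pow,
    ← Real.rpow_natCast, ← Real.rpow_mul (by positivity)]
  simp

/-- The variable `α` may be replaced by `|ξ| ^ (2 s)`. -/
theorem lintegral_comp_disp_le (hs : s ∈ Set.Ioo (1 / 2 : ℝ) 1) (he : ‖e‖ = 1) {R l u : ℝ}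
    (hR : 0 < R) (hl : 0 < l) (y : ↥(ℝ ∙ e)ᗮ) (g : ℝ → ℝ≥0∞) :
    ENNReal.ofReal (l * R ^ (2 * s - 2)) *
      ∫⁻ a in {a : ℝ | latS he (WithLp.toLp 2 (a, y)) ∈ latBox e R l u},
        g (disp s (latS he (WithLp.toLp 2 (a, y))) / (2 * Real.pi)) ≤ ∫⁻ z, g z := by
  set S : Set ℝ := {a : ℝ | latS he (WithLp.toLp 2 (a, y)) ∈ latBox e R l u} with hS
  have hSm : MeasurableSet S := by
    refine (measurableSet_latBox R l u).preimage (Continuous.measurable ?_)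
    fun_prop
  have hpi := Real.pi_pos
  set f : ℝ → ℝ := fun a => disp s (latS he (WithLp.toLp 2 (a, y))) / (2 * Real.pi) with hf
  set f' : ℝ → ℝ := fun a => ((2 * Real.pi) ^ 2 * (2 * a)) * s *
    ((2 * Real.pi) ^ 2 * (a ^ 2 + ‖y‖ ^ 2)) ^ (s - 1) / (2 * Real.pi) with hf'
  have hSa : ∀ a ∈ S, l ≤ 2 * Real.pi * a ∧ (2 * Real.pi) ^ 2 * (a ^ 2 + ‖y‖ ^ 2) ≤ R ^ 2 := by
    rintro a ⟨h1, h2⟩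
    rw [real_inner_smul_left, inner_latS] at h2
    refine ⟨h2.1, ?_⟩
    rw [← norm_latS_sq he, ← mul_pow]
    rw [norm_smul, Real.norm_of_nonneg (by positivity)] at h1
    gcongr
  have hpos : ∀ a ∈ S, 0 < a := fun a ha => by
    have := (hSa a ha).1
    by_contra! hc
    nlinarith
  have hderiv : ∀ a ∈ S, HasDerivWithinAt f (f' a) S a := by
    intro a ha
    have h1 : HasDerivAt (fun a : ℝ => (2 * Real.pi) ^ 2 * (a ^ 2 + ‖y‖ ^ 2))
        ((2 * Real.pi) ^ 2 * (2 * a)) a := by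
      have := ((hasDerivAt_pow 2 a).add_const (‖y‖ ^ 2)).const_mul ((2 * Real.pi) ^ 2)
      simpa using this
    have h2 := h1.rpow_const (p := s) (Or.inl (by have := hpos a ha; positivity))
    have h3 := h2.div_const (2 * Real.pi)
    refine HasDerivAt.hasDerivWithinAt ?_
    simp only [hf, disp_latS]
    exact h3
  have hinj : Set.InjOn f S := by
    intro a ha b hb hab
    simp only [hf, disp_latS] at hab
    have h1 := (div_left_inj' (by positivity : 2 * Real.pi ≠ 0)).1 hab
    have h2 := Real.rpow_left_injOn (by linarith [hs.1] : s ≠ 0)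
      (Set.mem_ofPred.2 (by positivity)) (Set.mem_ofPred.2 (by positivity)) h1
    have h3 : a ^ 2 = b ^ 2 := by
      have := mul_left_cancel₀ (by positivity : (2 * Real.pi) ^ 2 ≠ 0) h2
      linarith
    exact (sq_eq_sq₀ (hpos a ha).le (hpos b hb).le).1 h3
  -- The derivative is 2s · (2πa) · |2πξ|^{2s-2}. On the box 2πa ≥ l, while 2s ≥ 1 and, as s < 1,
  -- the last factor is least at |2πξ| = R.
  have hlow : ∀ a ∈ S, l * R ^ (2 * s - 2) ≤ |f' a| := by
    intro a ha
    have h1 := hpos a ha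
    obtain ⟨h2, h3⟩ := hSa a ha
    refine le_trans ?_ (le_abs_self _)
    have h4 : R ^ (2 * s - 2) ≤ ((2 * Real.pi) ^ 2 * (a ^ 2 + ‖y‖ ^ 2)) ^ (s - 1) := by
      calc R ^ (2 * s - 2) = (R ^ 2) ^ (s - 1) := by
            rw [← Real.rpow_natCast, ← Real.rpow_mul hR.le]
            congr 1
            push_cast
            ring
        _ ≤ _ := Real.rpow_le_rpow_of_nonpos (by positivity) h3 (by linarith [hs.2])
    have h5 : f' a = (2 * s) * (2 * Real.pi * a) *
        ((2 * Real.pi) ^ 2 * (a ^ 2 + ‖y‖ ^ 2)) ^ (s - 1) := by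
      rw [hf']
      field_simp
    rw [h5]
    refine mul_le_mul ?_ h4 (by positivity) (by have := hs.1; positivity)
    have := hs.1
    nlinarith
  calc _ = ∫⁻ a in S, ENNReal.ofReal (l * R ^ (2 * s - 2)) * g (f a) := by
        rw [lintegral_const_mul' _ _ (by finiteness)]
    _ ≤ ∫⁻ a in S, ENNReal.ofReal |f' a| * g (f a) := by
        refine setLIntegral_mono' hSm fun a ha => ?_
        gcongr
        exact hlow a ha
    _ = ∫⁻ z in f '' S, g z := (lintegral_image_eq_lintegral_abs_deriv_mul hSm hderiv hinj g).symm
    _ ≤ _ := lintegral_mono' Measure.restrict_le_self le_rfl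

end ChangeOfVariables

/-! ### Weighted `L²` bounds and time traces from the lateral norm. -/

section LateralEstimates

variable {n : ℕ} {s : ℝ} {e : Space n}

theorem lintegral_latST (he : ‖e‖ = 1) (f : SpaceTime n → ℝ≥0∞) :
    ∫⁻ ζ, f ζ = ∫⁻ z : ℝ × LatSpace e, f (latST he (WithLp.toLp 2 z)) ∂(volume.prod volume) :=
  ((measurePreserving_latST he).lintegral_comp_emb
    ((latST he).toHomeomorph.measurableEmbedding.comp measurableEmbedding_toLp) f).symm

theorem lintegral_latS (he : ‖e‖ = 1) (f : Space n → ℝ≥0∞) :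
    ∫⁻ ξ, f ξ = ∫⁻ z : ℝ × ↥(ℝ ∙ e)ᗮ, f (latS he (WithLp.toLp 2 z)) ∂(volume.prod volume) :=
  (((latS he).measurePreserving.comp
    (WithLp.volume_preserving_toLp ℝ ↥(ℝ ∙ e)ᗮ)).lintegral_comp_emb
    ((latS he).toHomeomorph.measurableEmbedding.comp measurableEmbedding_toLp) f).symm

theorem lintegral_toLp {U V : Type*} [NormedAddCommGroup U] [InnerProductSpace ℝ U]
    [FiniteDimensional ℝ U] [MeasurableSpace U] [BorelSpace U]
    [NormedAddCommGroup V] [InnerProductSpace ℝ V]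
    [FiniteDimensional ℝ V] [MeasurableSpace V] [BorelSpace V] (f : WithLp 2 (U × V) → ℝ≥0∞) :
    ∫⁻ ζ, f ζ = ∫⁻ z : U × V, f (WithLp.toLp 2 z) ∂(volume.prod volume) :=
  ((WithLp.volume_preserving_toLp U V).lintegral_comp_emb measurableEmbedding_toLp f).symm

/-- Weighted `L²` bounds of the Fourier transform by the lateral norm. -/
theorem lintegral_mul_sq_le_latSum (he : ‖e‖ = 1) {f g : SpaceTime n → ℂ} (h : IsFT f g)
    (hL : latSum he f < ⊤) {S : Set (Space n)} (hS : MeasurableSet S)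
    (hg : ∀ᵐ ζ, ζ.fst ∉ S → g ζ = 0) {wt : SpaceTime n → ℝ≥0∞} (hwt : Measurable wt) {B : ℝ≥0∞}
    (hB : ∀ (y : ↥(ℝ ∙ e)ᗮ) (τ : ℝ), ∫⁻ a in {a : ℝ | latS he (WithLp.toLp 2 (a, y)) ∈ S},
      wt (pt (latS he (WithLp.toLp 2 (a, y))) τ) ≤ B) :
    ∫⁻ ζ, wt ζ * ‖g ζ‖ₑ ^ 2 ≤ B * latSum he f ^ 2 := by
  obtain ⟨P, hP⟩ := h.exists_lateral he
  obtain ⟨h1, -, h3⟩ := hP.ae_eq_fourier h.right.1 hL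
  have hm : Measurable (fun κ : LatSpace e => (∫⁻ a, ‖P (a, κ)‖ₑ) ^ 2) :=
    (hP.meas.measurable.enorm.lintegral_prod_left').pow_const 2
  rw [lintegral_latST he]
  have h4 : AEMeasurable (fun z : ℝ × LatSpace e => wt (latST he (WithLp.toLp 2 z)) *
      ‖g (latST he (WithLp.toLp 2 z))‖ₑ ^ 2) (volume.prod volume) :=
    (hwt.aemeasurable.mul (h.right.1.enorm.pow_const 2)).comp_quasiMeasurePreserving
      (measurePreserving_latST he).quasiMeasurePreserving
  rw [lintegral_prod_symm _ h4]
  have h5 : ∀ᵐ κ : LatSpace e, ∀ᵐ a : ℝ, g (latST he (WithLp.toLp 2 (a, κ))) =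
      𝓕 (fun a => P (a, κ)) a :=
    ae_fiber_of_ae (Measure.measurePreserving_swap.quasiMeasurePreserving.ae h3)
  have h6 : ∀ᵐ κ : LatSpace e, ∀ᵐ a : ℝ, (latST he (WithLp.toLp 2 (a, κ))).fst ∉ S →
      g (latST he (WithLp.toLp 2 (a, κ))) = 0 :=
    ae_fiber_of_ae (Measure.measurePreserving_swap.quasiMeasurePreserving.ae
      ((measurePreserving_latST he).quasiMeasurePreserving.ae hg))
  calc _ ≤ ∫⁻ κ : LatSpace e, B * (∫⁻ a, ‖P (a, κ)‖ₑ) ^ 2 := by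
        refine lintegral_mono_ae ?_
        filter_upwards [h5, h6] with κ h7 h8
        have hSm : MeasurableSet {a : ℝ | latS he (WithLp.toLp 2 (a, κ.fst)) ∈ S} :=
          hS.preimage (Continuous.measurable (by fun_prop))
        -- The transform along e is bounded, uniformly in the dual variable, by the integral of
        -- |`P`|. What remains is the integral of the weight over the slice, which is at most `B`.
        calc _ ≤ ∫⁻ a, {a : ℝ | latS he (WithLp.toLp 2 (a, κ.fst)) ∈ S}.indicator
              (fun a => wt (pt (latS he (WithLp.toLp 2 (a, κ.fst))) κ.snd)) a *
                (∫⁻ a, ‖P (a, κ)‖ₑ) ^ 2 := by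
              refine lintegral_mono_ae ?_
              filter_upwards [h7, h8] with a h9 h10
              by_cases ha : latS he (WithLp.toLp 2 (a, κ.fst)) ∈ S
              · have ha' : a ∈ {a : ℝ | latS he (WithLp.toLp 2 (a, κ.fst)) ∈ S} := ha
                rw [Set.indicator_of_mem ha']
                refine mul_le_mul le_rfl ?_ zero_le zero_le
                gcongr
                rw [h9, Real.fourier_eq]
                refine (enorm_integral_le_lintegral_enorm _).trans (le_of_eq ?_)
                refine lintegral_congr fun b => ?_
                rw [← ofReal_norm, Circle.norm_smul, ofReal_norm]
              · rw [h10 ha]; simp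
          _ = (∫⁻ a in {a : ℝ | latS he (WithLp.toLp 2 (a, κ.fst)) ∈ S},
              wt (pt (latS he (WithLp.toLp 2 (a, κ.fst))) κ.snd)) *
                (∫⁻ a, ‖P (a, κ)‖ₑ) ^ 2 := by
              rw [lintegral_mul_const, lintegral_indicator hSm]
              refine Measurable.indicator (hwt.comp (Continuous.measurable ?_)) hSm
              have : Continuous fun x : Space n => pt x κ.snd := by fun_prop
              exact this.comp (by fun_prop)
          _ ≤ _ := by
              gcongr
              exact hB _ _
    _ ≤ _ := by
        rw [lintegral_const_mul _ hm]
        gcongr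

/-- Fubini moves the Fourier integral in `a` outside the τ integral. It applies because `k` and the
integral of |`P`| over `a` are both in L² of τ, so their product is integrable. -/
theorem norm_integral_mul_fourier_le {P : ℝ × ℝ → ℂ} (hP : StronglyMeasurable P)
    {k : ℝ → ℂ} (hk : Continuous k) (hk2 : MemLp k 2)
    (hm : ∫⁻ τ, (∫⁻ a, ‖P (a, τ)‖ₑ) ^ 2 < ⊤) (α : ℝ) :
    ‖∫ τ, k τ * 𝓕 (fun a => P (a, τ)) α‖ₑ ≤ ∫⁻ a, ‖∫ τ, k τ * P (a, τ)‖ₑ := by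
  have hint : Integrable (Function.uncurry fun (τ a : ℝ) =>
      Real.fourierChar (-inner ℝ a α) • (k τ * P (a, τ))) (volume.prod volume) := by
    have hmeas : StronglyMeasurable (Function.uncurry fun (τ a : ℝ) =>
        Real.fourierChar (-inner ℝ a α) • (k τ * P (a, τ))) := by
      have h1 : StronglyMeasurable fun z : ℝ × ℝ =>
          ((Real.fourierChar (-inner ℝ z.2 α) : Circle) : ℂ) := by
        refine Continuous.stronglyMeasurable ?_
        exact continuous_subtype_val.comp (Real.continuous_fourierChar.comp (by fun_prop))
      exact h1.mul ((hk.stronglyMeasurable.comp_measurable measurable_fst).mul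
        (hP.comp_measurable measurable_swap))
    refine ⟨hmeas.aestronglyMeasurable, ?_⟩
    unfold HasFiniteIntegral
    rw [lintegral_prod _ hmeas.aestronglyMeasurable.enorm]
    calc _ = ∫⁻ τ, ‖k τ‖ₑ * ∫⁻ a, ‖P (a, τ)‖ₑ := by
          refine lintegral_congr fun τ => ?_
          rw [← lintegral_const_mul' _ _ (by finiteness)]
          refine lintegral_congr fun a => ?_
          simp only [Function.uncurry]
          rw [← ofReal_norm, Circle.norm_smul, ofReal_norm, enorm_mul]
      _ ≤ ∫⁻ τ, (‖k τ‖ₑ ^ 2 + (∫⁻ a, ‖P (a, τ)‖ₑ) ^ 2) := by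
          refine lintegral_mono fun τ => ?_
          rcases le_total ‖k τ‖ₑ (∫⁻ a, ‖P (a, τ)‖ₑ) with h | h
          · refine le_trans ?_ le_add_self
            rw [sq]; gcongr
          · refine le_trans ?_ le_self_add
            rw [sq]; gcongr
      _ = sqNorm volume k + ∫⁻ τ, (∫⁻ a, ‖P (a, τ)‖ₑ) ^ 2 :=
          lintegral_add_left (by fun_prop) _
      _ < ⊤ := ENNReal.add_lt_top.2 ⟨(memLp_two_iff.1 hk2).2, hm⟩
  have h1 : ∫ τ, k τ * 𝓕 (fun a => P (a, τ)) α =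
      ∫ a, Real.fourierChar (-inner ℝ a α) • ∫ τ, k τ * P (a, τ) := by
    calc _ = ∫ τ, ∫ a, Real.fourierChar (-inner ℝ a α) • (k τ * P (a, τ)) := by
          refine integral_congr_ae (Filter.Eventually.of_forall fun τ => ?_)
          simp only [Real.fourier_eq]
          rw [← integral_const_mul]
          refine integral_congr_ae (Filter.Eventually.of_forall fun a => ?_)
          simp only [Circle.smul_def, smul_eq_mul]
          ring
      _ = ∫ a, ∫ τ, Real.fourierChar (-inner ℝ a α) • (k τ * P (a, τ)) :=
          integral_integral_swap hint
      _ = _ := by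
          refine integral_congr_ae (Filter.Eventually.of_forall fun a => ?_)
          simp only [Circle.smul_def]
          rw [integral_smul]
  rw [h1]
  refine (enorm_integral_le_lintegral_enorm _).trans (le_of_eq ?_)
  refine lintegral_congr fun b => ?_
  rw [← ofReal_norm, Circle.norm_smul, ofReal_norm]

theorem memLp_inv_timeSymb (w : ℝ) : MemLp (fun τ => (timeSymb w τ)⁻¹) 2 :=
  (isFT_timeKernel w).right

theorem timeSymb_ne_zero (w τ : ℝ) : timeSymb w τ ≠ 0 := by
  intro h
  have := congrArg Complex.im h
  simp [timeSymb] at this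

/-- The trace of the solution of `(i ∂ₜ - (-Δ) ^ s + i) u = f` at a fixed time. -/
theorem lintegral_trace_le_latSum (hs : s ∈ Set.Ioo (1 / 2 : ℝ) 1) (he : ‖e‖ = 1)
    {f g : SpaceTime n → ℂ} (h : IsFT f g) (hL : latSum he f < ⊤) {R l u : ℝ} (hR : 0 < R)
    (hl : 0 < l) (hg : ∀ᵐ ζ, ζ.fst ∉ latBox e R l u → g ζ = 0) :
    ∫⁻ ξ : Space n, ‖∫ τ : ℝ, (symb s (pt ξ τ))⁻¹ * g (pt ξ τ)‖ₑ ^ 2 ≤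
      (ENNReal.ofReal (l * R ^ (2 * s - 2)))⁻¹ * latSum he f ^ 2 := by
  obtain ⟨P, hP⟩ := h.exists_lateral he
  obtain ⟨h1, -, h3⟩ := hP.ae_eq_fourier h.right.1 hL
  have hs0 : 0 < s := by linarith [hs.1]
  set S := latBox e R l u with hS
  have hSm : MeasurableSet S := measurableSet_latBox R l u
  have hcm : MeasurePreserving (fun ζ : SpaceTime n => WithLp.ofLp ((latST he).symm ζ)) volume
      (volume.prod volume) :=
    (WithLp.volume_preserving_ofLp ℝ (LatSpace e)).comp (latST he).symm.measurePreserving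
  have hcS : MeasurePreserving (fun ξ : Space n => WithLp.ofLp ((latS he).symm ξ)) volume
      (volume.prod volume) :=
    (WithLp.volume_preserving_ofLp ℝ ↥(ℝ ∙ e)ᗮ).comp (latS he).symm.measurePreserving
  have h4 : ∀ᵐ ξ : Space n, ∀ᵐ τ : ℝ, g (pt ξ τ) =
      𝓕 (fun a => P (a, WithLp.toLp 2 (((latS he).symm ξ).snd, τ))) ((latS he).symm ξ).fst := by
    have := hcm.quasiMeasurePreserving.ae h3
    simp only [WithLp.toLp_ofLp, LinearIsometryEquiv.apply_symm_apply] at this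
    exact ae_fiber_toLp this
  have h5 : ∀ᵐ ξ : Space n,
      ∫⁻ τ : ℝ, (∫⁻ a, ‖P (a, WithLp.toLp 2 (((latS he).symm ξ).snd, τ))‖ₑ) ^ 2 < ⊤ := by
    have hm : Measurable (fun κ : LatSpace e => (∫⁻ a, ‖P (a, κ)‖ₑ) ^ 2) :=
      (hP.meas.measurable.enorm.lintegral_prod_left').pow_const 2
    have hm' : Measurable (fun z : ↥(ℝ ∙ e)ᗮ × ℝ =>
        (∫⁻ a, ‖P (a, WithLp.toLp 2 z)‖ₑ) ^ 2) := hm.comp (by fun_prop)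
    have h6 : ∫⁻ y : ↥(ℝ ∙ e)ᗮ, ∫⁻ τ : ℝ, (∫⁻ a, ‖P (a, WithLp.toLp 2 (y, τ))‖ₑ) ^ 2 < ⊤ := by
      rw [lintegral_toLp, lintegral_prod _ hm'.aemeasurable] at h1
      exact h1.trans_lt (by finiteness)
    have h7 := ae_lt_top hm'.lintegral_prod_right' h6.ne
    exact hcS.quasiMeasurePreserving.ae (Measure.quasiMeasurePreserving_snd.ae h7)
  -- `T (a, ξ)` is the time-zero trace produced by the slice of the source at position `a`. Beyond
  -- the component of ξ orthogonal to e, it depends on ξ only through `disp s ξ`.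
  set T : ℝ × Space n → ℂ := fun z => ∫ τ, (timeSymb (disp s z.2) τ)⁻¹ *
    P (z.1, WithLp.toLp 2 (((latS he).symm z.2).snd, τ)) with hT
  have hTm : StronglyMeasurable T := by
    refine StronglyMeasurable.integral_prod_right' (f := fun w : (ℝ × Space n) × ℝ =>
      (timeSymb (disp s w.1.2) w.2)⁻¹ *
        P (w.1.1, WithLp.toLp 2 (((latS he).symm w.1.2).snd, w.2))) ?_
    refine StronglyMeasurable.mul (Continuous.stronglyMeasurable ?_)
      (hP.meas.comp_measurable (Continuous.measurable (by fun_prop)))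
    refine Continuous.inv₀ ?_ fun w => timeSymb_ne_zero _ _
    have := continuous_disp (n := n) hs0
    unfold timeSymb
    fun_prop
  set G : ℝ × Space n → ℝ≥0∞ := fun z => S.indicator (fun ξ => ‖T (z.1, ξ)‖ₑ) z.2 with hG
  have hGm : Measurable G := by
    have : G = (Prod.snd ⁻¹' S).indicator (fun z => ‖T z‖ₑ) := by
      ext z
      rfl
    rw [this]
    exact hTm.measurable.enorm.indicator (hSm.preimage measurable_snd)
  have h6 : ∀ᵐ ξ : Space n, ‖∫ τ : ℝ, (symb s (pt ξ τ))⁻¹ * g (pt ξ τ)‖ₑ ≤ ∫⁻ a, G (a, ξ) := by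
    filter_upwards [h4, h5, ae_fiber_toLp hg] with ξ h7 h8 h9
    by_cases hξ : ξ ∈ S
    · simp only [hG, Set.indicator_of_mem hξ]
      have h10 : ∫ τ : ℝ, (symb s (pt ξ τ))⁻¹ * g (pt ξ τ) =
          ∫ τ : ℝ, (timeSymb (disp s ξ) τ)⁻¹ *
            𝓕 (fun a => P (a, WithLp.toLp 2 (((latS he).symm ξ).snd, τ)))
              ((latS he).symm ξ).fst := by
        refine integral_congr_ae ?_
        filter_upwards [h7] with τ hτ
        rw [hτ, symb_pt]
      rw [h10]
      exact norm_integral_mul_fourier_le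
        (P := fun z : ℝ × ℝ => P (z.1, WithLp.toLp 2 (((latS he).symm ξ).snd, z.2)))
        (hP.meas.comp_measurable (by fun_prop))
        (Continuous.inv₀ (continuous_timeSymb _) fun τ => timeSymb_ne_zero _ τ)
        (memLp_inv_timeSymb _) h8 _
    · rw [integral_eq_zero_of_ae]
      · simp
      · filter_upwards [h9] with τ hτ
        rw [hτ hξ]; simp
  -- For fixed `a` and `y`, the new variable z = |2πξ|^{2s} / 2π turns the trace into a convolution
  -- of the slice with the resolvent, which is bounded on L². The Jacobian gives the constant.
  have h7 : ∀ a : ℝ, ∫⁻ ξ, G (a, ξ) ^ 2 ≤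
      (ENNReal.ofReal (l * R ^ (2 * s - 2)))⁻¹ * sqNorm volume (fun κ => P (a, κ)) := by
    intro a
    have hGa : Measurable fun ξ => G (a, ξ) ^ 2 := (hGm.comp (by fun_prop)).pow_const 2
    have hc : 0 < l * R ^ (2 * s - 2) := by positivity
    have hGl : Measurable fun z : ℝ × ↥(ℝ ∙ e)ᗮ => G (a, latS he (WithLp.toLp 2 z)) ^ 2 := by
      have : Measurable fun z : ℝ × ↥(ℝ ∙ e)ᗮ => latS he (WithLp.toLp 2 z) :=
        Continuous.measurable (by fun_prop)
      exact hGa.comp this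
    rw [lintegral_latS he, lintegral_prod_symm _ hGl.aemeasurable]
    have hPa : sqNorm volume (fun κ => P (a, κ)) =
        ∫⁻ y : ↥(ℝ ∙ e)ᗮ, sqNorm volume fun τ : ℝ => P (a, WithLp.toLp 2 (y, τ)) := by
      rw [← sqNorm_toLp]
      have : StronglyMeasurable fun z : ↥(ℝ ∙ e)ᗮ × ℝ => P (a, WithLp.toLp 2 z) :=
        hP.meas.comp_measurable (by fun_prop)
      exact sqNorm_prod this.aestronglyMeasurable
    rw [hPa, ← lintegral_const_mul' _ _ (by simp [hc])]
    refine lintegral_mono fun y => ?_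
    rw [← ENNReal.mul_le_iff_le_inv (by simpa using hc) (by finiteness)]
    refine le_trans (le_of_eq ?_) ((lintegral_comp_disp_le (u := u) hs he hR hl y (fun z =>
      ‖∫ τ, (timeSymb (2 * Real.pi * z) τ)⁻¹ * P (a, WithLp.toLp 2 (y, τ))‖ₑ ^ 2)).trans
      (sqNorm_integral_timeSymb_le (fun τ : ℝ => P (a, WithLp.toLp 2 (y, τ)))
        (hP.meas.comp_measurable (by fun_prop)).aestronglyMeasurable))
    congr 1
    have hSy : MeasurableSet {a : ℝ | latS he (WithLp.toLp 2 (a, y)) ∈ S} :=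
      hSm.preimage (Continuous.measurable (by fun_prop))
    rw [← lintegral_indicator hSy]
    refine lintegral_congr fun b => ?_
    by_cases hb : latS he (WithLp.toLp 2 (b, y)) ∈ S
    · have hb' : b ∈ {a : ℝ | latS he (WithLp.toLp 2 (a, y)) ∈ S} := hb
      rw [Set.indicator_of_mem hb']
      simp only [hG, Set.indicator_of_mem hb, hT, LinearIsometryEquiv.symm_apply_apply]
      rw [mul_div_cancel₀ _ (by positivity : 2 * Real.pi ≠ 0)]
      rfl
    · have hb' : b ∉ {a : ℝ | latS he (WithLp.toLp 2 (a, y)) ∈ S} := hb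
      rw [Set.indicator_of_notMem hb']
      simp only [hG, Set.indicator_of_notMem hb]
      simp
  -- Minkowski brings the L² norm in ξ inside the superposition over slices.
  calc _ ≤ ∫⁻ ξ : Space n, (∫⁻ a, G (a, ξ)) ^ 2 := lintegral_mono_ae (h6.mono fun ξ h => by gcongr)
    _ ≤ (∫⁻ a, (∫⁻ ξ, G (a, ξ) ^ 2) ^ (1 / 2 : ℝ)) ^ 2 :=
        lintegral_lintegral_sq_le hGm.aemeasurable
    _ ≤ (∫⁻ a, ((ENNReal.ofReal (l * R ^ (2 * s - 2)))⁻¹ ^ (1 / 2 : ℝ)) *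
          sqNorm volume (fun κ => P (a, κ)) ^ (1 / 2 : ℝ)) ^ 2 := by
        gcongr with a
        rw [← ENNReal.mul_rpow_of_nonneg _ _ (by norm_num)]
        exact ENNReal.rpow_le_rpow (h7 a) (by norm_num)
    _ = _ := by
        have hc : 0 < l * R ^ (2 * s - 2) := by positivity
        rw [lintegral_const_mul' _ _ (by simp [hc]), ← hP.latSum_eq, mul_pow, ← ENNReal.rpow_natCast,
          ← ENNReal.rpow_mul]
        norm_num

end LateralEstimates

/-! ### Consequences of the `Y^e_{k,k'}` norm, with explicit powers of 2. -/

section YBounds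

variable {n : ℕ} {s : ℝ} {e : Space n} {k k' : ℕ}

/-- The weight in the norm of `Y^e_{k,k'}`. -/
def yWeight (n : ℕ) (s : ℝ) (k k' : ℕ) : ℝ≥0∞ :=
  (2 : ℝ≥0∞) ^ (-(k' : ℝ) * ((2 * s - 1) / 2)) * (2 : ℝ≥0∞) ^ (2 * (n : ℝ) * ((k : ℝ) - k'))

theorem two_rpow_ne_zero (x : ℝ) : (2 : ℝ≥0∞) ^ x ≠ 0 := by
  simp

theorem two_rpow_ne_top (x : ℝ) : (2 : ℝ≥0∞) ^ x ≠ ⊤ := by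
  simp

theorem ofReal_two_rpow (x : ℝ) : ENNReal.ofReal ((2 : ℝ) ^ x) = (2 : ℝ≥0∞) ^ x := by
  rw [← ENNReal.ofReal_rpow_of_pos (by norm_num)]
  simp

theorem two_rpow_add (x y : ℝ) : (2 : ℝ≥0∞) ^ (x + y) = 2 ^ x * 2 ^ y :=
  ENNReal.rpow_add _ _ (by norm_num) (by norm_num)

theorem two_rpow_sq (x : ℝ) : ((2 : ℝ≥0∞) ^ x) ^ 2 = 2 ^ (2 * x) := by
  rw [← ENNReal.rpow_mul_natCast]
  congr 1
  push_cast
  ring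

theorem yWeight_eq : yWeight n s k k' =
    (2 : ℝ≥0∞) ^ (-(k' : ℝ) * ((2 * s - 1) / 2) + 2 * (n : ℝ) * ((k : ℝ) - k')) := by
  rw [two_rpow_add, yWeight]

theorem yWeight_ne_zero : yWeight n s k k' ≠ 0 := by
  rw [yWeight_eq]; exact two_rpow_ne_zero _

theorem lt_top_of_yWeight_mul {L : ℝ≥0∞} (h : yWeight n s k k' * L < ⊤) : L < ⊤ :=
  ENNReal.lt_top_of_mul_ne_top_right h.ne yWeight_ne_zero

/-- Absorbs the weight of the Y norm, so that the later estimates become linear inequalities between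
exponents. -/
theorem two_rpow_mul_sq_le {x a : ℝ} (L : ℝ≥0∞)
    (h : x ≤ 2 * a + (-(k' : ℝ) * (2 * s - 1) + 4 * (n : ℝ) * ((k : ℝ) - k'))) :
    (2 : ℝ≥0∞) ^ x * L ^ 2 ≤ (2 ^ a * (yWeight n s k k' * L)) ^ 2 := by
  rw [mul_pow, mul_pow, yWeight_eq, two_rpow_sq, two_rpow_sq, ← mul_assoc, ← two_rpow_add]
  gcongr
  · norm_num
  · linarith

/-- The spatial frequencies of functions in `Y^e_{k,k'}`. -/
def yBox (k k' : ℕ) (e : Space n) : Set (Space n) :=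
  latBox e ((2 : ℝ) ^ ((k : ℝ) + 1)) ((2 : ℝ) ^ ((k' : ℝ) - 1)) ((2 : ℝ) ^ ((k' : ℝ) + 1))

theorem lintegral_wt_one_le (he : ‖e‖ = 1) (y : ↥(ℝ ∙ e)ᗮ) :
    ∫⁻ _ in {a : ℝ | latS he (WithLp.toLp 2 (a, y)) ∈ yBox k k' e}, (1 : ℝ≥0∞) ≤
      2 ^ ((k' : ℝ) + 1) := by
  have hpi := Real.pi_gt_three
  have h0 : (0 : ℝ) < 2 ^ ((k' : ℝ) - 1) := by positivity
  have h0' : (0 : ℝ) < 2 ^ ((k' : ℝ) + 1) := by positivity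
  calc _ = volume {a : ℝ | latS he (WithLp.toLp 2 (a, y)) ∈ yBox k k' e} := by simp
    _ ≤ volume (Set.Icc 0 ((2 : ℝ) ^ ((k' : ℝ) + 1))) := by
        refine measure_mono ?_
        rintro a ⟨-, h2⟩
        rw [real_inner_smul_left, inner_latS] at h2
        have h3 : 0 ≤ a := by
          by_contra! hc
          nlinarith [h2.1]
        exact ⟨h3, le_trans (by nlinarith) h2.2⟩
    _ = _ := by rw [Real.volume_Icc, sub_zero, ofReal_two_rpow]

theorem ofReal_jacobian : ENNReal.ofReal ((2 : ℝ) ^ ((k' : ℝ) - 1) *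
    ((2 : ℝ) ^ ((k : ℝ) + 1)) ^ (2 * s - 2)) = 2 ^ ((k' : ℝ) - 1 + (k + 1) * (2 * s - 2)) := by
  rw [← Real.rpow_mul (by norm_num), ← Real.rpow_add (by norm_num), ofReal_two_rpow]

/-- With d = k + 1 - k' ≥ 0 the right side exceeds the left by d(4n - 2 + 2s) + 3. The factor
2^{2n(k-k')} of the norm thus absorbs the small Jacobian of directions nearly orthogonal to e. -/
theorem jacobian_exponent_le (hn : 1 ≤ n) (hs : s ∈ Set.Ioo (1 / 2 : ℝ) 1) (hk : k' ≤ k + 1) :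
    -((k' : ℝ) - 1 + (k + 1) * (2 * s - 2)) ≤ 2 * (2 * (n : ℝ) + 2) +
      (-(k' : ℝ) * (2 * s - 1) + 4 * (n : ℝ) * ((k : ℝ) - k')) := by
  have h1 : (k' : ℝ) ≤ k + 1 := by exact_mod_cast hk
  have h2 : (1 : ℝ) ≤ n := by exact_mod_cast hn
  have h3 : 0 ≤ ((k : ℝ) + 1 - k') * (4 * n - 2 + 2 * s) :=
    mul_nonneg (by linarith) (by linarith [hs.1])
  nlinarith

/-- The slice of the box has length at most 2^{k'+1}. The resulting loss 2^{sk} is affordable where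
the modulation is at least 2^{2sk}. -/
theorem sqNorm_le_yWeight (hs : s ∈ Set.Ioo (1 / 2 : ℝ) 1) (he : ‖e‖ = 1)
    (hk : k' ≤ k + 1) {f g : SpaceTime n → ℂ} (h : IsFT f g)
    (hL : yWeight n s k k' * latSum he f < ⊤) (hg : ∀ᵐ ζ, ζ.fst ∉ yBox k k' e → g ζ = 0) :
    sqNorm volume g ≤
      (2 ^ (s * k + (2 * (n : ℝ) + 2)) * (yWeight n s k k' * latSum he f)) ^ 2 := by
  have h1 := lintegral_mul_sq_le_latSum he h (lt_top_of_yWeight_mul hL) (measurableSet_latBox _ _ _)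
    hg (wt := fun _ => 1) measurable_const fun y _ => lintegral_wt_one_le he y
  simp only [one_mul] at h1
  refine h1.trans (two_rpow_mul_sq_le _ ?_)
  have h2 : (k' : ℝ) ≤ k + 1 := by exact_mod_cast hk
  have h3 : 0 ≤ ((k : ℝ) + 1 - k') * (4 * n + 2 * s) :=
    mul_nonneg (by linarith) (by have := hs.1; positivity)
  nlinarith [hs.2]

/-- After the change of variables the weight |`symb`|⁻² has integral at most 1 over each slice, up
to the Jacobian. This is the embedding of Y into L². -/
theorem sqNorm_inv_symb_le_yWeight (hn : 1 ≤ n) (hs : s ∈ Set.Ioo (1 / 2 : ℝ) 1) (he : ‖e‖ = 1)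
    (hk : k' ≤ k + 1) {f g : SpaceTime n → ℂ} (h : IsFT f g)
    (hL : yWeight n s k k' * latSum he f < ⊤) (hg : ∀ᵐ ζ, ζ.fst ∉ yBox k k' e → g ζ = 0) :
    sqNorm volume (fun ζ => (symb s ζ)⁻¹ * g ζ) ≤
      (2 ^ (2 * (n : ℝ) + 2) * (yWeight n s k k' * latSum he f)) ^ 2 := by
  have hs0 : 0 < s := by linarith [hs.1]
  have hc : ENNReal.ofReal ((2 : ℝ) ^ ((k' : ℝ) - 1) *
    ((2 : ℝ) ^ ((k : ℝ) + 1)) ^ (2 * s - 2)) ≠ 0 := by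
      rw [ofReal_jacobian]; exact two_rpow_ne_zero _
  have h1 := lintegral_mul_sq_le_latSum he h (lt_top_of_yWeight_mul hL) (measurableSet_latBox _ _ _)
    hg (wt := fun ζ => ‖(symb s ζ)⁻¹‖ₑ ^ 2)
    ((((continuous_symb hs0).inv₀ symb_ne_zero).measurable.enorm).pow_const 2)
    (B := (ENNReal.ofReal ((2 : ℝ) ^ ((k' : ℝ) - 1) *
      ((2 : ℝ) ^ ((k : ℝ) + 1)) ^ (2 * s - 2)))⁻¹) fun y τ => by
        rw [← mul_one (_⁻¹ : ℝ≥0∞), ← ENNReal.mul_le_iff_le_inv hc (by finiteness)]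
        refine le_trans (le_of_eq ?_) ((lintegral_comp_disp_le
          (u := (2 : ℝ) ^ ((k' : ℝ) + 1)) hs he (R := (2 : ℝ) ^ ((k : ℝ) + 1))
          (l := (2 : ℝ) ^ ((k' : ℝ) - 1)) (by positivity)
          (by positivity) y (fun z => ‖(timeSymb (2 * Real.pi * z) τ)⁻¹‖ₑ ^ 2)).trans
          (sqNorm_inv_timeSymb_le τ))
        congr 1
        refine lintegral_congr fun a => ?_
        rw [mul_div_cancel₀ _ (by positivity : 2 * Real.pi ≠ 0), symb_pt]
  rw [ofReal_jacobian, ← ENNReal.rpow_neg] at h1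
  refine le_trans (le_of_eq ?_) (h1.trans (two_rpow_mul_sq_le _ (jacobian_exponent_le hn hs hk)))
  unfold sqNorm
  simp only [enorm_mul, mul_pow]

/-- Functions in Y have a square integrable trace at time 0, as the free part of the Duhamel term
requires. -/
theorem lintegral_trace_le_yWeight (hn : 1 ≤ n) (hs : s ∈ Set.Ioo (1 / 2 : ℝ) 1) (he : ‖e‖ = 1)
    (hk : k' ≤ k + 1) {f g : SpaceTime n → ℂ} (h : IsFT f g)
    (hL : yWeight n s k k' * latSum he f < ⊤) (hg : ∀ᵐ ζ, ζ.fst ∉ yBox k k' e → g ζ = 0) :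
    ∫⁻ ξ : Space n, ‖∫ τ : ℝ, (symb s (pt ξ τ))⁻¹ * g (pt ξ τ)‖ₑ ^ 2 ≤
      (2 ^ (2 * (n : ℝ) + 2) * (yWeight n s k k' * latSum he f)) ^ 2 := by
  have h1 := lintegral_trace_le_latSum hs he h (lt_top_of_yWeight_mul hL)
    (R := (2 : ℝ) ^ ((k : ℝ) + 1)) (l := (2 : ℝ) ^ ((k' : ℝ) - 1))
    (u := (2 : ℝ) ^ ((k' : ℝ) + 1)) (by positivity) (by positivity) hg
  rw [ofReal_jacobian, ← ENNReal.rpow_neg] at h1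
  exact h1.trans (two_rpow_mul_sq_le _ (jacobian_exponent_le hn hs hk))

end YBounds

/-! ### The commutator of the time cut-off with the evolution operator. -/

section TimeCutoffSymbol

variable {n : ℕ} {s : ℝ} {ψ : ℝ → ℝ}

/-- `(i ∂ₜ - w + i) (ψ h) = ψ (i ∂ₜ - w + i) h + i ψ' h`. -/
theorem timeSymb_mul_cutoff (hψ : IsTimeCutoff ψ) {w L : ℝ} {q h u h' p r : ℝ → ℂ}
    (hhq : IsFT h q) (hu : IsFT (fun t => ψ t * h t) u)
    (hh' : IsFT h' (fun τ => timeSymb w τ * q τ)) (hp : IsFT (fun t => ψ t * h' t) p)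
    (hr : IsFT (fun t => ((deriv ψ t : ℝ) : ℂ) * h t) r)
    (hsupp : ∀ᵐ τ : ℝ, L < |2 * Real.pi * τ + w| → q τ = 0) :
    (fun τ => timeSymb w τ * u τ) =ᵐ[volume] fun τ => p τ + Complex.I * r τ := by
  set qm : ℝ → ℂ := fun τ => ((2 * Real.pi * τ + w : ℝ) : ℂ) * q τ with hqm
  -- Bounded modulation confines `q` to a compact interval, so its inverse transform is continuously
  -- differentiable and the product rule holds classically.
  have hqs : ∀ᵐ τ, τ ∉ Set.Icc ((-L - w) / (2 * Real.pi)) ((L - w) / (2 * Real.pi)) → q τ = 0 := by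
    filter_upwards [hsupp] with τ hτ h1
    refine hτ ?_
    by_contra! hc
    exact h1 (mem_Icc_of_abs_le hc)
  have hq2 := hhq.right
  have hqi := integrable_of_ae_eq_zero hq2 hqs
  have hqm' : ∀ τ, qm τ = Complex.I * q τ - timeSymb w τ * q τ := fun τ => by
    simp only [hqm, timeSymb]; ring
  have hqmm : MemLp qm 2 := ((hq2.const_mul Complex.I).sub hh'.right).ae_eq
    (Filter.Eventually.of_forall fun τ => (hqm' τ).symm)
  have hqmi : Integrable qm := by
    refine integrable_of_ae_eq_zero hqmm (a := (-L - w) / (2 * Real.pi))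
      (b := (L - w) / (2 * Real.pi)) ?_
    filter_upwards [hqs] with τ h1 h2
    rw [hqm]; simp [h1 h2]
  have hqi' : Integrable fun τ : ℝ => τ * q τ := by
    have h1 : Integrable fun τ : ℝ => ((2 * Real.pi : ℝ) : ℂ)⁻¹ * (qm τ - w * q τ) :=
      (hqmi.sub (hqi.const_mul _)).const_mul _
    refine h1.congr (Filter.Eventually.of_forall fun τ => ?_)
    have : ((2 * Real.pi : ℝ) : ℂ) ≠ 0 := by
      exact_mod_cast (by positivity : (2 * Real.pi : ℝ) ≠ 0)
    simp only [hqm]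
    rw [inv_mul_eq_iff_eq_mul₀ this]
    push_cast; ring
  set R : ℝ → ℂ := fun t => Complex.exp (Complex.I * t * w) * invFT q t
  set R' : ℝ → ℂ := fun t => Complex.exp (Complex.I * t * w) * (Complex.I * invFT qm t)
  have hR : ∀ t, HasDerivAt R (R' t) t := hasDerivAt_exp_mul_invFT hqi hqi' w
  have hR' : Continuous R' := by
    have := continuous_invFT hqmi
    fun_prop
  obtain ⟨h2, h3⟩ := isFT_timeSymb hψ.smooth hψ.hasCompactSupport w hR hR'
  have hexp : ∀ (t : ℝ) (z : ℂ), Complex.exp (-(Complex.I * t * w)) *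
      (Complex.exp (Complex.I * t * w) * z) = z := fun t z => by
    rw [← mul_assoc, ← Complex.exp_add]
    simp
  have hinv : h =ᵐ[volume] invFT q :=
    hhq.unique_left (isFT_invFT hqi hq2) (Filter.EventuallyEq.refl _ _)
  have h4 : u =ᵐ[volume] 𝓕 (fun t : ℝ => ψ t * (Complex.exp (-(Complex.I * t * w)) * R t)) := by
    refine hu.unique h2 ?_
    filter_upwards [hinv] with t ht
    simp only [R, hexp, ht]
  have hinv' : h' =ᵐ[volume] fun t => Complex.I * invFT q t - invFT qm t := by
    refine hh'.unique_left (((isFT_invFT hqi hq2).const_mul Complex.I).sub (isFT_invFT hqmi hqmm))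
      (Filter.Eventually.of_forall fun τ => ?_)
    simp only [hqm']
    ring
  have h5 := (hp.add (hr.const_mul Complex.I)).unique h3 (by
    filter_upwards [hinv, hinv'] with t h6 h7
    have e1 : Complex.exp (-(Complex.I * t * w)) *
        (ψ t * R' t + deriv ψ t * R t + ψ t * R t) =
        ψ t * (Complex.I * invFT qm t) + deriv ψ t * invFT q t + ψ t * invFT q t := by
      rw [mul_add, mul_add, mul_left_comm, mul_left_comm _ ((deriv ψ t : ℝ) : ℂ),
        mul_left_comm _ (ψ t : ℂ) (R t)]
      simp only [R, R', hexp]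
    rw [e1, h6, h7]
    linear_combination (-(ψ t : ℂ) * invFT qm t) * Complex.I_sq)
  filter_upwards [h4, h5] with τ h6 h7
  rw [h6, h7]

/-- `(i ∂ₜ - (-Δ) ^ s + i) (ψ f) = ψ (i ∂ₜ - (-Δ) ^ s + i) f + i ψ' f`. -/
theorem symb_mul_cutoff (hs : 0 < s) (hψ : IsTimeCutoff ψ) {f v u F p r : SpaceTime n → ℂ} {L : ℝ}
    (hf : IsFT f v) (hu : IsFT (fun ζ => ψ ζ.snd * f ζ) u)
    (hF : IsFT F (fun ζ => symb s ζ * v ζ)) (hp : IsFT (fun ζ => ψ ζ.snd * F ζ) p)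
    (hr : IsFT (fun ζ => ((deriv ψ ζ.snd : ℝ) : ℂ) * f ζ) r)
    (hsupp : ∀ᵐ ζ, L < |modulation s ζ| → v ζ = 0) :
    (fun ζ => symb s ζ * u ζ) =ᵐ[volume] fun ζ => p ζ + Complex.I * r ζ := by
  have hψ' : Continuous (deriv ψ) := hψ.smooth.continuous_deriv (by simp)
  refine ae_eq_toLp ((continuous_symb hs).aestronglyMeasurable.mul hu.right.1)
    (hp.right.1.add (hr.right.1.const_mul _)) ?_
  filter_upwards [isCutoffOf_of_isFT hψ.smooth.continuous hf hu,
    isCutoffOf_of_isFT hψ.smooth.continuous hF hp, isCutoffOf_of_isFT hψ' hf hr,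
    memLp_fiber_toLp hf.right, memLp_fiber_toLp hF.right, ae_fiber_toLp hsupp] with ξ h1 h2 h3 h4 h5 h6
  obtain ⟨h, hh⟩ := exists_isFT_left h4
  obtain ⟨h', hh'⟩ := exists_isFT_left h5
  have := timeSymb_mul_cutoff hψ (w := disp s ξ) (L := L) hh (h1 h hh)
    (by simpa only [symb_pt] using hh') (h2 h' hh') (h3 h hh) (by simpa [modulation] using h6)
  simpa only [symb_pt] using this

/-- Time cut-offs do not enlarge the spatial Fourier support. -/
theorem cutoff_support {χ : ℝ → ℝ} (hχ : Continuous χ) {f v u : SpaceTime n → ℂ}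
    (hf : IsFT f v) (hu : IsFT (fun ζ => χ ζ.snd * f ζ) u) {S : Set (Space n)}
    (hS : MeasurableSet S) (hv : ∀ᵐ ζ, ζ.fst ∉ S → v ζ = 0) : ∀ᵐ ζ, ζ.fst ∉ S → u ζ = 0 := by
  have h1 : (fun ζ : SpaceTime n => ({ζ | ζ.fst ∉ S} : Set (SpaceTime n)).indicator u ζ)
      =ᵐ[volume] fun _ => 0 := by
    have hSm : MeasurableSet ({ζ | ζ.fst ∉ S} : Set (SpaceTime n)) :=
      (hS.preimage (f := fun ζ : SpaceTime n => ζ.fst) (Continuous.measurable (by fun_prop))).compl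
    refine ae_eq_toLp (hu.right.1.indicator hSm) aestronglyMeasurable_const ?_
    filter_upwards [isCutoffOf_of_isFT hχ hf hu, ae_fiber_toLp hv] with ξ h2 h3
    by_cases hξ : ξ ∈ S
    · refine Filter.Eventually.of_forall fun τ => Set.indicator_of_notMem ?_ _
      exact fun h => h hξ
    · have h4 : IsFT (fun _ : ℝ => (0 : ℂ)) (fun τ => v (pt ξ τ)) :=
        IsFT.zero.congr (Filter.EventuallyEq.refl _ _) (h3.mono fun τ hτ => (hτ hξ).symm)
      have h5 := (h2 _ h4).unique IsFT.zero (Filter.Eventually.of_forall fun t => by simp)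
      filter_upwards [h5] with τ hτ
      have hm : pt ξ τ ∈ ({ζ | ζ.fst ∉ S} : Set (SpaceTime n)) := hξ
      rw [Set.indicator_of_mem hm, hτ]
  filter_upwards [h1] with ζ hζ hξ
  have hm : ζ ∈ ({ζ | ζ.fst ∉ S} : Set (SpaceTime n)) := hξ
  rwa [Set.indicator_of_mem hm] at hζ

end TimeCutoffSymbol

/-! ### The Duhamel term on `Y^e_{k,k'}`. -/

section YDuhamel

variable {n : ℕ} {s : ℝ} {e : Space n} {k k' : ℕ} {φ₀ ψ : ℝ → ℝ}

theorem yNorm_eq (he : ‖e‖ = 1) {g : L2ST n} {v F : SpaceTime n → ℂ} (hg : IsFT g v)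
    (hv : ∀ᵐ ζ, ζ ∉ regionY s k k' e → v ζ = 0) (hF : IsFT F (fun ζ => symb s ζ * v ζ)) :
    yNorm s k k' e g = yWeight n s k k' * latSum he F := by
  have h1 : FourierSupportedIn g (regionY s k k' e) := by
    filter_upwards [hg.coe_fourier, hv] with ζ h2 h3 h4
    rw [h2, h3 h4]
  rw [yNorm, if_pos h1, lateralNorm_eq he, yWeight]
  congr 1
  exact latSum_congr he ((isFT_l2Multiplier hg hF.right).unique_left hF
    (Filter.EventuallyEq.refl _ _))

theorem supp_of_yNorm_lt {g : L2ST n} {v : SpaceTime n → ℂ} (hg : IsFT g v)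
    (h : yNorm s k k' e g < ⊤) : ∀ᵐ ζ, ζ ∉ regionY s k k' e → v ζ = 0 := by
  have h1 : FourierSupportedIn g (regionY s k k' e) := by
    by_contra hc
    rw [yNorm, if_neg hc] at h
    exact lt_irrefl _ h
  filter_upwards [hg.coe_fourier, h1] with ζ h2 h3 h4
  rw [← h2, h3 h4]

/-- The annulus `|2πξ| ∈ Iₖ`. -/
def annulus (n k : ℕ) : Set (Space n) := {ξ | ‖(2 * Real.pi) • ξ‖ ∈ dyadicInterval k}

theorem measurableSet_dyadicInterval (k : ℕ) : MeasurableSet (dyadicInterval k) := by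
  unfold dyadicInterval
  split_ifs <;> exact measurableSet_Icc

theorem measurableSet_annulus (n k : ℕ) : MeasurableSet (annulus n k) :=
  (measurableSet_dyadicInterval k).preimage
    (Continuous.measurable (f := fun ξ : Space n => ‖(2 * Real.pi) • ξ‖) (by fun_prop))

theorem norm_le_of_mem_annulus {ξ : Space n} (h : ξ ∈ annulus n k) :
    ‖(2 * Real.pi) • ξ‖ ≤ (2 : ℝ) ^ ((k : ℝ) + 1) := by
  refine (le_of_mem_dyadicInterval h).2.trans (le_of_eq ?_)
  rw [two_rpow_add_one, pow_succ]

theorem disp_le_of_mem_annulus (hs : s ∈ Set.Ioo (1 / 2 : ℝ) 1) {ξ : Space n}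
    (h : ξ ∈ annulus n k) : 0 ≤ disp s ξ ∧ disp s ξ ≤ 4 * (2 : ℝ) ^ (2 * s * k) := by
  refine ⟨by unfold disp; positivity, ?_⟩
  calc disp s ξ ≤ ((2 : ℝ) ^ ((k : ℝ) + 1)) ^ (2 * s) :=
        Real.rpow_le_rpow (norm_nonneg _) (norm_le_of_mem_annulus h) (by linarith [hs.1])
    _ = (2 : ℝ) ^ (2 * s) * (2 : ℝ) ^ (2 * s * k) := by
        rw [← Real.rpow_mul (by norm_num), ← Real.rpow_add (by norm_num)]
        congr 1
        ring
    _ ≤ (2 : ℝ) ^ (2 : ℝ) * (2 : ℝ) ^ (2 * s * k) := by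
        gcongr
        · norm_num
        · linarith [hs.2]
    _ = _ := by norm_num

/-- The spatial frequencies allowed in `Y^e_{k,k'}`. -/
def ySlab (k k' : ℕ) (e : Space n) : Set (Space n) := annulus n k ∩ yBox k k' e

theorem measurableSet_ySlab : MeasurableSet (ySlab k k' e) :=
  (measurableSet_annulus n k).inter (measurableSet_latBox _ _ _)

theorem fst_mem_ySlab {ζ : SpaceTime n} (h : ζ ∈ regionY s k k' e) : ζ.fst ∈ ySlab k k' e := by
  obtain ⟨⟨j, -, h1, -⟩, h2⟩ := h
  exact ⟨h1, norm_le_of_mem_annulus h1, h2⟩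

theorem modulation_le_of_mem_regionY {ζ : SpaceTime n} (h : ζ ∈ regionY s k k' e) :
    |modulation s ζ| ≤ (2 : ℝ) ^ (2 * s * k + 11) := by
  obtain ⟨⟨j, hj, -, h1⟩, -⟩ := h
  refine (le_of_mem_dyadicInterval h1).2.trans ?_
  rw [← Real.rpow_natCast]
  refine Real.rpow_le_rpow_of_exponent_le (by norm_num) ?_
  push_cast
  linarith

/-- The region of low time frequencies for spatial frequencies of size `2 ^ k`. -/
def lowTime (n : ℕ) (s : ℝ) (k : ℕ) : Set (SpaceTime n) :=
  {ζ | |2 * Real.pi * ζ.snd| ≤ 512 * (2 : ℝ) ^ (2 * s * k)}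

/-- Since |ξ|^{2s} ≤ 4 · 2^{2sk}, the modulation is at most 516 · 2^{2sk} < 2^{2sk+10}. The
threshold 512 leaves this room, and the shells up to ⌊2sk + 10⌋ reach 2^{⌊2sk+10⌋+1}, which
suffices. -/
theorem mem_regionY_of_lowTime (hs : s ∈ Set.Ioo (1 / 2 : ℝ) 1) {ζ : SpaceTime n}
    (h : ζ ∈ lowTime n s k) (h' : ζ.fst ∈ ySlab k k' e) : ζ ∈ regionY s k k' e := by
  obtain ⟨h1, h2⟩ := disp_le_of_mem_annulus hs h'.1
  have h3 : (0 : ℝ) < 2 ^ (2 * s * k) := by positivity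
  have h0 : 0 ≤ 2 * s * k + 10 := by have := hs.1; positivity
  have h4 : |modulation s ζ| ≤ 2 ^ (⌊2 * s * k + 10⌋₊ + 1) := by
    calc |modulation s ζ| ≤ |2 * Real.pi * ζ.snd| + |disp s ζ.fst| := abs_add_le _ _
      _ ≤ 512 * (2 : ℝ) ^ (2 * s * k) + 4 * (2 : ℝ) ^ (2 * s * k) := by
          rw [abs_of_nonneg h1]
          exact add_le_add h h2
      _ ≤ (2 : ℝ) ^ (2 * s * k) * 2 ^ (10 : ℝ) := by norm_num; linarith
      _ = (2 : ℝ) ^ (2 * s * k + 10) := (Real.rpow_add (by norm_num) _ _).symm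
      _ ≤ (2 : ℝ) ^ ((⌊2 * s * k + 10⌋₊ + 1 : ℕ) : ℝ) := by
          refine Real.rpow_le_rpow_of_exponent_le (by norm_num) ?_
          push_cast
          exact (Nat.lt_floor_add_one _).le
      _ = _ := Real.rpow_natCast _ _
  obtain ⟨j, hj, h5⟩ := dyadicInterval_cover _ (abs_nonneg _) h4
  exact ⟨⟨j, (Nat.le_floor_iff h0).1 hj, h'.1, h5⟩, h'.2.2⟩

/-- Outside the low region |τ| > 512 · 2^{2sk}, and |ξ|^{2s} cannot cancel more than 4 · 2^{2sk} of
it. -/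
theorem le_modulation_of_notMem_lowTime (hs : s ∈ Set.Ioo (1 / 2 : ℝ) 1) {ζ : SpaceTime n}
    (h : ζ ∉ lowTime n s k) (h' : ζ.fst ∈ annulus n k) :
    (2 : ℝ) ^ (2 * s * k) ≤ |modulation s ζ| := by
  obtain ⟨h1, h2⟩ := disp_le_of_mem_annulus hs h'
  have h3 : (0 : ℝ) < 2 ^ (2 * s * k) := by positivity
  have h4 : 512 * (2 : ℝ) ^ (2 * s * k) < |2 * Real.pi * ζ.snd| := not_le.1 h
  have h5 : |2 * Real.pi * ζ.snd| ≤ |modulation s ζ| + |disp s ζ.fst| := by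
    have := abs_sub (modulation s ζ) (disp s ζ.fst)
    rwa [modulation, add_sub_cancel_right] at this
  rw [abs_of_nonneg h1] at h5
  linarith

theorem measurableSet_lowTime : MeasurableSet (lowTime n s k) :=
  measurableSet_le (f := fun ζ : SpaceTime n => |2 * Real.pi * ζ.snd|)
    (Continuous.measurable (by fun_prop)) measurable_const

/-- Functions whose modulation is at least `2 ^ (2sk)`. -/
theorem xSum_div_symb_le (hφ₀ : IsBump φ₀) (hs : 0 < s) {p : SpaceTime n → ℂ}
    (h : ∀ᵐ ζ, p ζ ≠ 0 → (2 : ℝ) ^ (2 * s * k) ≤ |modulation s ζ|) :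
    xSum φ₀ s (fun ζ => (symb s ζ)⁻¹ * p ζ) ≤
      5 * decaySum * (2 ^ (-(s * k)) * eLpNorm p 2 volume) := by
  have h0 : 0 ≤ 2 * s * k := by positivity
  have hpow : (0 : ℝ) < 2 ^ (2 * s * k) := by positivity
  have h1 : eLpNorm (fun ζ => (symb s ζ)⁻¹ * p ζ) 2 volume ≤
      (2 : ℝ≥0∞) ^ (-(2 * s * k)) * eLpNorm p 2 volume := by
    have : eLpNorm (fun ζ => (symb s ζ)⁻¹ * p ζ) 2 volume ≤
        ENNReal.ofReal ((2 : ℝ) ^ (-(2 * s * k))) * eLpNorm p 2 volume := by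
      refine eLpNorm_le_mul_eLpNorm_of_ae_le_mul (h.mono fun ζ hζ => ?_) 2
      by_cases hp : p ζ = 0
      · simp [hp]
      · rw [norm_mul, norm_inv, Real.rpow_neg (by norm_num)]
        gcongr
        exact (hζ hp).trans (modulation_le_norm_symb ζ)
    rwa [ofReal_two_rpow] at this
  have h2 : eLpNorm (fun ζ => (modulation s ζ : ℂ) * ((symb s ζ)⁻¹ * p ζ)) 2 volume ≤
      eLpNorm p 2 volume := by
    refine eLpNorm_mono fun ζ => ?_
    rw [← mul_assoc, norm_mul, norm_mul, norm_inv, Complex.norm_real, Real.norm_eq_abs]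
    refine mul_le_of_le_one_left (norm_nonneg _) ?_
    have := one_le_norm_symb (s := s) ζ
    rw [mul_inv_le_iff₀ (by linarith), one_mul]
    exact modulation_le_norm_symb ζ
  -- At this splitting index both terms of `xSum_le` are of size 2^{-sk}. Rounding down costs at
  -- most a factor 2 in the second, whence 5 = 1 + 2 · 2.
  set m := ⌊2 * s * k⌋₊ with hm
  have hm1 : (m : ℝ) ≤ 2 * s * k := Nat.floor_le h0
  have hm2 : 2 * s * k < m + 1 := Nat.lt_floor_add_one _
  refine (xSum_le hφ₀ _ m).trans ?_
  calc _ ≤ decaySum * ((2 : ℝ≥0∞) ^ ((m : ℝ) / 2) *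
          ((2 : ℝ≥0∞) ^ (-(2 * s * k)) * eLpNorm p 2 volume) +
        2 * (2 : ℝ≥0∞) ^ (-((m : ℝ) / 2)) * eLpNorm p 2 volume) := by gcongr
    _ ≤ decaySum * ((2 : ℝ≥0∞) ^ (-(s * k)) * eLpNorm p 2 volume +
        2 * (2 * (2 : ℝ≥0∞) ^ (-(s * k))) * eLpNorm p 2 volume) := by
        gcongr _ * (?_ + 2 * ?_ * _)
        · rw [← mul_assoc, ← two_rpow_add]
          gcongr
          · norm_num
          · linarith
        · rw [show (2 : ℝ≥0∞) * 2 ^ (-(s * k)) = 2 ^ (1 + -(s * k)) by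
            rw [two_rpow_add, ENNReal.rpow_one]]
          gcongr
          · norm_num
          · linarith
    _ = _ := by ring

theorem eLpNorm_le_of_sqNorm {f : SpaceTime n → ℂ} {a : ℝ≥0∞} (h : sqNorm volume f ≤ a ^ 2) :
    eLpNorm f 2 volume ≤ a := by
  refine le_of_sq_le ?_
  rwa [← sqNorm_eq]

/-- The Duhamel term of a function in `Y^e_{k,k'}`. -/
theorem exists_duhOf_yNorm (hφ₀ : IsBump φ₀) (hs : s ∈ Set.Ioo (1 / 2 : ℝ) 1)
    (hψ : IsTimeCutoff ψ) (hn : 1 ≤ n) :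
    ∃ C : ℝ≥0, ∀ (k k' : ℕ) (e : Space n) (g : L2ST n) (v : SpaceTime n → ℂ), k' ≤ k + 1 →
      ‖e‖ = 1 → IsFT g v → yNorm s k k' e g < ⊤ →
      eLpNorm v 2 volume ≤ C * yNorm s k k' e g ∧
      ∃ (x : SpaceTime n → ℂ) (y : L2ST n) (uy : SpaceTime n → ℂ), AEStronglyMeasurable x ∧
        IsFT y uy ∧ DuhOf ψ s v (fun ζ => x ζ + uy ζ) ∧
        (∀ᵐ ζ, ζ.fst ∉ annulus n k → x ζ = 0) ∧
        xSum φ₀ s x ≤ C * yNorm s k k' e g ∧ yNorm s k k' e y ≤ yNorm s k k' e g := by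
  have hs0 : 0 < s := by linarith [hs.1]
  obtain ⟨C₂, hC₂⟩ := exists_freePart_lift hs0 hψ
  obtain ⟨M, hM1, hM⟩ := hψ.exists_bound
  have hψ1 : ∀ t, ‖ψ t‖ ≤ 1 := fun t => by
    have := hψ.range t
    rw [Real.norm_of_nonneg this.1]
    exact this.2
  have hψ' : Continuous (deriv ψ) := hψ.smooth.continuous_deriv (by simp)
  set K : ℝ≥0∞ := 2 ^ (2 * (n : ℝ) + 2) with hK
  have hKt : K ≠ ⊤ := two_rpow_ne_top _
  have hdt : decaySum ≠ ⊤ := decaySum_lt_top.ne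
  -- The first summand bounds the L² norm; the others bound the X norms of the high-frequency,
  -- commutator and free remainders `x₁`, `x₂` and `u₂`.
  set D : ℝ≥0∞ := K + (5 * decaySum * K + 3 * decaySum * (M * K) +
    3 * decaySum * ((2 * C₂ + 1) * K)) with hD
  have hDt : D ≠ ⊤ := by rw [hD]; finiteness
  refine ⟨D.toNNReal, fun k k' e g v hk he hg hA => ?_⟩
  rw [ENNReal.coe_toNNReal hDt]
  have hsupp := supp_of_yNorm_lt hg hA
  have hfst : ∀ᵐ ζ, ζ.fst ∉ ySlab k k' e → v ζ = 0 :=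
    hsupp.mono fun ζ h h' => h fun h'' => h' (fst_mem_ySlab h'')
  have hmod : ∀ᵐ ζ, (2 : ℝ) ^ (2 * s * k + 11) < |modulation s ζ| → v ζ = 0 :=
    hsupp.mono fun ζ h h' => h fun h'' => absurd (modulation_le_of_mem_regionY h'') (not_le.2 h')
  have hFm : MemLp (fun ζ => symb s ζ * v ζ) 2 := by
    refine MemLp.of_le_mul (c := 1 + (2 : ℝ) ^ (2 * s * k + 11)) hg.right
      ((continuous_symb hs0).aestronglyMeasurable.mul hg.right.1) ?_
    filter_upwards [hmod] with ζ h
    by_cases h1 : |modulation s ζ| ≤ (2 : ℝ) ^ (2 * s * k + 11)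
    · rw [norm_mul]
      gcongr
      have h2 := norm_symb_sq (s := s) ζ
      have h3 := abs_nonneg (modulation s ζ)
      rw [← sq_abs (modulation s ζ)] at h2
      nlinarith [norm_nonneg (symb s ζ)]
    · rw [h (not_le.1 h1)]; simp
  obtain ⟨F, hF⟩ := exists_isFT_left hFm
  have hAeq := yNorm_eq he hg hsupp hF
  set A := yNorm s k k' e g with hAdef
  have hL : yWeight n s k k' * latSum he F < ⊤ := hAeq ▸ hA
  have hFs : ∀ᵐ ζ, ζ.fst ∉ yBox k k' e → symb s ζ * v ζ = 0 := hfst.mono fun ζ h h' => by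
    rw [h fun h'' => h' h''.2, mul_zero]
  have hinv : ∀ ζ, (symb s ζ)⁻¹ * (symb s ζ * v ζ) = v ζ := fun ζ =>
    inv_mul_cancel_left₀ (symb_ne_zero ζ) _
  -- The three consequences of the Y norm: `hb1` bounds the source with loss 2^{sk}, `hb2` bounds
  -- the function in L², and `hb3` bounds its trace at time 0.
  have hb1 := sqNorm_le_yWeight hs he hk hF hL hFs
  have hb2 := sqNorm_inv_symb_le_yWeight hn hs he hk hF hL hFs
  have hb3 := lintegral_trace_le_yWeight hn hs he hk hF hL hFs
  simp only [hinv] at hb2 hb3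
  rw [← hAeq, ← hK] at hb2 hb3
  rw [← hAeq, two_rpow_add, ← hK] at hb1
  have hvA : eLpNorm v 2 volume ≤ K * A := eLpNorm_le_of_sqNorm hb2
  have hvi : ∀ᵐ ξ : Space n, Integrable fun τ : ℝ => v (pt ξ τ) := by
    filter_upwards [memLp_fiber_toLp hg.right, ae_fiber_toLp hmod] with ξ h1 h2
    refine integrable_of_ae_eq_zero h1
      (a := (-(2 : ℝ) ^ (2 * s * k + 11) - disp s ξ) / (2 * Real.pi))
      (b := ((2 : ℝ) ^ (2 * s * k + 11) - disp s ξ) / (2 * Real.pi)) ?_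
    filter_upwards [h2] with τ h3 h4
    refine h3 ?_
    by_contra! hc
    exact h4 (mem_Icc_of_abs_le (by simpa [modulation] using hc))
  obtain ⟨u₁, hu₁⟩ := exists_isFT (memLp_cutoff hψ.smooth.continuous hψ1 hg.left)
  obtain ⟨p, hp⟩ := exists_isFT (memLp_cutoff hψ.smooth.continuous hψ1 hF.left)
  obtain ⟨r, hr⟩ := exists_isFT (memLp_cutoff hψ' (fun t => (hM t).2) hg.left)
  obtain ⟨u₂, hu₂m, hu₂, hu₂s⟩ := hC₂ n v hg.right hvi
  have hdu := duhOf_of_cutoff hs0 hg.right hvi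
    (isCutoffOf_of_isFT hψ.smooth.continuous hg hu₁) hu₂
  have hu₁' := symb_mul_cutoff hs0 hψ hg hu₁ hF hp hr hmod
  have hpfst : ∀ᵐ ζ, ζ.fst ∉ ySlab k k' e → p ζ = 0 :=
    cutoff_support hψ.smooth.continuous hF hp measurableSet_ySlab
      (hfst.mono fun ζ h h' => by rw [h h', mul_zero])
  have hpm : eLpNorm p 2 volume ≤ 2 ^ (s * k) * K * A := by
    rw [← hp.eLpNorm_eq]
    calc _ ≤ eLpNorm F 2 volume := eLpNorm_mono fun ζ => by
          rw [norm_mul, Complex.norm_real]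
          exact mul_le_of_le_one_left (norm_nonneg _) (hψ1 _)
      _ = _ := hF.eLpNorm_eq
      _ ≤ _ := eLpNorm_le_of_sqNorm hb1
  -- The cut is made in τ rather than in the modulation: a multiplier in τ alone is bounded on L¹_e
  -- L², and for these spatial frequencies it still separates modulations allowed in Y from
  -- modulations at least 2^{2sk}.
  set low := lowTime n s k with hlow
  have hlowm : MeasurableSet low := measurableSet_lowTime
  set uy : SpaceTime n → ℂ := fun ζ => -((symb s ζ)⁻¹ * low.indicator p ζ) with huy
  set x₁ : SpaceTime n → ℂ := fun ζ => -((symb s ζ)⁻¹ * lowᶜ.indicator p ζ) with hx₁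
  set x₂ : SpaceTime n → ℂ := fun ζ => -((symb s ζ)⁻¹ * (Complex.I * r ζ)) with hx₂
  have hsi : Continuous fun ζ : SpaceTime n => (symb s ζ)⁻¹ :=
    (continuous_symb hs0).inv₀ symb_ne_zero
  have hx₁m : AEStronglyMeasurable x₁ :=
    (hsi.aestronglyMeasurable.mul (hp.right.1.indicator hlowm.compl)).neg
  have hx₂m : AEStronglyMeasurable x₂ :=
    (hsi.aestronglyMeasurable.mul (hr.right.1.const_mul _)).neg
  have huyL : MemLp uy 2 := by
    refine (hp.right.indicator hlowm).of_le
      (hsi.aestronglyMeasurable.mul (hp.right.1.indicator hlowm)).neg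
      (Filter.Eventually.of_forall fun ζ => ?_)
    simp only [huy, norm_neg, norm_mul, norm_inv]
    exact mul_le_of_le_one_left (norm_nonneg _) (inv_le_one_of_one_le₀ (one_le_norm_symb ζ))
  have hsum : (fun ζ => -u₁ ζ + u₂ ζ) =ᵐ[volume] fun ζ => (x₁ ζ + x₂ ζ + u₂ ζ) + uy ζ := by
    filter_upwards [hu₁'] with ζ h
    have h1 : u₁ ζ = (symb s ζ)⁻¹ * (p ζ + Complex.I * r ζ) := by
      rw [← h, inv_mul_cancel_left₀ (symb_ne_zero ζ)]
    have h2 : low.indicator p ζ + lowᶜ.indicator p ζ = p ζ :=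
      Set.indicator_self_add_compl_apply _ _ _
    simp only [h1, hx₁, hx₂, huy]
    rw [← h2]
    ring
  have hdu' := hdu.congr (Filter.EventuallyEq.refl _ _) hsum
  obtain ⟨y, hy⟩ := exists_Lp_isFT huyL
  have huyY : ∀ᵐ ζ, ζ ∉ regionY s k k' e → uy ζ = 0 := by
    filter_upwards [hpfst] with ζ h h'
    by_cases h1 : ζ ∈ low
    · have h2 : p ζ = 0 := h fun h'' => h' (mem_regionY_of_lowTime hs h1 h'')
      simp [huy, Set.indicator_of_mem h1, h2]
    · simp [huy, Set.indicator_of_notMem h1]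
  have hsuy : ∀ ζ, symb s ζ * uy ζ = -low.indicator p ζ := fun ζ => by
    simp only [huy]
    rw [mul_neg, mul_inv_cancel_left₀ (symb_ne_zero ζ)]
  have hsuyL : MemLp (fun ζ => symb s ζ * uy ζ) 2 := by
    simp only [hsuy]
    exact (hp.right.indicator hlowm).neg
  obtain ⟨Fy, hFy⟩ := exists_isFT_left hsuyL
  -- Applying the operator to `y` removes the resolvent and leaves minus the low time frequencies of
  -- ψF. The projection is a contraction on the lateral norm and |ψ| ≤ 1, so no constant is lost.
  have hyA : yNorm s k k' e y ≤ A := by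
    rw [yNorm_eq he hy huyY hFy, hAeq]
    gcongr
    refine le_trans ?_ (latSum_mono he (f := fun ζ => ψ ζ.snd * F ζ)
      (Filter.Eventually.of_forall fun ζ => ?_))
    · refine latSum_multiplier_le he hp hFy (b := fun τ =>
        -({τ : ℝ | |2 * Real.pi * τ| ≤ 512 * (2 : ℝ) ^ (2 * s * k)}.indicator (fun _ => 1) τ))
        (Measurable.neg (measurable_const.indicator
          (measurableSet_le (Continuous.measurable (by fun_prop)) measurable_const))) ?_ ?_
      · intro τ
        rw [norm_neg]
        refine (norm_indicator_le_norm_self _ _).trans ?_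
        simp
      · refine Filter.Eventually.of_forall fun ζ => ?_
        rw [hsuy]
        by_cases h1 : ζ ∈ low
        · have h2 : ζ.snd ∈ {τ : ℝ | |2 * Real.pi * τ| ≤ 512 * (2 : ℝ) ^ (2 * s * k)} := h1
          rw [Set.indicator_of_mem h1, Set.indicator_of_mem h2]
          ring
        · have h2 : ζ.snd ∉ {τ : ℝ | |2 * Real.pi * τ| ≤ 512 * (2 : ℝ) ^ (2 * s * k)} := h1
          rw [Set.indicator_of_notMem h1, Set.indicator_of_notMem h2]
          ring
    · rw [norm_mul, Complex.norm_real]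
      exact mul_le_of_le_one_left (norm_nonneg _) (hψ1 _)
  have hxm : AEStronglyMeasurable fun ζ => x₁ ζ + x₂ ζ + u₂ ζ := (hx₁m.add hx₂m).add hu₂m
  -- The gain 2^{-sk} from large modulation cancels the loss 2^{sk} in the L² norm of the source.
  have hxs₁ : xSum φ₀ s x₁ ≤ 5 * decaySum * K * A := by
    rw [hx₁, xSum_neg (φ₀ := φ₀) (s := s) (fun ζ => (symb s ζ)⁻¹ * lowᶜ.indicator p ζ)]
    refine (xSum_div_symb_le (k := k) hφ₀ hs0 ?_).trans ?_
    · filter_upwards [hpfst] with ζ h h'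
      have h1 : ζ ∈ lowᶜ := by
        by_contra hc
        exact h' (Set.indicator_of_notMem hc _)
      rw [Set.indicator_of_mem h1] at h'
      refine le_modulation_of_notMem_lowTime hs h1 ?_
      by_contra hc
      exact h' (h fun h'' => hc h''.1)
    · calc _ ≤ 5 * decaySum * (2 ^ (-(s * k)) * (2 ^ (s * k) * K * A)) := by
            gcongr
            refine le_trans (eLpNorm_mono fun ζ => ?_) hpm
            exact norm_indicator_le_norm_self _ _
        _ = 5 * decaySum * (2 ^ (-(s * k)) * 2 ^ (s * k)) * K * A := by ring
        _ = _ := by rw [← two_rpow_add]; simp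
  have hxs₂ : xSum φ₀ s x₂ ≤ 3 * decaySum * (M * K) * A := by
    refine (xSum_le_symb hφ₀ _).trans ?_
    rw [mul_assoc _ _ A]
    gcongr
    calc _ ≤ eLpNorm r 2 volume := eLpNorm_mono fun ζ => by
          simp only [hx₂]
          rw [mul_neg, mul_inv_cancel_left₀ (symb_ne_zero ζ)]
          simp
      _ ≤ M * eLpNorm v 2 volume := eLpNorm_le_of_sqNorm_le
          ((isCutoffOf_of_isFT hψ' hg hr).sqNorm_le (fun t => (hM t).2) hg.right hr.right.1)
      _ ≤ _ := by
          rw [mul_assoc]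
          gcongr
  have hus : xSum φ₀ s u₂ ≤ 3 * decaySum * ((2 * C₂ + 1) * K) * A := by
    refine (xSum_le_symb hφ₀ _).trans ?_
    rw [mul_assoc _ _ A]
    gcongr
    refine eLpNorm_le_of_sqNorm (hu₂s.trans ?_)
    calc _ ≤ (C₂ : ℝ≥0∞) * ((K * A) ^ 2 + (K * A) ^ 2) := by gcongr
      _ = 2 * (C₂ : ℝ≥0∞) * (K * A) ^ 2 := by ring
      _ ≤ (2 * (C₂ : ℝ≥0∞) + 1) ^ 2 * (K * A) ^ 2 := by
          gcongr
          calc 2 * (C₂ : ℝ≥0∞) ≤ 2 * C₂ + 1 := le_self_add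
            _ ≤ _ := le_self_pow₀ le_add_self (by norm_num)
      _ = _ := by ring
  refine ⟨hvA.trans (by gcongr; exact le_self_add), fun ζ => x₁ ζ + x₂ ζ + u₂ ζ, y, uy, hxm, hy,
    hdu', ?_, ?_, hyA⟩
  -- The whole Duhamel term and the Y part `uy` both vanish outside the annulus, hence so does their
  -- difference.
  · have h1 := hdu'.support (measurableSet_annulus n k)
      (hfst.mono fun ζ h h' => h fun h'' => h' h''.1) (hxm.add huyL.1)
    filter_upwards [h1, huyY] with ζ h2 h3 h4
    have h5 := h2 h4
    rwa [h3 fun h6 => h4 (fst_mem_ySlab h6).1, add_zero] at h5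
  · calc _ ≤ xSum φ₀ s (fun ζ => x₁ ζ + x₂ ζ) + xSum φ₀ s u₂ :=
          xSum_add_le hφ₀ hs0 (hx₁m.add hx₂m) hu₂m
      _ ≤ xSum φ₀ s x₁ + xSum φ₀ s x₂ + xSum φ₀ s u₂ := by
          gcongr
          exact xSum_add_le hφ₀ hs0 hx₁m hx₂m
      _ ≤ 5 * decaySum * K * A + 3 * decaySum * (M * K) * A +
          3 * decaySum * ((2 * C₂ + 1) * K) * A := by gcongr
      _ = (5 * decaySum * K + 3 * decaySum * (M * K) +
          3 * decaySum * ((2 * C₂ + 1) * K)) * A := by ring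
      _ ≤ _ := by
          gcongr
          exact le_add_self

end YDuhamel

/-! ### Decompositions in `Zₖ`. -/

section ZNorm

variable {n : ℕ} {s : ℝ} {k : ℕ} {φ₀ ψ : ℝ → ℝ} {𝓔 : Finset (Space n)}

/-- Reduces a bound by the infimum to finite decompositions. A finite nonzero constant passes
through the infimum. -/
theorem le_mul_zNorm {f : L2ST n} {B C : ℝ≥0∞} (hC : C ≠ 0) (hCt : C ≠ ⊤)
    (h : ∀ (f₁ : L2ST n) (g : Space n → ℕ → L2ST n),
      f = f₁ + ∑ e ∈ 𝓔, ∑ k' ∈ yIndices k, g e k' →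
      xNorm φ₀ s k f₁ + ∑ e ∈ 𝓔, ∑ k' ∈ yIndices k, yNorm s k k' e (g e k') < ⊤ →
      B ≤ C * (xNorm φ₀ s k f₁ + ∑ e ∈ 𝓔, ∑ k' ∈ yIndices k, yNorm s k k' e (g e k'))) :
    B ≤ C * zNorm φ₀ s 𝓔 k f := by
  unfold zNorm
  simp only [ENNReal.mul_iInf_of_ne hC hCt]
  refine le_iInf fun f₁ => le_iInf fun g => le_iInf fun hf => ?_
  rcases eq_or_ne (xNorm φ₀ s k f₁ + ∑ e ∈ 𝓔, ∑ k' ∈ yIndices k, yNorm s k k' e (g e k')) ⊤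
    with h1 | h1
  · rw [h1, ENNReal.mul_top hC]
    exact le_top
  · exact h f₁ g hf (lt_top_iff_ne_top.2 h1)

theorem exists_decomposition {f : L2ST n} (h : zNorm φ₀ s 𝓔 k f < ⊤) :
    ∃ (f₁ : L2ST n) (g : Space n → ℕ → L2ST n),
      f = f₁ + ∑ e ∈ 𝓔, ∑ k' ∈ yIndices k, g e k' ∧
      xNorm φ₀ s k f₁ + ∑ e ∈ 𝓔, ∑ k' ∈ yIndices k, yNorm s k k' e (g e k') < ⊤ := by
  simp only [zNorm, iInf_lt_iff] at h
  obtain ⟨f₁, g, hf, h⟩ := h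
  exact ⟨f₁, g, hf, h⟩

theorem zNorm_le {f f₁ : L2ST n} {g : Space n → ℕ → L2ST n}
    (h : f = f₁ + ∑ e ∈ 𝓔, ∑ k' ∈ yIndices k, g e k') :
    zNorm φ₀ s 𝓔 k f ≤
      xNorm φ₀ s k f₁ + ∑ e ∈ 𝓔, ∑ k' ∈ yIndices k, yNorm s k k' e (g e k') :=
  iInf_le_of_le f₁ (iInf_le_of_le g (iInf_le_of_le h le_rfl))

theorem yNorm_zero {k' : ℕ} {e : Space n} (he : ‖e‖ = 1) :
    yNorm s k k' e (0 : L2ST n) = 0 := by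
  have h0 : IsFT (0 : L2ST n) (fun _ : SpaceTime n => (0 : ℂ)) :=
    IsFT.zero.congr (Lp.coeFn_zero _ _ _).symm (Filter.EventuallyEq.refl _ _)
  rw [yNorm_eq he h0 (Filter.Eventually.of_forall fun ζ _ => rfl) (F := fun _ => 0)
    (by simpa using IsFT.zero)]
  simp [latSum, sqNorm]

/-- The modulation intervals cover the half line, so the support condition of `Xₖ` restricts only
the spatial frequency. This is why remainders with spread-out modulation are admissible in `Xₖ`. -/
theorem mem_regionX {ζ : SpaceTime n} : ζ ∈ regionX s k ↔ ζ.fst ∈ annulus n k := by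
  refine ⟨fun h => ?_, fun h => ?_⟩
  · obtain ⟨j, hj⟩ := Set.mem_iUnion.1 h
    exact hj.1
  · obtain ⟨J, hJ⟩ := exists_le_two_pow |modulation s ζ|
    obtain ⟨j, -, hj⟩ := dyadicInterval_cover J (abs_nonneg (modulation s ζ))
      (hJ.trans (pow_le_pow_right₀ (by norm_num) (Nat.le_succ _)))
    exact Set.mem_iUnion.2 ⟨j, h, hj⟩

theorem zNorm_le_xSum (hφ₀ : IsBump φ₀) (hs : 0 < s) (h𝓔 : ∀ e ∈ 𝓔, ‖e‖ = 1) {f : L2ST n}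
    {v : SpaceTime n → ℂ} (hf : IsFT f v) (hv : ∀ᵐ ζ, ζ.fst ∉ annulus n k → v ζ = 0) :
    zNorm φ₀ s 𝓔 k f ≤ xSum φ₀ s v := by
  refine (zNorm_le (f₁ := f) (g := fun _ _ => 0) (by simp)).trans (le_of_eq ?_)
  rw [xNorm_eq_xSum hφ₀ hs hf (by simpa only [mem_regionX] using hv), Finset.sum_eq_zero, add_zero]
  exact fun e he => Finset.sum_eq_zero fun k' _ => yNorm_zero (h𝓔 e he)

theorem DuhOf.unique {v u u' : SpaceTime n → ℂ} (h : DuhOf ψ s v u) (h' : DuhOf ψ s v u')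
    (hu : AEStronglyMeasurable u) (hu' : AEStronglyMeasurable u') : u =ᵐ[volume] u' := by
  refine ae_eq_toLp hu hu' ?_
  filter_upwards [h.isFT, h'.isFT] with ξ h1 h2
  exact h1.unique h2 (Filter.EventuallyEq.refl _ _)

theorem xSum_zero : xSum φ₀ s (fun _ : SpaceTime n => 0) = 0 := by
  simp [xSum]

theorem xSum_sum_le (hφ₀ : IsBump φ₀) (hs : 0 < s) {ι : Type*} (S : Finset ι)
    {v : ι → SpaceTime n → ℂ} (hv : ∀ i, AEStronglyMeasurable (v i)) :
    xSum φ₀ s (fun ζ => ∑ i ∈ S, v i ζ) ≤ ∑ i ∈ S, xSum φ₀ s (v i) := by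
  classical
  induction S using Finset.induction_on with
  | empty => simp [xSum_zero]
  | insert a S ha ih =>
    simp only [Finset.sum_insert ha]
    refine (xSum_add_le hφ₀ hs (hv a)
      (Finset.aestronglyMeasurable_fun_sum S fun i _ => hv i)).trans ?_
    gcongr

theorem le_of_mem_yIndices {k' : ℕ} (h : k' ∈ yIndices k) : k' ≤ k + 1 := by
  unfold yIndices at h
  split_ifs at h with h1
  · exact (Finset.mem_Icc.1 h).2
  · simp at h

theorem IsFT.of_decomposition {f f₁ : L2ST n} {g : Space n → ℕ → L2ST n}
    (h : f = f₁ + ∑ e ∈ 𝓔, ∑ k' ∈ yIndices k, g e k') {v₁ : SpaceTime n → ℂ}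
    {v : Space n × ℕ → SpaceTime n → ℂ} (h₁ : IsFT f₁ v₁)
    (hv : ∀ i ∈ 𝓔 ×ˢ yIndices k, IsFT (g i.1 i.2) (v i)) :
    IsFT f (fun ζ => v₁ ζ + ∑ i ∈ 𝓔 ×ˢ yIndices k, v i ζ) := by
  refine (h₁.add (IsFT.finset_sum _ hv)).congr ?_ (Filter.EventuallyEq.refl _ _)
  rw [h, ← Finset.sum_product']
  filter_upwards [Lp.coeFn_add f₁ (∑ i ∈ 𝓔 ×ˢ yIndices k, g i.1 i.2),
    Lp.coeFn_fun_finsetSum (𝓔 ×ˢ yIndices k) (fun i => g i.1 i.2)] with ζ h1 h2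
  rw [h1, Pi.add_apply, h2]

/-- By linearity the Duhamel term is computed on each summand. The X remainders of all Y summands
join the X component of the result, while each Y part keeps its indices; as 𝓔 and the index sets are
finite, the bounds add up with a constant independent of k. -/
theorem exists_duhOf_decomposition (hφ₀ : IsBump φ₀) (hs : s ∈ Set.Ioo (1 / 2 : ℝ) 1)
    (hψ : IsTimeCutoff ψ) (hn : 1 ≤ n) (h𝓔 : ∀ e ∈ 𝓔, ‖e‖ = 1) :
    ∃ C : ℝ≥0, 1 ≤ C ∧ ∀ (k : ℕ) (h : L2ST n) (v : SpaceTime n → ℂ), IsFT h v →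
      ∀ (f₁ : L2ST n) (g : Space n → ℕ → L2ST n),
      h = f₁ + ∑ e ∈ 𝓔, ∑ k' ∈ yIndices k, g e k' →
      xNorm φ₀ s k f₁ + ∑ e ∈ 𝓔, ∑ k' ∈ yIndices k, yNorm s k k' e (g e k') < ⊤ →
      eLpNorm v 2 volume ≤
        C * (xNorm φ₀ s k f₁ + ∑ e ∈ 𝓔, ∑ k' ∈ yIndices k, yNorm s k k' e (g e k')) ∧
      ∃ (w : L2ST n) (u : SpaceTime n → ℂ), IsFT w u ∧ DuhOf ψ s v u ∧
        zNorm φ₀ s 𝓔 k w ≤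
          C * (xNorm φ₀ s k f₁ + ∑ e ∈ 𝓔, ∑ k' ∈ yIndices k, yNorm s k k' e (g e k')) := by
  classical
  have hs0 : 0 < s := by linarith [hs.1]
  obtain ⟨C₁, hC₁⟩ := exists_duhOf_xSum hφ₀ hs0 hψ
  obtain ⟨C₂, hC₂⟩ := exists_duhOf_yNorm hφ₀ hs hψ hn
  set C : ℝ≥0 := C₁ + C₂ + 1 with hC
  have hC₁C : (C₁ : ℝ≥0∞) ≤ C := by
    rw [hC]; exact_mod_cast (by rw [add_assoc]; exact le_self_add)
  have hC₂C : (C₂ : ℝ≥0∞) + 1 ≤ C := by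
    rw [hC]; exact_mod_cast (by rw [add_assoc]; exact le_add_self)
  have hC₂C' : (C₂ : ℝ≥0∞) ≤ C := le_self_add.trans hC₂C
  have h1C : (1 : ℝ≥0∞) ≤ C := le_add_self.trans hC₂C
  refine ⟨C, by exact_mod_cast h1C, fun k h v hv f₁ g hf hlt => ?_⟩
  rw [← Finset.sum_product' 𝓔 (yIndices k) (fun e k' => yNorm s k k' e (g e k'))] at hlt ⊢
  set I := 𝓔 ×ˢ yIndices k with hI
  obtain ⟨hx1, hsumlt⟩ := ENNReal.add_lt_top.1 hlt
  have hy1 : ∀ i ∈ I, yNorm s k i.2 i.1 (g i.1 i.2) < ⊤ := fun i hi =>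
    ENNReal.sum_lt_top.1 hsumlt i hi
  obtain ⟨v₁, hf₁⟩ : ∃ v₁ : SpaceTime n → ℂ, IsFT f₁ v₁ := ⟨_, IsFT.of_Lp f₁⟩
  have hgi' : ∀ i : Space n × ℕ, ∃ w : SpaceTime n → ℂ, IsFT (g i.1 i.2) w :=
    fun i => ⟨_, IsFT.of_Lp _⟩
  choose vi hgi using hgi'
  have hsup₁ := supp_of_xNorm_lt hf₁ hx1
  have hxeq := xNorm_eq_xSum hφ₀ hs0 hf₁ hsup₁
  have hvsum : v =ᵐ[volume] fun ζ => v₁ ζ + ∑ i ∈ I, vi i ζ :=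
    hv.unique (IsFT.of_decomposition hf hf₁ fun i _ => hgi i) (Filter.EventuallyEq.refl _ _)
  obtain ⟨u₁, hu₁m, hu₁, hu₁s⟩ := hC₁ n v₁ hf₁.right.1 (hxeq ▸ hx1)
  have hY : ∀ i : Space n × ℕ, ∃ (x : SpaceTime n → ℂ) (y : L2ST n) (uy : SpaceTime n → ℂ),
      AEStronglyMeasurable x ∧ IsFT y uy ∧ (i ∈ I →
      eLpNorm (vi i) 2 volume ≤ C₂ * yNorm s k i.2 i.1 (g i.1 i.2) ∧
      DuhOf ψ s (vi i) (fun ζ => x ζ + uy ζ) ∧ (∀ᵐ ζ, ζ.fst ∉ annulus n k → x ζ = 0) ∧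
      xSum φ₀ s x ≤ C₂ * yNorm s k i.2 i.1 (g i.1 i.2) ∧
      yNorm s k i.2 i.1 y ≤ yNorm s k i.2 i.1 (g i.1 i.2)) := by
    intro i
    by_cases hi : i ∈ I
    · obtain ⟨he, hk⟩ := Finset.mem_product.1 hi
      obtain ⟨h1, x, y, uy, h2, h3, h4, h5, h6, h7⟩ := hC₂ k i.2 i.1 (g i.1 i.2) (vi i)
        (le_of_mem_yIndices hk) (h𝓔 _ he) (hgi i) (hy1 i hi)
      exact ⟨x, y, uy, h2, h3, fun _ => ⟨h1, h4, h5, h6, h7⟩⟩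
    · exact ⟨fun _ => 0, 0, _, aestronglyMeasurable_const, IsFT.of_Lp 0, fun h => absurd h hi⟩
  choose x y uy hxm hyuy hP using hY
  refine ⟨?_, ?_⟩
  · rw [eLpNorm_congr_ae hvsum]
    calc _ ≤ eLpNorm v₁ 2 volume + eLpNorm (fun ζ => ∑ i ∈ I, vi i ζ) 2 volume :=
          eLpNorm_add_le hf₁.right.1
            (Finset.aestronglyMeasurable_fun_sum I fun i _ => (hgi i).right.1) (by norm_num)
      _ ≤ xNorm φ₀ s k f₁ + ∑ i ∈ I, C₂ * yNorm s k i.2 i.1 (g i.1 i.2) := by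
          gcongr
          · rw [hxeq]; exact eLpNorm_le_xSum hφ₀ hs0 hf₁.right.1
          · have h1 := eLpNorm_sum_le (s := I) (f := vi) (p := 2) (μ := volume)
              (fun i _ => (hgi i).right.1) (by norm_num)
            have e1 : (fun ζ => ∑ i ∈ I, vi i ζ) = ∑ i ∈ I, vi i := by
              ext ζ; simp
            rw [e1]
            exact h1.trans (Finset.sum_le_sum fun i hi => (hP i hi).1)
      _ ≤ C * xNorm φ₀ s k f₁ + C * ∑ i ∈ I, yNorm s k i.2 i.1 (g i.1 i.2) := by
          rw [← Finset.mul_sum]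
          gcongr
          exact le_mul_of_one_le_left zero_le h1C
      _ = _ := (mul_add _ _ _).symm
  · set ux : SpaceTime n → ℂ := fun ζ => u₁ ζ + ∑ i ∈ I, x i ζ with hux
    have hsm : AEStronglyMeasurable fun ζ : SpaceTime n => ∑ i ∈ I, x i ζ :=
      Finset.aestronglyMeasurable_fun_sum I fun i _ => hxm i
    have huxm : AEStronglyMeasurable ux := hu₁m.add hsm
    have hxb : xSum φ₀ s ux ≤ C₁ * xNorm φ₀ s k f₁ +
        ∑ i ∈ I, C₂ * yNorm s k i.2 i.1 (g i.1 i.2) := by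
      refine (xSum_add_le hφ₀ hs0 hu₁m hsm).trans ?_
      rw [hxeq]
      gcongr
      refine (xSum_sum_le hφ₀ hs0 I hxm).trans ?_
      exact Finset.sum_le_sum fun i hi => (hP i hi).2.2.2.1
    have hxt : xSum φ₀ s ux < ⊤ := by
      refine hxb.trans_lt (ENNReal.add_lt_top.2 ⟨ENNReal.mul_lt_top (by simp) hx1, ?_⟩)
      exact ENNReal.sum_lt_top.2 fun i hi => ENNReal.mul_lt_top (by simp) (hy1 i hi)
    obtain ⟨f₁', hf₁'⟩ := exists_Lp_isFT (memLp_of_xSum hφ₀ hs0 huxm hxt)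
    have huxs : ∀ᵐ ζ, ζ ∉ regionX s k → ux ζ = 0 := by
      have h1 := hu₁.support (measurableSet_annulus n k)
        (hsup₁.mono fun ζ h h' => h (mt mem_regionX.1 h')) hu₁m
      have h2 : ∀ᵐ ζ : SpaceTime n, ∀ i ∈ I, ζ.fst ∉ annulus n k → x i ζ = 0 :=
        (Finset.eventually_all I).2 fun i hi => (hP i hi).2.2.1
      filter_upwards [h1, h2] with ζ h3 h4 h5
      have h6 := mt mem_regionX.2 h5
      simp only [hux]
      rw [h3 h6, Finset.sum_eq_zero fun i hi => h4 i hi h6, add_zero]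
    have hdec : f₁' + ∑ e ∈ 𝓔, ∑ k' ∈ yIndices k, y (e, k') =
      f₁' + ∑ e ∈ 𝓔, ∑ k' ∈ yIndices k, (fun e k' => y (e, k')) e k' := rfl
    have hw := IsFT.of_decomposition hdec hf₁' (v := uy) fun i _ => hyuy i
    refine ⟨_, _, hw, ?_, ?_⟩
    · have h1 := hu₁.add hs0 (DuhOf.sum hs0 I fun i hi => (hP i hi).2.1)
      refine h1.congr hvsum.symm (Filter.Eventually.of_forall fun ζ => ?_)
      simp only [hux, Finset.sum_add_distrib]
      ring
    · refine (zNorm_le hdec).trans ?_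
      rw [← Finset.sum_product' 𝓔 (yIndices k) (fun e k' => yNorm s k k' e (y (e, k'))),
        xNorm_eq_xSum hφ₀ hs0 hf₁' huxs]
      calc _ ≤ (C₁ * xNorm φ₀ s k f₁ + ∑ i ∈ I, C₂ * yNorm s k i.2 i.1 (g i.1 i.2)) +
            ∑ i ∈ I, yNorm s k i.2 i.1 (g i.1 i.2) :=
            add_le_add hxb (Finset.sum_le_sum fun i hi => (hP i hi).2.2.2.2)
        _ = C₁ * xNorm φ₀ s k f₁ + (C₂ + 1) * ∑ i ∈ I, yNorm s k i.2 i.1 (g i.1 i.2) := by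
            rw [← Finset.mul_sum]; ring
        _ ≤ C * xNorm φ₀ s k f₁ + C * ∑ i ∈ I, yNorm s k i.2 i.1 (g i.1 i.2) := by gcongr
        _ = _ := (mul_add _ _ _).symm
/-- The space `Zₖ` is contained in `L²`, and the Duhamel term is bounded on it. -/
theorem exists_duhOf_zNorm (hφ₀ : IsBump φ₀) (hs : s ∈ Set.Ioo (1 / 2 : ℝ) 1)
    (hψ : IsTimeCutoff ψ) (hn : 1 ≤ n) (h𝓔 : ∀ e ∈ 𝓔, ‖e‖ = 1) :
    ∃ C : ℝ≥0, ∀ (k : ℕ) (h : L2ST n) (v : SpaceTime n → ℂ), IsFT h v →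
      eLpNorm v 2 volume ≤ C * zNorm φ₀ s 𝓔 k h ∧
      (zNorm φ₀ s 𝓔 k h < ⊤ → ∃ (w : L2ST n) (u : SpaceTime n → ℂ), IsFT w u ∧
        DuhOf ψ s v u ∧ zNorm φ₀ s 𝓔 k w ≤ C * zNorm φ₀ s 𝓔 k h) := by
  obtain ⟨C, hC1, key⟩ := exists_duhOf_decomposition hφ₀ hs hψ hn h𝓔
  have hC0 : (C : ℝ≥0∞) ≠ 0 := by
    rw [ENNReal.coe_ne_zero]
    exact (zero_lt_one.trans_le hC1).ne'
  refine ⟨C, fun k h v hv => ?_⟩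
  refine ⟨le_mul_zNorm hC0 (by simp) fun f₁ g hf hlt => (key k h v hv f₁ g hf hlt).1, fun hlt => ?_⟩
  obtain ⟨f₁, g, hf, hlt'⟩ := exists_decomposition hlt
  obtain ⟨-, w, u, hw, hu, -⟩ := key k h v hv f₁ g hf hlt'
  -- The function `w` comes from one decomposition, but the Duhamel term is unique. The estimate
  -- obtained from any other decomposition therefore applies to the same `w`, and the infimum may be
  -- taken.
  refine ⟨w, u, hw, hu, le_mul_zNorm hC0 (by simp) fun f₁' g' hf' hlt'' => ?_⟩
  obtain ⟨-, w', u', hw', hu', hz⟩ := key k h v hv f₁' g' hf' hlt''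
  have : w = w' := Lp_eq_of_isFT hw (hw'.congr (Filter.EventuallyEq.refl _ _)
    (hu'.unique hu hw'.right.1 hw.right.1))
  rwa [this]

end ZNorm

/-! ### Summation over frequency blocks, and the two main estimates. -/

section Assembly

variable {n : ℕ} {s : ℝ} {k : ℕ} {φ₀ ψ : ℝ → ℝ} {𝓔 : Finset (Space n)}

theorem exists_schwartz_eq {V : Type*} [NormedAddCommGroup V] [InnerProductSpace ℝ V]
    {g : V → ℝ} (hg : ContDiff ℝ ∞ g) (hc : HasCompactSupport g) :
    ∃ θ : 𝓢(V, ℂ), ∀ x, θ x = (g x : ℂ) := by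
  have h1 : HasCompactSupport fun x => (g x : ℂ) :=
    hc.comp_left (g := fun r : ℝ => (r : ℂ)) (by simp)
  have h2 : ContDiff ℝ ∞ fun x => (g x : ℂ) := Complex.ofRealCLM.contDiff.comp hg
  exact ⟨h1.toSchwartzMap h2, fun x => rfl⟩

/-- Test with a smooth bump equal to 1 near the point. -/
theorem locallyIntegrable_of_schwartz {V : Type*} [NormedAddCommGroup V] [InnerProductSpace ℝ V]
    [FiniteDimensional ℝ V] [MeasurableSpace V] [BorelSpace V] {G : V → ℂ}
    (h : ∀ θ : 𝓢(V, ℂ), Integrable fun ζ => θ ζ * G ζ) : LocallyIntegrable G := by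
  intro x
  obtain ⟨b⟩ : Nonempty (ContDiffBump x) := inferInstance
  obtain ⟨θ, hθ⟩ := exists_schwartz_eq b.contDiff b.hasCompactSupport
  refine ⟨Metric.closedBall x b.rIn, Metric.closedBall_mem_nhds x b.rIn_pos, ?_⟩
  refine ((h θ).integrableOn (s := Metric.closedBall x b.rIn)).congr_fun (fun y hy => ?_)
    measurableSet_closedBall
  have : b y = 1 := b.one_of_mem_closedBall hy
  simp [hθ, this]

theorem ae_eq_of_schwartz {V : Type*} [NormedAddCommGroup V] [InnerProductSpace ℝ V]
    [FiniteDimensional ℝ V] [MeasurableSpace V] [BorelSpace V] {G G' : V → ℂ}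
    (h : ∀ θ : 𝓢(V, ℂ), Integrable fun ζ => θ ζ * G ζ)
    (h' : ∀ θ : 𝓢(V, ℂ), Integrable fun ζ => θ ζ * G' ζ)
    (he : ∀ θ : 𝓢(V, ℂ), ∫ ζ, θ ζ * G ζ = ∫ ζ, θ ζ * G' ζ) : G =ᵐ[volume] G' := by
  refine ae_eq_of_integral_contDiff_smul_eq (locallyIntegrable_of_schwartz h)
    (locallyIntegrable_of_schwartz h') fun g hg hc => ?_
  obtain ⟨θ, hθ⟩ := exists_schwartz_eq hg hc
  simpa [hθ] using he θ

theorem Represents.unique {T : 𝓢'(SpaceTime n, ℂ)} {G G' : SpaceTime n → ℂ}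
    (h : Represents T G) (h' : Represents T G') : G =ᵐ[volume] G' :=
  ae_eq_of_schwartz (fun θ => (h.2 θ).1) (fun θ => (h'.2 θ).1)
    fun θ => (h.2 θ).2.symm.trans (h'.2 θ).2

theorem represents_fourier {f : L2ST n} {v : SpaceTime n → ℂ} (h : IsFT f v) :
    Represents (𝓕 (f : 𝓢'(SpaceTime n, ℂ))) v := by
  refine ⟨h.right.1, fun θ => ⟨(θ.memLp 2).integrable_mul h.right, ?_⟩⟩
  rw [Lp.fourier_toTemperedDistribution_eq, Lp.toTemperedDistribution_apply]
  refine integral_congr_ae ?_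
  filter_upwards [h.coe_fourier] with ζ hζ
  rw [hζ, smul_eq_mul]

theorem isFT_freqProj (hφ₀ : IsBump φ₀) {f : L2ST n} {v : SpaceTime n → ℂ} (h : IsFT f v) :
    IsFT (freqProj φ₀ k f) (fun ζ => (dyadic φ₀ k ‖(2 * Real.pi) • ζ.fst‖ : ℂ) * v ζ) := by
  refine isFT_l2Multiplier h (memLp_mul_of_bound ?_ (fun ζ => hφ₀.norm_dyadic_le k _) h.right)
  refine Continuous.aestronglyMeasurable ?_
  have := hφ₀.continuous_dyadic k
  fun_prop

theorem isFT_freqProjS (hφ₀ : IsBump φ₀) {f : L2S n} {v : Space n → ℂ} (h : IsFT f v) :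
    IsFT (freqProjS φ₀ k f) (fun ξ => (dyadic φ₀ k ‖(2 * Real.pi) • ξ‖ : ℂ) * v ξ) := by
  refine isFT_l2Multiplier h (memLp_mul_of_bound ?_ (fun ζ => hφ₀.norm_dyadic_le k _) h.right)
  refine Continuous.aestronglyMeasurable ?_
  have := hφ₀.continuous_dyadic k
  fun_prop

theorem dyadic_eq_zero_of_notMem (hφ₀ : IsBump φ₀) {ξ : Space n} (h : ξ ∉ annulus n k) :
    dyadic φ₀ k ‖(2 * Real.pi) • ξ‖ = 0 := by
  by_contra hc
  have := hφ₀.mem_dyadicInterval hc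
  rw [abs_norm] at this
  exact h this

/-- A frequency block is determined by its profile. -/
theorem freqProj_eq (hφ₀ : IsBump φ₀) {f w : L2ST n} {v u : SpaceTime n → ℂ}
    {W : Space n → ℝ → ℂ} (hf : IsFT f v) (hw : IsFT w u)
    (hW : ∀ᵐ ξ, IsFT (W ξ) (fun τ => v (pt ξ τ)))
    (hW' : ∀ᵐ ξ, IsFT (fun t => (dyadic φ₀ k ‖(2 * Real.pi) • ξ‖ : ℂ) * W ξ t)
      (fun τ => u (pt ξ τ))) : freqProj φ₀ k f = w := by
  have h1 := isFT_freqProj (k := k) hφ₀ hf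
  refine Lp_eq_of_isFT h1 (hw.congr (Filter.EventuallyEq.refl _ _) ?_)
  refine ae_eq_toLp hw.right.1 h1.right.1 ?_
  filter_upwards [hW, hW'] with ξ h2 h3
  exact h3.unique (h2.const_mul _) (Filter.EventuallyEq.refl _ _)

theorem tsum_enorm_le {a b : ℕ → ℝ≥0∞} {C : ℝ≥0∞} (h : ∀ k, a k ≤ C * b k) {σ : ℝ} :
    ∑' k : ℕ, (2 : ℝ≥0∞) ^ ((k : ℝ) * σ) * a k ≤
      C * ∑' k : ℕ, (2 : ℝ≥0∞) ^ ((k : ℝ) * σ) * b k := by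
  rw [← ENNReal.tsum_mul_left]
  refine ENNReal.tsum_le_tsum fun k => ?_
  rw [mul_left_comm]
  gcongr
  exact h k

theorem isFT_toLp_swap {f : L2ST n} {f' g : SpaceTime n → ℂ} {W : Space n × ℝ → ℂ}
    (h : IsProfile f' W g) (hf : f' =ᵐ[volume] f) :
    ∀ᵐ t : ℝ, IsFT (fun x => f (pt x t)) (fun ξ => W (ξ, t)) := by
  have h1 := ae_fiber_of_ae (Measure.measurePreserving_swap.quasiMeasurePreserving.ae
    (ae_toLp_iff.2 hf))
  filter_upwards [h.left, h1] with t h2 h3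
  exact h2.congr h3 (Filter.EventuallyEq.refl _ _)

/-- The free evolution. -/
theorem exists_cutoffFree (hφ₀ : IsBump φ₀) (hs : 0 < s) (hψ : IsTimeCutoff ψ)
    (h𝓔 : ∀ e ∈ 𝓔, ‖e‖ = 1) :
    ∃ C : ℝ≥0, ∀ f₀ : L2S n, ∃ u : L2ST n, IsCutoffFree s ψ f₀ u ∧
      ∀ k, zNorm φ₀ s 𝓔 k (freqProj φ₀ k u) ≤ C * ‖freqProjS φ₀ k f₀‖ₑ := by
  obtain ⟨C, hC⟩ := exists_free_lift hs hψ
  refine ⟨3 * decaySum.toNNReal * (C + 1), fun f₀ => ?_⟩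
  obtain ⟨q, hq⟩ : ∃ q : Space n → ℂ, IsFT f₀ q := ⟨_, IsFT.of_Lp f₀⟩
  have hcont : Continuous fun z : Space n × ℝ =>
      ψ z.2 * Complex.exp (-(Complex.I * z.2 * disp s z.1)) := by
    have h1 := hψ.smooth.continuous
    have h2 := continuous_disp (n := n) hs
    fun_prop
  -- The case of a profile `R` constant in time. It is used for the datum, to construct the
  -- solution, and for each of its frequency blocks, to estimate it.
  have lift : ∀ q : Space n → ℂ, MemLp q 2 → ∃ (w : L2ST n) (u : SpaceTime n → ℂ), IsFT w u ∧
      (∀ᵐ ξ, IsFT (fun t : ℝ => ψ t * (Complex.exp (-(Complex.I * t * disp s ξ)) * q ξ))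
        (fun τ => u (pt ξ τ))) ∧
      eLpNorm (fun ζ => symb s ζ * u ζ) 2 volume ≤ (C + 1) * eLpNorm q 2 volume := by
    intro q hq
    have hm : AEStronglyMeasurable (fun z : Space n × ℝ =>
        ψ z.2 * (Complex.exp (-(Complex.I * z.2 * disp s z.1)) * q z.1))
        (volume.prod volume) := by
      have := hcont.aestronglyMeasurable (μ := volume.prod volume)|>.mul
        (hq.1.comp_fst (ν := (volume : Measure ℝ)))
      refine this.congr (Filter.Eventually.of_forall fun z => ?_)
      simp [mul_assoc]
    obtain ⟨u, hum, hu, hus⟩ := hC n (fun ξ _ => q ξ) (fun _ _ => 0)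
      (Filter.Eventually.of_forall fun ξ => ⟨fun t => hasDerivAt_const t (q ξ), continuous_const⟩) hm
    have h1 : sqNorm volume (fun ζ => symb s ζ * u ζ) ≤ (C : ℝ≥0∞) * sqNorm volume q := by
      refine hus.trans (le_of_eq ?_)
      simp [sqNorm]
    have h2 : MemLp u 2 := memLp_of_symb_mul hum
      (h1.trans_lt (ENNReal.mul_lt_top (by simp) (memLp_two_iff.1 hq).2))
    obtain ⟨w, hw⟩ := exists_Lp_isFT h2
    refine ⟨w, u, hw, hu, eLpNorm_le_of_sqNorm_le (h1.trans ?_)⟩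
    gcongr
    calc (C : ℝ≥0∞) ≤ C + 1 := le_self_add
      _ ≤ _ := le_self_pow₀ le_add_self (by norm_num)
  obtain ⟨f, v, hf, hv, -⟩ := lift q hq.right
  refine ⟨f, ?_, fun k => ?_⟩
  · obtain ⟨H, hH⟩ := hf.exists_profile
    have h1 : H =ᵐ[volume.prod volume] fun z : Space n × ℝ =>
        ψ z.2 * (Complex.exp (-(Complex.I * z.2 * disp s z.1)) * q z.1) := by
      refine ae_eq_of_fiber hH.memLp.1 ?_ ?_
      · have := hcont.aestronglyMeasurable (μ := volume.prod volume)|>.mul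
          (hq.right.1.comp_fst (ν := (volume : Measure ℝ)))
        refine this.congr (Filter.Eventually.of_forall fun z => ?_)
        simp [mul_assoc]
      · filter_upwards [hH.right, hv] with ξ h2 h3
        exact h2.unique_left h3 (Filter.EventuallyEq.refl _ _)
    have h2 := ae_fiber_of_ae (Measure.measurePreserving_swap.quasiMeasurePreserving.ae h1)
    filter_upwards [hH.left, h2] with t h3 h4
    have h5 : IsFT (propagator s t f₀)
        (fun ξ => Complex.exp (-(Complex.I * t * disp s ξ)) * q ξ) := by
      refine isFT_l2Multiplier hq (memLp_mul_of_bound ?_ (C := 1)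
        (fun ξ => (norm_exp_I_mul _ _).le) hq.right)
      have h2 := continuous_disp (n := n) hs
      exact Continuous.aestronglyMeasurable (by fun_prop)
    exact h3.unique_left (h5.const_mul (ψ t : ℂ)) h4
  · set qk : Space n → ℂ := fun ξ => (dyadic φ₀ k ‖(2 * Real.pi) • ξ‖ : ℂ) * q ξ with hqk
    have hk := isFT_freqProjS (k := k) hφ₀ hq
    obtain ⟨w, u, hw, hu, hus⟩ := lift qk hk.right
    have h1 : freqProj φ₀ k f = w := by
      refine freqProj_eq hφ₀ hf hw hv (hu.mono fun ξ h => ?_)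
      refine h.congr (Filter.Eventually.of_forall fun t => ?_) (Filter.EventuallyEq.refl _ _)
      simp only [hqk]
      ring
    rw [h1]
    have h2 : ∀ᵐ ζ : SpaceTime n, ζ.fst ∉ annulus n k → u ζ = 0 := by
      refine ae_eq_zero_of_fiber hu (measurableSet_annulus n k)
        (Filter.Eventually.of_forall fun ξ hξ => Filter.Eventually.of_forall fun t => ?_) hw.right.1
      simp [hqk, dyadic_eq_zero_of_notMem hφ₀ hξ]
    refine (zNorm_le_xSum hφ₀ hs h𝓔 hw h2).trans ((xSum_le_symb hφ₀ u).trans ?_)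
    have h3 : ‖freqProjS φ₀ k f₀‖ₑ = eLpNorm qk 2 volume := by
      rw [Lp.enorm_def, hk.eLpNorm_eq]
    rw [h3]
    push_cast
    rw [ENNReal.coe_toNNReal decaySum_lt_top.ne, mul_assoc _ _ (eLpNorm qk 2 volume)]
    gcongr

/-- A distribution is represented by at most one function up to null sets. So the infimum over
resolvent blocks in `nNorm` runs over at most one function, and is attained when finite. -/
theorem IsResolventBlock.unique {F : 𝓢'(SpaceTime n, ℂ)} {h h' : L2ST n}
    (hh : IsResolventBlock φ₀ s k F h) (hh' : IsResolventBlock φ₀ s k F h') : h = h' := by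
  obtain ⟨G, hG, h1⟩ := hh
  obtain ⟨G', hG', h2⟩ := hh'
  refine Lp_eq_of_isFT (IsFT.of_Lp h)
    ((IsFT.of_Lp h').congr (Filter.EventuallyEq.refl _ _) ?_)
  filter_upwards [h1, h2, hG.unique hG'] with ζ h3 h4 h5
  rw [h3, h4, h5]

theorem exists_isResolventBlock {F : 𝓢'(SpaceTime n, ℂ)} {σ : ℝ}
    (h : nNorm φ₀ s 𝓔 σ F < ⊤) (k : ℕ) :
    ∃ h : L2ST n, IsResolventBlock φ₀ s k F h ∧ zNorm φ₀ s 𝓔 k h < ⊤ ∧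
      (⨅ (h : L2ST n) (_ : IsResolventBlock φ₀ s k F h), zNorm φ₀ s 𝓔 k h) =
        zNorm φ₀ s 𝓔 k h := by
  have h1 := ENNReal.ne_top_of_tsum_ne_top h.ne k
  have h2 := ENNReal.lt_top_of_mul_ne_top_right h1 (two_rpow_ne_zero _)
  have h3 := h2
  simp only [iInf_lt_iff] at h3
  obtain ⟨h, hh, hlt⟩ := h3
  refine ⟨h, hh, hlt, le_antisymm (iInf₂_le h hh) (le_iInf₂ fun h' hh' => ?_)⟩
  rw [hh'.unique hh]

/-- Oscillation compensates the growth of the symbol, as the equation for the kernel shows. Hence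
the integral defining `duhamelHat` converges as soon as `G` divided by the symbol is integrable in
τ. -/
theorem norm_symb_mul_duhamelKernel_le (t : ℝ) (ζ : SpaceTime n) :
    ‖symb s ζ * duhamelKernel s t ζ‖ ≤ 2 + |t| := by
  have h1 := I_mul_symb_mul_duhamelKernel (s := s) t ζ
  calc ‖symb s ζ * duhamelKernel s t ζ‖ =
        ‖Complex.I * (symb s ζ * duhamelKernel s t ζ)‖ := by simp
    _ ≤ (‖Complex.exp (Complex.I * t * (2 * Real.pi * ζ.snd))‖ +
        ‖Complex.exp (-(Complex.I * t * disp s ζ.fst))‖) + ‖duhamelKernel s t ζ‖ := by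
        rw [h1]
        refine (norm_sub_le _ _).trans ?_
        gcongr
        refine (norm_add_le _ _).trans ?_
        rw [norm_neg]
    _ ≤ (1 + 1) + |t| := by
        have e1 : ‖Complex.exp (Complex.I * t * (2 * Real.pi * ζ.snd))‖ = 1 := by
          have := norm_exp_I_mul' t (2 * Real.pi * ζ.snd)
          push_cast at this
          exact this
        rw [e1, norm_exp_I_mul]
        gcongr
        exact norm_duhamelKernel_le t ζ
    _ = _ := by ring

/-- The Duhamel profile of a spatial frequency block. -/
theorem duhProfile_block (G : SpaceTime n → ℂ) (k : ℕ) (ξ : Space n) (t : ℝ) :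
    duhProfile ψ s (fun ζ => (symb s ζ)⁻¹ *
      ((dyadic φ₀ k ‖(2 * Real.pi) • ζ.fst‖ : ℂ) * G ζ)) ξ t =
      (dyadic φ₀ k ‖(2 * Real.pi) • ξ‖ : ℂ) * (Complex.I * ψ t * duhamelHat s G t ξ) := by
  have h1 : duhamelHat s (fun ζ => symb s ζ * ((symb s ζ)⁻¹ *
      ((dyadic φ₀ k ‖(2 * Real.pi) • ζ.fst‖ : ℂ) * G ζ))) t ξ =
      (dyadic φ₀ k ‖(2 * Real.pi) • ξ‖ : ℂ) * duhamelHat s G t ξ := by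
    unfold duhamelHat
    rw [← integral_const_mul]
    refine integral_congr_ae (Filter.Eventually.of_forall fun τ => ?_)
    beta_reduce
    rw [mul_inv_cancel_left₀ (symb_ne_zero _), mul_assoc, WithLp.toLp_fst]
  unfold duhProfile
  rw [h1]
  ring

theorem aestronglyMeasurable_duhamelHat (hs : 0 < s) (hψ : IsTimeCutoff ψ) {G : SpaceTime n → ℂ}
    (hG : AEStronglyMeasurable G) :
    AEStronglyMeasurable (fun z : Space n × ℝ => Complex.I * ψ z.2 * duhamelHat s G z.2 z.1)
      (volume.prod volume) := by
  have h1 : Continuous fun z : (Space n × ℝ) × ℝ => duhamelKernel s z.1.2 (pt z.1.1 z.2) := by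
    have h3 : Continuous fun z : (Space n × ℝ) × ℝ => (z.1.2, pt z.1.1 z.2) := by fun_prop
    exact Continuous.comp (g := fun z : ℝ × SpaceTime n => duhamelKernel s z.1 z.2)
      (f := fun z : (Space n × ℝ) × ℝ => ((z.1.2, pt z.1.1 z.2) : ℝ × SpaceTime n))
      (continuous_duhamelKernel hs) h3
  have h2 := aestronglyMeasurable_integral_kernel hG h1
  have h3 : Continuous fun z : Space n × ℝ => Complex.I * ψ z.2 := by
    have := hψ.smooth.continuous
    fun_prop
  exact h3.aestronglyMeasurable.mul h2

/-- The integrand is the fibre of a resolvent block times the bounded function `symb` ·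
`duhamelKernel`, divided by the value `c` of the spatial cut-off. -/
theorem integrable_mul_duhamelKernel (hs : 0 < s) {G : SpaceTime n → ℂ} {ξ : Space n} {c : ℂ}
    (hc : c ≠ 0) (h : Integrable fun τ : ℝ => (symb s (pt ξ τ))⁻¹ * (c * G (pt ξ τ))) (t : ℝ) :
    Integrable fun τ : ℝ => G (pt ξ τ) * duhamelKernel s t (pt ξ τ) := by
  have h3 : Continuous fun τ : ℝ => symb s (pt ξ τ) * duhamelKernel s t (pt ξ τ) := by
    have h4 : Continuous fun τ : ℝ => pt ξ τ := by fun_prop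
    have h5 : Continuous fun τ : ℝ => (t, pt ξ τ) := by fun_prop
    exact ((continuous_symb hs).comp h4).mul
      (Continuous.comp (g := fun z : ℝ × SpaceTime n => duhamelKernel s z.1 z.2)
        (f := fun τ : ℝ => ((t, pt ξ τ) : ℝ × SpaceTime n)) (continuous_duhamelKernel hs) h5)
  have h6 := (h.bdd_mul (c := 2 + |t|) h3.aestronglyMeasurable
    (Filter.Eventually.of_forall fun τ => norm_symb_mul_duhamelKernel_le t (pt ξ τ))).const_mul c⁻¹
  refine h6.congr (Filter.Eventually.of_forall fun τ => ?_)
  beta_reduce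
  generalize duhamelKernel s t (pt ξ τ) = D
  have h7 := symb_ne_zero (s := s) (pt ξ τ)
  revert h7
  generalize symb s (pt ξ τ) = S
  intro h7
  field_simp

theorem continuous_dyadic_fst (hφ₀ : IsBump φ₀) (k : ℕ) :
    Continuous fun z : Space n × ℝ => (dyadic φ₀ k ‖(2 * Real.pi) • z.1‖ : ℂ) :=
  Complex.continuous_ofReal.comp ((hφ₀.continuous_dyadic k).comp (by fun_prop))

/-- A profile is square integrable if its blocks are summable. -/
theorem memLp_of_blocks (hφ₀ : IsBump φ₀) {W : Space n × ℝ → ℂ}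
    (hW : AEStronglyMeasurable W (volume.prod volume)) {u : ℕ → SpaceTime n → ℂ}
    (hu : ∀ k, AEStronglyMeasurable (u k))
    (hWu : ∀ k, ∀ᵐ ξ : Space n,
      IsFT (fun t => (dyadic φ₀ k ‖(2 * Real.pi) • ξ‖ : ℂ) * W (ξ, t)) (fun τ => u k (pt ξ τ)))
    (hsum : ∑' k, eLpNorm (u k) 2 volume < ⊤) : MemLp W 2 (volume.prod volume) := by
  have hWk : ∀ k, AEStronglyMeasurable
      (fun z : Space n × ℝ => (dyadic φ₀ k ‖(2 * Real.pi) • z.1‖ : ℂ) * W z)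
      (volume.prod volume) := fun k => (continuous_dyadic_fst hφ₀ k).aestronglyMeasurable.mul hW
  refine ⟨hW, lt_of_le_of_lt (eLpNorm_le_tsum hWk
    (Filter.Eventually.of_forall fun z => hφ₀.enorm_le_tsum _ _)) (lt_of_le_of_lt ?_ hsum)⟩
  refine ENNReal.tsum_le_tsum fun k => le_of_eq ?_
  rw [eLpNorm_two_eq, eLpNorm_two_eq, sqNorm_prod (hWk k), sqNorm_fiber (hu k)]
  congr 1
  refine lintegral_congr_ae ?_
  filter_upwards [hWu k] with ξ h2
  exact h2.sqNorm_eq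

/-- The `N` norm of a square integrable function is controlled by its frequency blocks. -/
theorem iInf_zNorm_le (hφ₀ : IsBump φ₀) (hs : 0 < s) (h𝓔 : ∀ e ∈ 𝓔, ‖e‖ = 1) (f : L2ST n)
    (k : ℕ) :
    ⨅ (h : L2ST n) (_ : IsResolventBlock φ₀ s k (f : 𝓢'(SpaceTime n, ℂ)) h), zNorm φ₀ s 𝓔 k h ≤
      3 * decaySum * ‖freqProj φ₀ k f‖ₑ := by
  obtain ⟨g, hf⟩ : ∃ g : SpaceTime n → ℂ, IsFT f g := ⟨_, IsFT.of_Lp f⟩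
  have h1 := isFT_freqProj (k := k) hφ₀ hf
  -- Dividing the block by the symbol makes the right side of `xSum_le_symb` the plain L² norm of
  -- the block.
  set r : SpaceTime n → ℂ := fun ζ =>
    (symb s ζ)⁻¹ * ((dyadic φ₀ k ‖(2 * Real.pi) • ζ.fst‖ : ℂ) * g ζ) with hr
  have hsr : ∀ ζ, symb s ζ * r ζ = (dyadic φ₀ k ‖(2 * Real.pi) • ζ.fst‖ : ℂ) * g ζ :=
    fun ζ => mul_inv_cancel_left₀ (symb_ne_zero ζ) _
  have hrL : MemLp r 2 := by
    refine memLp_of_symb_mul (s := s)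
      (((continuous_symb hs).inv₀ symb_ne_zero).aestronglyMeasurable.mul h1.right.1) ?_
    simp only [hsr]
    exact (memLp_two_iff.1 h1.right).2
  obtain ⟨h, hh⟩ := exists_Lp_isFT hrL
  refine (iInf₂_le h ⟨g, represents_fourier hf, hh.coe_fourier⟩).trans ?_
  refine (zNorm_le_xSum hφ₀ hs h𝓔 hh (Filter.Eventually.of_forall fun ζ hζ => ?_)).trans ?_
  · simp [hr, dyadic_eq_zero_of_notMem hφ₀ hζ]
  · refine (xSum_le_symb hφ₀ r).trans ?_
    simp only [hsr]
    rw [Lp.enorm_def, h1.eLpNorm_eq]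

/-- The Duhamel term. -/
theorem exists_cutoffDuhamel (hφ₀ : IsBump φ₀) (hs : s ∈ Set.Ioo (1 / 2 : ℝ) 1)
    (hψ : IsTimeCutoff ψ) (hn : 1 ≤ n) (h𝓔 : ∀ e ∈ 𝓔, ‖e‖ = 1) :
    ∃ C : ℝ≥0, ∀ σ : ℝ, 0 ≤ σ → ∀ F : 𝓢'(SpaceTime n, ℂ), nNorm φ₀ s 𝓔 σ F < ⊤ →
      ∃ f : L2ST n, IsCutoffDuhamel s ψ F f ∧
        fNorm φ₀ s 𝓔 σ f ≤ C * nNorm φ₀ s 𝓔 σ F ∧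
        nNorm φ₀ s 𝓔 σ (f : 𝓢'(SpaceTime n, ℂ)) ≤ C * nNorm φ₀ s 𝓔 σ F := by
  have hs0 : 0 < s := by linarith [hs.1]
  obtain ⟨C, hC⟩ := exists_duhOf_zNorm hφ₀ hs hψ hn h𝓔
  refine ⟨C + 3 * decaySum.toNNReal * (C * C), fun σ hσ F hF => ?_⟩
  choose h hh hlt hinf using exists_isResolventBlock hF
  have hNeq : nNorm φ₀ s 𝓔 σ F = ∑' k : ℕ, (2 : ℝ≥0∞) ^ ((k : ℝ) * σ) * zNorm φ₀ s 𝓔 k (h k) :=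
    tsum_congr fun k => by rw [hinf k]
  obtain ⟨G, hG, -⟩ := hh 0
  set v : ℕ → SpaceTime n → ℂ := fun k ζ =>
    (symb s ζ)⁻¹ * ((dyadic φ₀ k ‖(2 * Real.pi) • ζ.fst‖ : ℂ) * G ζ) with hv
  have hhv : ∀ k, IsFT (h k) (v k) := fun k => by
    obtain ⟨G', hG', h1⟩ := hh k
    refine (IsFT.of_Lp (h k)).congr (Filter.EventuallyEq.refl _ _) ?_
    filter_upwards [h1, hG'.unique hG] with ζ h2 h3
    rw [h2, h3]
  choose w u hw hdu hz using fun k => (hC k (h k) (v k) (hhv k)).2 (hlt k)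
  -- One factor `C` embeds `Zₖ` into L²; the other bounds the Duhamel term on `Zₖ`.
  have hun : ∀ k, eLpNorm (u k) 2 volume ≤ C * C * zNorm φ₀ s 𝓔 k (h k) := fun k => by
    refine ((hC k (w k) (u k) (hw k)).1).trans ?_
    rw [mul_assoc]
    gcongr
    exact hz k
  set W : Space n × ℝ → ℂ := fun z => Complex.I * ψ z.2 * duhamelHat s G z.2 z.1 with hW
  have hWm : AEStronglyMeasurable W (volume.prod volume) :=
    aestronglyMeasurable_duhamelHat hs0 hψ hG.1
  have hWk : ∀ k, ∀ᵐ ξ : Space n,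
      IsFT (fun t => (dyadic φ₀ k ‖(2 * Real.pi) • ξ‖ : ℂ) * W (ξ, t))
        (fun τ => u k (pt ξ τ)) := fun k => by
    filter_upwards [(hdu k).isFT] with ξ h1
    exact h1.congr (Filter.Eventually.of_forall fun t => duhProfile_block G k ξ t)
      (Filter.EventuallyEq.refl _ _)
  have hWL : MemLp W 2 (volume.prod volume) := by
    refine memLp_of_blocks hφ₀ hWm (fun k => (hw k).right.1) hWk ?_
    -- This is where σ ≥ 0 enters: the weights 2^{kσ} are at least 1, so finiteness of the N norm
    -- makes the blocks summable in L².
    calc ∑' k, eLpNorm (u k) 2 volume ≤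
          ∑' k : ℕ, (C * C : ℝ≥0∞) * ((2 : ℝ≥0∞) ^ ((k : ℝ) * σ) * zNorm φ₀ s 𝓔 k (h k)) := by
          refine ENNReal.tsum_le_tsum fun k => (hun k).trans ?_
          gcongr
          refine le_mul_of_one_le_left zero_le ?_
          calc (1 : ℝ≥0∞) = 2 ^ (0 : ℝ) := by simp
            _ ≤ _ := ENNReal.rpow_le_rpow_of_exponent_le (by norm_num) (by positivity)
      _ = C * C * nNorm φ₀ s 𝓔 σ F := by rw [ENNReal.tsum_mul_left, hNeq]
      _ < ⊤ := ENNReal.mul_lt_top (by finiteness) hF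
  obtain ⟨f', g, hf', hprofile⟩ := exists_profile_of_memLp hWL
  obtain ⟨f, hf⟩ := exists_Lp_isFT hf'.right
  have hff : f' =ᵐ[volume] f := hf'.unique_left hf (Filter.EventuallyEq.refl _ _)
  have hproj : ∀ k, freqProj φ₀ k f = w k := fun k =>
    freqProj_eq hφ₀ (W := fun ξ t => W (ξ, t)) hf (hw k) hprofile.right (hWk k)
  refine ⟨f, ⟨G, hG, ?_, ?_⟩, ?_, ?_⟩
  · have h1 : ∀ᵐ ξ : Space n, ∀ k, Integrable fun τ : ℝ => v k (pt ξ τ) :=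
      ae_all_iff.2 fun k => (hdu k).integrable
    filter_upwards [h1] with ξ h2 t
    -- At every ξ some cut-off is nonzero, and the integrability of that single block yields the
    -- integrability for `G` itself.
    obtain ⟨k, hk⟩ := hφ₀.exists_dyadic_ne ‖(2 * Real.pi) • ξ‖
    have hk' : (dyadic φ₀ k ‖(2 * Real.pi) • ξ‖ : ℂ) ≠ 0 := by exact_mod_cast hk
    exact integrable_mul_duhamelKernel (G := G) (ξ := ξ) hs0 hk' (h2 k) t
  · filter_upwards [isFT_toLp_swap hprofile hff] with t h1
    refine ⟨h1.left.toLp _, h1.left.coeFn_toLp.symm, ?_⟩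
    exact (h1.congr h1.left.coeFn_toLp.symm (Filter.EventuallyEq.refl _ _)).coe_fourier
  · rw [hNeq]
    refine (tsum_enorm_le (C := C) (b := fun k => zNorm φ₀ s 𝓔 k (h k)) fun k => ?_).trans ?_
    · rw [hproj k]
      exact hz k
    · push_cast
      gcongr
      exact le_self_add
  -- The N norm of `f` needs only the L² norms of its blocks, and these are already bounded by the Z
  -- norms of the resolvent blocks of `F`.
  · rw [hNeq]
    refine (tsum_enorm_le (C := 3 * decaySum.toNNReal * (C * C))
      (b := fun k => zNorm φ₀ s 𝓔 k (h k)) fun k => ?_).trans ?_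
    · refine (iInf_zNorm_le hφ₀ hs0 h𝓔 f k).trans ?_
      rw [ENNReal.coe_toNNReal decaySum_lt_top.ne, hproj k, Lp.enorm_def, (hw k).eLpNorm_eq,
        mul_assoc _ _ (zNorm φ₀ s 𝓔 k (h k))]
      gcongr
      exact hun k
    · refine mul_le_mul' ?_ le_rfl
      push_cast
      exact le_add_self

end Assembly

end SMap

end

theorem lemma9p1 (n : ℕ) (hn : 3 ≤ n) (s : ℝ) (hs : s ∈ Set.Ioo (1 / 2 : ℝ) 1)
    (𝓔 : Finset (SMap.Space n)) (h𝓔 : ∀ e ∈ 𝓔, ‖e‖ = 1)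
    (φ₀ : ℝ → ℝ) (hφ₀ : SMap.IsBump φ₀) (ψ : ℝ → ℝ) (hψ : SMap.IsTimeCutoff ψ) :
    ∃ C : ℝ≥0, ∀ σ : ℝ, 0 ≤ σ →
      (∀ f₀ : SMap.L2S n, SMap.besovNorm φ₀ σ f₀ < ⊤ →
        ∃ u : SMap.L2ST n, SMap.IsCutoffFree s ψ f₀ u ∧
          SMap.fNorm φ₀ s 𝓔 σ u ≤ C * SMap.besovNorm φ₀ σ f₀) ∧
      (∀ F : 𝓢'(SMap.SpaceTime n, ℂ), SMap.nNorm φ₀ s 𝓔 σ F < ⊤ →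
        ∃ f : SMap.L2ST n, SMap.IsCutoffDuhamel s ψ F f ∧
          SMap.fNorm φ₀ s 𝓔 σ f ≤ C * SMap.nNorm φ₀ s 𝓔 σ F ∧
          SMap.nNorm φ₀ s 𝓔 σ (f : 𝓢'(SMap.SpaceTime n, ℂ)) ≤ C * SMap.nNorm φ₀ s 𝓔 σ F) := by
  obtain ⟨C₁, h₁⟩ := SMap.exists_cutoffFree (n := n) hφ₀ (by linarith [hs.1] : 0 < s) hψ h𝓔
  obtain ⟨C₂, h₂⟩ := SMap.exists_cutoffDuhamel hφ₀ hs hψ (by omega : 1 ≤ n) h𝓔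
  refine ⟨C₁ + C₂, fun σ hσ => ⟨fun f₀ _ => ?_, fun F hF => ?_⟩⟩
  · obtain ⟨u, hu, hb⟩ := h₁ f₀
    refine ⟨u, hu, (SMap.tsum_enorm_le hb).trans ?_⟩
    push_cast
    exact mul_le_mul' le_self_add le_rfl
  · obtain ⟨f, hf, hb₁, hb₂⟩ := h₂ σ hσ F hF
    have h : (C₂ : ℝ≥0∞) * SMap.nNorm φ₀ s 𝓔 σ F ≤
        ((C₁ + C₂ : ℝ≥0) : ℝ≥0∞) * SMap.nNorm φ₀ s 𝓔 σ F := by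
      push_cast
      exact mul_le_mul' le_add_self le_rfl
    exact ⟨f, hf, hb₁.trans h, hb₂.trans h⟩
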